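/- Let $G$ be a connected complex semisimple Lie group with Lie algebra $\mathfrak g$, let $\sigma$ be an involutive automorphism of $G$ (as a real Lie group) and $\theta$ a Cartan involution of $G$ with $\sigma\theta=\theta\sigma$, and put $\tau=\sigma\theta$. Denote the differentials by the same letters, let $\mathfrak g=\mathfrak h\oplus\mathfrak q$, $\mathfrak g=\mathfrak k\oplus\mathfrak m$ be the $(+1,-1)$-eigenspace decompositions for $\sigma$ and $\theta$, and let $\mathfrak h'=\mathfrak g^\tau$. Let $H$ and $H'$ be the identity components of $G^\sigma$ and $G^\tau$, and assume that $H'$ is a simple Lie group and a real form of $G$, i.e. $\mathfrak h'$ is simple and $\mathfrak g=\mathfrak h'\oplus i\mathfrak h'$. Assume that $H'$ is of non-Hermitian type, i.e. the center of $\mathfrak k\cap\mathfrak h'$ is zero. Let $B$ be the Killing form of $\mathfrak g$ as a real Lie algebra. Let $\mathfrak t$ be a maximal abelian subspace of $\mathfrak k\cap\mathfrak q$ and $T=\exp\mathfrak t$. For a real linear form $\alpha:\mathfrak t\to i\mathbb R$ put $\mathfrak g(\mathfrak t,\alpha)=\{X\in\mathfrak g\mid [Y,X]=\alpha(Y)X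 \text{ for all } Y\in\mathfrak t\}$, and let $\Sigma(\mathfrak t)$ be the set of all $\alpha\neq0$ with $\mathfrak g(\mathfrak t,\alpha)\ne0$. Let $\alpha\in\Sigma(\mathfrak t)$ be a longest root (for the length defined by the Killing form), and suppose that $\dim_{\mathbb C}\mathfrak g(\mathfrak t,\alpha)=1$. Put $\mathfrak t_\alpha=\{Y\in\mathfrak t\mid\alpha(Y)=0\}$, let $Y_\alpha\in\mathfrak t$ be the element with $\alpha(Y_\alpha)=\pi i/2$ and $B(Y_\alpha,\mathfrak t_\alpha)=\{0\}$, and put $a_\alpha=\exp Y_\alpha$. Let $Z$ be a nonzero element of $(\mathfrak g(\mathfrak t,\alpha)\oplus\mathfrak g(\mathfrak t,-\alpha))\cap\mathfrak m\cap\mathfrak h'$ and put $Z'=\mathrm{Ad}(a_\alpha^{-1})Z$. Let $\widetilde{\mathfrak t}$ be a maximal abelian subalgebra of $\mathfrak k$ containing $\mathfrak t$, put $\mathfrak t_{\mathfrak h}=\widetilde{\mathfrak t}\cap\mathfrak h$, and let $$\mathfrak j=\mathbb R Z\oplus i\mathfrak t_\alpha\oplus i\mathfrak t_{\mathfrak h},\qquad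 \mathfrak j'=\mathrm{Ad}(a_\alpha^{-1})\mathfrak j .$$ Then there exists $t\in T\cap H$ such that $e^\alpha(t)=-1$ (that is, $e^{\alpha(Y)}=-1$ for every $Y\in\mathfrak t$ with $\exp Y=t$) and such that $\mathrm{Ad}(t)|_{\mathfrak j'}$ is the reflection with respect to $Z'$, i.e. $$\mathrm{Ad}(t)W=W-\frac{2B(W,Z')}{B(Z',Z')}\,Z'\qquad\text{for all } W\in\mathfrak j'.$$ -/

import Mathlib

open scoped Manifold ContDiff Pointwise

noncomputable section

namespace ComplexLie

/-- The Lie algebra `𝔤` of a complex Lie group `G` (the tangent space at the identity, with the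
bracket of left-invariant vector fields). -/
abbrev LieAlg (E G : Type*) [NormedAddCommGroup E] [NormedSpace ℂ E] [TopologicalSpace G]
    [ChartedSpace E G] [Group G] : Type _ :=
  GroupLieAlgebra 𝓘(ℂ, E) G

variable {E : Type*} [NormedAddCommGroup E] [NormedSpace ℂ E] [CompleteSpace E]
  {G : Type*} [TopologicalSpace G] [ChartedSpace E G] [Group G]

/-- `𝔤` regarded as a real Lie algebra. -/
instance instLieAlgebraReal [LieGroup 𝓘(ℂ, E) ω G] : LieAlgebra ℝ (LieAlg E G) where
  lie_smul r x y := by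
    rw [← Complex.coe_smul, ← Complex.coe_smul, lie_smul]

/-- The differential at the identity of a self-map `φ` of `G` fixing the identity, as a real linear
map of `𝔤` (so that it makes sense for antiholomorphic automorphisms as well). -/
def dAut (φ : G → G) : LieAlg E G →ₗ[ℝ] LieAlg E G where
  toFun X := mfderiv 𝓘(ℝ, E) 𝓘(ℝ, E) φ (1 : G) X
  map_add' X Y := ContinuousLinearMap.map_add (mfderiv 𝓘(ℝ, E) 𝓘(ℝ, E) φ (1 : G)) X Y
  map_smul' r X := ContinuousLinearMap.map_smul (mfderiv 𝓘(ℝ, E) 𝓘(ℝ, E) φ (1 : G)) r X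

/-- The adjoint action `Ad(g)` of `G` on `𝔤`. -/
def Ad (g : G) : LieAlg E G →ₗ[ℂ] LieAlg E G where
  toFun X := mfderiv 𝓘(ℂ, E) 𝓘(ℂ, E) (fun x : G => g * x * g⁻¹) (1 : G) X
  map_add' X Y := ContinuousLinearMap.map_add
    (mfderiv 𝓘(ℂ, E) 𝓘(ℂ, E) (fun x : G => g * x * g⁻¹) (1 : G)) X Y
  map_smul' c X := ContinuousLinearMap.map_smul
    (mfderiv 𝓘(ℂ, E) 𝓘(ℂ, E) (fun x : G => g * x * g⁻¹) (1 : G)) c X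

/-- `γ` is the one-parameter subgroup of `G` with initial velocity `X`. (A homomorphism `ℝ → G`
that is differentiable at `0` is automatically smooth.) -/
def IsOneParameterSubgroup (X : LieAlg E G) (γ : ℝ → G) : Prop :=
  (∀ s t : ℝ, γ (s + t) = γ s * γ t) ∧
    HasMFDerivAt 𝓘(ℝ, ℝ) 𝓘(ℝ, E) γ 0
      ((ContinuousLinearMap.toSpanSingleton ℝ (show E from X) : ℝ →L[ℝ] E))

open Classical in
/-- The exponential map of `G`: `exp X = γ 1`, where `γ` is the one-parameter subgroup with initial
velocity `X` (which exists and is unique in every Lie group). -/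
def lieExp (X : LieAlg E G) : G :=
  if h : ∃ γ : ℝ → G, IsOneParameterSubgroup X γ then h.choose 1 else 1

/-- The set of fixed points of `φ` in `𝔤`, i.e. its `+1`-eigenspace. -/
def plusSpace (φ : LieAlg E G →ₗ[ℝ] LieAlg E G) : Submodule ℝ (LieAlg E G) :=
  LinearMap.ker (φ - LinearMap.id)

/-- The `-1`-eigenspace of `φ` in `𝔤`. -/
def minusSpace (φ : LieAlg E G →ₗ[ℝ] LieAlg E G) : Submodule ℝ (LieAlg E G) :=
  LinearMap.ker (φ + LinearMap.id)

/-- An involutive automorphism of `G` as a real Lie group. -/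
def IsLieInvolution (E : Type*) [NormedAddCommGroup E] [NormedSpace ℂ E] {G : Type*}
    [TopologicalSpace G] [ChartedSpace E G] [Group G] (φ : G ≃* G) : Prop :=
  ContMDiff 𝓘(ℝ, E) 𝓘(ℝ, E) ∞ φ ∧ ∀ x, φ (φ x) = x

section Algebra

variable [LieGroup 𝓘(ℂ, E) ω G]

/-- The Killing form `B` of `𝔤` regarded as a real Lie algebra. -/
def B (X Y : LieAlg E G) : ℝ := killingForm ℝ (LieAlg E G) X Y

variable (E) in
/-- `θ` is a Cartan involution of `G`: an involution such that `-B(X, θ X)` is positive definite. -/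
def IsCartanInvolution (θ : G ≃* G) : Prop :=
  IsLieInvolution E θ ∧ ∀ X : LieAlg E G, X ≠ 0 → 0 < -B X (dAut θ X)

/-- `V` is an abelian subspace of `𝔤`. -/
def IsAbelianSubspace (V : Submodule ℝ (LieAlg E G)) : Prop :=
  ∀ X ∈ V, ∀ Y ∈ V, ⁅X, Y⁆ = 0

/-- `V` is a maximal abelian subspace of `S`. -/
def IsMaxAbelianIn (V S : Submodule ℝ (LieAlg E G)) : Prop :=
  Maximal (fun W : Submodule ℝ (LieAlg E G) => W ≤ S ∧ IsAbelianSubspace W) V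

/-- The real subspace `V` is a simple real Lie algebra under the bracket of `𝔤`. -/
def IsSimpleSubalgebra (V : Submodule ℝ (LieAlg E G)) : Prop :=
  ∃ L : LieSubalgebra ℝ (LieAlg E G), L.toSubmodule = V ∧ LieAlgebra.IsSimple ℝ L

/-- The real subspace `V` is a real form of `𝔤`: `𝔤 = V ⊕ iV`. -/
def IsRealForm (V : Submodule ℝ (LieAlg E G)) : Prop :=
  IsCompl V (Complex.I • V)

variable {𝔱 : Submodule ℝ (LieAlg E G)}

/-- The root space `𝔤(𝔱, α) = {X ∈ 𝔤 | [Y, X] = α(Y) X for all Y ∈ 𝔱}`, a complex subspace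
of `𝔤`. -/
def rootSpace (α : 𝔱 →ₗ[ℝ] ℂ) : Submodule ℂ (LieAlg E G) where
  carrier := {X | ∀ Y : 𝔱, ⁅(Y : LieAlg E G), X⁆ = α Y • X}
  add_mem' := by
    intro X X' hX hX' Y
    rw [lie_add, hX Y, hX' Y, smul_add]
  zero_mem' := by
    intro Y
    rw [lie_zero, smul_zero]
  smul_mem' := by
    intro c X hX Y
    rw [lie_smul, hX Y, smul_comm]

/-- The restricted root system `Σ(𝔱)`: nonzero linear forms `α : 𝔱 → iℝ` with
`𝔤(𝔱, α) ≠ 0`. -/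
def restrictedRoots (𝔱 : Submodule ℝ (LieAlg E G)) : Set (𝔱 →ₗ[ℝ] ℂ) :=
  {α | α ≠ 0 ∧ (∀ Y, (α Y).re = 0) ∧ rootSpace α ≠ ⊥}

/-- `A ∈ 𝔱` represents the linear form `α : 𝔱 → iℝ` through the Killing form, which is negative
definite on the subspaces `𝔱` of interest; then `-B(A, A)` is the squared length of `α`. -/
def Represents (A : 𝔱) (α : 𝔱 →ₗ[ℝ] ℂ) : Prop :=
  ∀ Y : 𝔱, α Y = -(B (A : LieAlg E G) (Y : LieAlg E G) : ℂ) * Complex.I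

/-- `α` is a longest root in `Σ(𝔱)`. -/
def IsLongestRoot (α : 𝔱 →ₗ[ℝ] ℂ) : Prop :=
  α ∈ restrictedRoots 𝔱 ∧ ∀ β ∈ restrictedRoots 𝔱, ∀ A C : 𝔱, Represents A α → Represents C β →
    -B (C : LieAlg E G) (C : LieAlg E G) ≤ -B (A : LieAlg E G) (A : LieAlg E G)

/-- `𝔱_α = {Y ∈ 𝔱 | α(Y) = 0}`. -/
def kerRoot (α : 𝔱 →ₗ[ℝ] ℂ) : Submodule ℝ (LieAlg E G) :=
  (LinearMap.ker α).map 𝔱.subtype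

/-- `Y` is the element `Y_α` of `𝔱` with `α(Y_α) = πi/2` and `B(Y_α, 𝔱_α) = 0`. -/
def IsYElement (α : 𝔱 →ₗ[ℝ] ℂ) (Y : 𝔱) : Prop :=
  α Y = (Real.pi / 2 : ℂ) * Complex.I ∧ ∀ W ∈ kerRoot α, B (Y : LieAlg E G) W = 0

/-- The subset `T = exp 𝔱` of `G`. -/
def torus (𝔱 : Submodule ℝ (LieAlg E G)) : Set G :=
  {g | ∃ Y : 𝔱, lieExp (Y : LieAlg E G) = g}

/-- The linear map `φ` restricts to `V` as the reflection with respect to the vector `Z ∈ V`, i.e.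
the orthogonal reflection for the Killing form that sends `Z` to `-Z`. -/
def IsReflectionOn (φ : LieAlg E G →ₗ[ℂ] LieAlg E G) (V : Submodule ℝ (LieAlg E G))
    (Z : LieAlg E G) : Prop :=
  Z ∈ V ∧ B Z Z ≠ 0 ∧ ∀ W ∈ V, φ W = W - (2 * B W Z / B Z Z) • Z

end Algebra

/-- Commuting involutions `σ` and `θ` of the complex Lie group `G`, `θ` a Cartan involution, such
that the Lie algebra `𝔥'` of the group `H' = (G^τ)_0`, `τ = σθ`, is a simple real form of `𝔤`. -/
structure RealFormData (E G : Type*) [NormedAddCommGroup E] [NormedSpace ℂ E] [CompleteSpace E]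
    [TopologicalSpace G] [ChartedSpace E G] [Group G] [LieGroup 𝓘(ℂ, E) ω G] where
  σ : G ≃* G
  θ : G ≃* G
  σ_involution : IsLieInvolution E σ
  θ_cartan : IsCartanInvolution E θ
  comm : ∀ x, σ (θ x) = θ (σ x)
  realForm : IsRealForm (plusSpace (dAut (E := E) (fun x : G => σ (θ x))))
  simple : IsSimpleSubalgebra (plusSpace (dAut (E := E) (fun x : G => σ (θ x))))

namespace RealFormData

variable [LieGroup 𝓘(ℂ, E) ω G] (D : RealFormData E G)

/-- `𝔥`, the Lie algebra of `H`. -/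
def 𝔥 : Submodule ℝ (LieAlg E G) := plusSpace (dAut D.σ)

/-- `𝔮`, the `-1`-eigenspace of `σ`. -/
def 𝔮 : Submodule ℝ (LieAlg E G) := minusSpace (dAut D.σ)

/-- `𝔨`, the `+1`-eigenspace of `θ`. -/
def 𝔨 : Submodule ℝ (LieAlg E G) := plusSpace (dAut D.θ)

/-- `𝔪`, the `-1`-eigenspace of `θ`. -/
def 𝔪 : Submodule ℝ (LieAlg E G) := minusSpace (dAut D.θ)

/-- `𝔥'`, the Lie algebra of the real form `H'`. -/
def 𝔥' : Submodule ℝ (LieAlg E G) := plusSpace (dAut (fun x : G => D.σ (D.θ x)))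

/-- `H`, the connected component of the identity of `G^σ`. -/
def H : Set G := connectedComponentIn {x | D.σ x = x} 1

/-- `H'` is of Hermitian type: the Lie algebra `𝔨 ∩ 𝔥'` of its maximal compact subgroup has a
nonzero center. -/
def IsHermitianType : Prop :=
  ∃ X ∈ D.𝔨 ⊓ D.𝔥', X ≠ 0 ∧ ∀ Y ∈ D.𝔨 ⊓ D.𝔥', ⁅X, Y⁆ = 0

/-- `Z` is a nonzero element of the sum of the root spaces for `α` and `-α` lying in `𝔪 ∩ 𝔥'`. -/
def IsZElement {𝔱 : Submodule ℝ (LieAlg E G)} (α : 𝔱 →ₗ[ℝ] ℂ) (Z : LieAlg E G) : Prop :=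
  Z ≠ 0 ∧ Z ∈ D.𝔪 ∧ Z ∈ D.𝔥' ∧ Z ∈ rootSpace α ⊔ rootSpace (-α)

/-- `𝔧 = ℝZ ⊕ i𝔱_α ⊕ i𝔱_𝔥` where `𝔱_𝔥 = 𝔱' ∩ 𝔥` for a maximal abelian subalgebra `𝔱'` of `𝔨`
containing `𝔱`. -/
def 𝔧 {𝔱 : Submodule ℝ (LieAlg E G)} (𝔱' : Submodule ℝ (LieAlg E G)) (α : 𝔱 →ₗ[ℝ] ℂ)
    (Z : LieAlg E G) : Submodule ℝ (LieAlg E G) :=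
  Submodule.span ℝ {Z} ⊔ Complex.I • kerRoot α ⊔ Complex.I • (𝔱' ⊓ D.𝔥)

end RealFormData

end ComplexLie

end

/-!
Equip `𝔥'` with the inner product `-B(x, θ y)` and consider its Cartan subspace `i𝔱`. Then `α` is a
longest restricted root of multiplicity one; let `e` be a root vector, so that `(ad e)²` has rank
one.

The heart of the matter is that some longest root different from `α` has positive inner product
with `α`. Otherwise consider the cone of all `u` with `(ad u)² = c ⟨u, θ ·⟩ u`. Along the flow of an
element of the cone the height `⟨·, e⟩` of a point of the cone is a quadratic polynomial, and its
zeros are double, so these flows preserve the closure of the part of the cone with positive height.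
As `𝔥'` is simple the cone spans it, and by the Lie product formula all flows `exp (ad y)` preserve
this closure. Hence the elements of the orbit of `e` under `exp (ad (𝔨 ∩ 𝔥'))` have nonnegative
height, and the point of least norm in the closed convex hull of this orbit is nonzero and fixed by
`𝔨 ∩ 𝔥'`. It yields a nonzero element of the center of `𝔨 ∩ 𝔥'`, which is trivial as `H'` is of
non-Hermitian type.

A longest root `β ≠ α` with `⟨α, β⟩ > 0` has a coroot `A` with `α(A) = 1`, part of an `𝔰𝔩₂`-triple
`(A, X, -θX)` in `𝔥'`. The element `t = exp(πiA)` satisfies `e^α(t) = -1`, and by the Cayley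
transform it equals `exp(π(X + θX))`, which lies in `H` because `σ = τθ` exchanges `X` and `θX`.
Finally `Ad t` negates `Z'` and fixes the centralizer of `𝔱`, which contains the part of `𝔧'`
orthogonal to `Z'`.
-/

open Filter Topology
open scoped RealInnerProductSpace

section ExponentialFlows

open NormedSpace

lemma norm_pow_sub_pow_le_of_norm_le {𝔸 : Type*} [NormedRing 𝔸] {a b : 𝔸} {c : ℝ} (hc : 1 ≤ c)
    (ha : ‖a‖ ≤ c) (hb : ‖b‖ ≤ c) (n : ℕ) : ‖a ^ n - b ^ n‖ ≤ n * c ^ n * ‖a - b‖ := by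
  induction n with
  | zero => simp
  | succ n ih =>
    have hb' : ‖b ^ n * (a - b)‖ ≤ c ^ n * ‖a - b‖ := by
      rcases Nat.eq_zero_or_pos n with rfl | hn
      · simp
      · exact norm_mul_le_of_le ((norm_pow_le' b hn).trans (by gcongr)) le_rfl
    have ha' : ‖(a ^ n - b ^ n) * a‖ ≤ n * c ^ n * ‖a - b‖ * c := norm_mul_le_of_le ih ha
    calc ‖a ^ (n + 1) - b ^ (n + 1)‖ = ‖(a ^ n - b ^ n) * a + b ^ n * (a - b)‖ := by
          rw [pow_succ, pow_succ]; noncomm_ring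
      _ ≤ n * c ^ n * ‖a - b‖ * c + c ^ n * ‖a - b‖ := norm_add_le_of_le ha' hb'
      _ ≤ n * c ^ n * ‖a - b‖ * c + c ^ (n + 1) * ‖a - b‖ := by gcongr; exact Nat.le_succ n
      _ = ((n + 1 : ℕ) : ℝ) * c ^ (n + 1) * ‖a - b‖ := by push_cast; ring

lemma tendsto_natCast_smul_sub_of_hasDerivAt {F : Type*} [NormedAddCommGroup F] [NormedSpace ℝ F]
    {f : ℝ → F} {f' : F} (h : HasDerivAt f f' 0) :
    Tendsto (fun n : ℕ => (n : ℝ) • (f (n : ℝ)⁻¹ - f 0)) atTop (𝓝 f') := by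
  have hinv : Tendsto (fun n : ℕ => (n : ℝ)⁻¹) atTop (𝓝[>] 0) :=
    tendsto_inv_atTop_nhdsGT_zero.comp tendsto_natCast_atTop_atTop
  simpa [Function.comp_def] using h.tendsto_slope_zero_right.comp hinv

variable {𝔸 : Type*} [NormedRing 𝔸] [NormedAlgebra ℝ 𝔸]

lemma eventually_norm_le_one_add_div [NormOneClass 𝔸] {f : ℝ → 𝔸} {f' : 𝔸}
    (h : HasDerivAt f f' 0) (h0 : f 0 = 1) :
    ∀ᶠ n : ℕ in atTop, ‖f (n : ℝ)⁻¹‖ ≤ 1 + (‖f'‖ + 1) / n := by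
  have hlim := (tendsto_natCast_smul_sub_of_hasDerivAt h).norm.eventually_le_const (lt_add_one _)
  filter_upwards [hlim, eventually_gt_atTop 0] with n hn hpos
  rw [norm_smul, Real.norm_natCast, h0, mul_comm, ← le_div_iff₀ (Nat.cast_pos.2 hpos)] at hn
  calc ‖f (n : ℝ)⁻¹‖ = ‖1 + (f (n : ℝ)⁻¹ - 1)‖ := by rw [add_sub_cancel]
    _ ≤ 1 + (‖f'‖ + 1) / n := norm_add_le_of_le norm_one.le hn

/-- Two curves through `1` with the same velocity have the same limit of `n`-th powers: both
`‖f (1 / n)‖` and `‖g (1 / n)‖` are at most `1 + M / n`, hence their `n`-th powers are bounded by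
`exp M`. -/
lemma tendsto_pow_sub_pow_of_hasDerivAt [NormOneClass 𝔸] {f g : ℝ → 𝔸} {v : 𝔸}
    (hf : HasDerivAt f v 0) (hg : HasDerivAt g v 0) (hf0 : f 0 = 1) (hg0 : g 0 = 1) :
    Tendsto (fun n : ℕ => f (n : ℝ)⁻¹ ^ n - g (n : ℝ)⁻¹ ^ n) atTop (𝓝 0) := by
  set M : ℝ := ‖v‖ + 1
  have : 0 ≤ M := by positivity
  have hlim := tendsto_natCast_smul_sub_of_hasDerivAt (hf.fun_sub hg)
  rw [sub_self, hf0, hg0, sub_self] at hlim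
  refine squeeze_zero_norm' ?_ (by simpa using hlim.norm.const_mul (Real.exp M))
  filter_upwards [eventually_norm_le_one_add_div hf hf0, eventually_norm_le_one_add_div hg hg0,
    eventually_gt_atTop 0] with n hfn hgn hn
  have hpow : (1 + M / n) ^ n ≤ Real.exp M := by
    have h := pow_le_pow_left₀ (by positivity) (Real.add_one_le_exp (M / n)) n
    rwa [← Real.exp_nat_mul, mul_div_cancel₀ _ (Nat.cast_pos.2 hn).ne', add_comm] at h
  have hone : 1 ≤ 1 + M / n := le_add_of_nonneg_right (by positivity)
  calc ‖f (n : ℝ)⁻¹ ^ n - g (n : ℝ)⁻¹ ^ n‖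
      ≤ n * (1 + M / n) ^ n * ‖f (n : ℝ)⁻¹ - g (n : ℝ)⁻¹‖ :=
        norm_pow_sub_pow_le_of_norm_le hone hfn hgn n
    _ ≤ n * Real.exp M * ‖f (n : ℝ)⁻¹ - g (n : ℝ)⁻¹‖ := by gcongr
    _ = Real.exp M * ‖(n : ℝ) • (f (n : ℝ)⁻¹ - g (n : ℝ)⁻¹)‖ := by
        rw [norm_smul, Real.norm_natCast]; ring

lemma tendsto_exp_mul_exp_pow [CompleteSpace 𝔸] [NormOneClass 𝔸] (X Y : 𝔸) :
    Tendsto (fun n : ℕ => (exp ((n : ℝ)⁻¹ • X) * exp ((n : ℝ)⁻¹ • Y)) ^ n) atTop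
      (𝓝 (exp (X + Y))) := by
  have hprod : HasDerivAt (fun s : ℝ => exp (s • X) * exp (s • Y)) (X + Y) 0 := by
    simpa using (hasDerivAt_exp_smul_const X (0 : ℝ)).fun_mul (hasDerivAt_exp_smul_const Y (0 : ℝ))
  have hsum : HasDerivAt (fun s : ℝ => exp (s • (X + Y))) (X + Y) 0 := by
    simpa [-smul_add] using hasDerivAt_exp_smul_const (X + Y) (0 : ℝ)
  have hlim := tendsto_pow_sub_pow_of_hasDerivAt hprod hsum (by simp) (by simp)
  refine (zero_add (exp (X + Y)) ▸ hlim.add_const (exp (X + Y))).congr' ?_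
  filter_upwards [eventually_gt_atTop 0] with n hn
  let _ : NormedAlgebra ℚ 𝔸 := NormedAlgebra.restrictScalars ℚ ℝ 𝔸
  rw [← exp_nsmul, ← Nat.cast_smul_eq_nsmul ℝ, smul_inv_smul₀ (Nat.cast_pos.2 hn).ne',
    sub_add_cancel]

lemma eq_exp_smul_apply_of_hasDerivAt {F : Type*} [NormedAddCommGroup F] [NormedSpace ℝ F]
    [CompleteSpace F] {A : F →L[ℝ] F} {f : ℝ → F} (hf : ∀ s, HasDerivAt f (A (f s)) s) (s : ℝ) :
    f s = exp (s • A) (f 0) := by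
  have hconst : ∀ s : ℝ, HasDerivAt (fun s : ℝ => exp (s • (-A)) (f s)) 0 s := fun s => by
    simpa using (hasDerivAt_exp_smul_const (-A) s).clm_apply (hf s)
  have h0 := is_const_of_deriv_eq_zero (fun s => (hconst s).differentiableAt)
    (fun s => (hconst s).deriv) s 0
  simp only [smul_neg, zero_smul, neg_zero, exp_zero, one_apply_eq_self] at h0
  let _ : NormedAlgebra ℚ (F →L[ℝ] F) := NormedAlgebra.restrictScalars ℚ ℝ _
  have hinv : exp (s • A) * exp (-(s • A)) = 1 := by
    rw [← exp_add_of_commute (Commute.refl (s • A)).neg_right, add_neg_cancel, exp_zero]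
  rw [← h0, ← mul_apply_eq_comp, hinv, one_apply_eq_self]

lemma exp_apply_of_apply_eq_smul {F : Type*} [NormedAddCommGroup F] [NormedSpace ℝ F]
    [CompleteSpace F] {A : F →L[ℝ] F} {x : F} {r : ℝ} (hx : A x = r • x) :
    exp A x = Real.exp r • x := by
  have hderiv : ∀ s : ℝ, HasDerivAt (fun s : ℝ => Real.exp (s * r) • x)
      (A (Real.exp (s * r) • x)) s := fun s => by
    simpa [hx, smul_smul] using ((hasDerivAt_mul_const r (x := s)).exp).smul_const x
  simpa using (eq_exp_smul_apply_of_hasDerivAt hderiv 1).symm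

end ExponentialFlows

section FixedVectors

lemma exists_mem_forall_eq_of_norm_le {V : Type*} [NormedAddCommGroup V] [InnerProductSpace ℝ V]
    [CompleteSpace V] {Q : Set V} (hne : Q.Nonempty) (hclosed : IsClosed Q) (hconv : Convex ℝ Q) :
    ∃ w ∈ Q, ∀ x ∈ Q, ‖x‖ ≤ ‖w‖ → x = w := by
  obtain ⟨w, hwQ, hw⟩ := exists_norm_eq_iInf_of_complete_convex hne hclosed.isComplete hconv 0
  rw [norm_eq_iInf_iff_real_inner_le_zero hconv hwQ] at hw
  refine ⟨w, hwQ, fun x hx hle => ?_⟩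
  have hinner := hw x hx
  rw [zero_sub, inner_neg_left, inner_sub_right, real_inner_self_eq_norm_sq] at hinner
  have hsq := norm_sub_sq_real x w
  rw [real_inner_comm] at hsq
  have hle' : ‖x‖ ^ 2 ≤ ‖w‖ ^ 2 := by gcongr
  exact sub_eq_zero.1 (norm_eq_zero.1 (sq_eq_zero_iff.1 (by nlinarith [sq_nonneg ‖x - w‖])))

variable {V : Type*} [NormedAddCommGroup V] [InnerProductSpace ℝ V] [FiniteDimensional ℝ V]

/-- The vector is the sum of the elements of a finite `r / 2`-net in `S`. -/
lemma exists_half_sq_le_inner_of_inner_nonneg {S : Set V} {r : ℝ} (hr : 0 < r)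
    (hnorm : ∀ x ∈ S, ‖x‖ = r) (hinner : ∀ x ∈ S, ∀ y ∈ S, 0 ≤ ⟪x, y⟫) :
    ∃ y, ∀ x ∈ S, r ^ 2 / 2 ≤ ⟪x, y⟫ := by
  have hbdd : Bornology.IsBounded S :=
    isBounded_iff_forall_norm_le.2 ⟨r, fun x hx => (hnorm x hx).le⟩
  obtain ⟨F, hFS, hF, hcover⟩ := Metric.finite_approx_of_totallyBounded
    (hbdd.isCompact_closure.totallyBounded.subset subset_closure) (r / 2) (by positivity)
  refine ⟨∑ x ∈ hF.toFinset, x, fun x hx => ?_⟩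
  obtain ⟨z, hz, hxz⟩ := Set.mem_iUnion₂.1 (hcover hx)
  have hle : ⟪x, z⟫ ≤ ⟪x, ∑ z ∈ hF.toFinset, z⟫ := by
    rw [inner_sum]
    exact Finset.single_le_sum (f := fun z => ⟪x, z⟫)
      (fun i hi => hinner x hx i (hFS (hF.mem_toFinset.1 hi))) (hF.mem_toFinset.2 hz)
  refine le_trans ?_ hle
  have hdist : ‖x - z‖ < r / 2 := by rwa [← dist_eq_norm]
  have hcs := abs_le.1 (abs_real_inner_le_norm (x - z) z)
  rw [inner_sub_left, real_inner_self_eq_norm_sq, hnorm z (hFS hz)] at hcs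
  nlinarith

/-- The fixed vector is the element of least norm of the closed convex hull of the orbit. -/
theorem exists_fixed_vector_of_inner_nonneg (K : Submonoid (V →L[ℝ] V))
    (hiso : ∀ k ∈ K, ∀ x, ‖k x‖ = ‖x‖) {e : V} (he : e ≠ 0)
    (hpos : ∀ k ∈ K, ∀ k' ∈ K, 0 ≤ ⟪k e, k' e⟫) : ∃ w ≠ 0, ∀ k ∈ K, k w = w := by
  set S : Set V := (fun k : V →L[ℝ] V => k e) '' K
  have hr : 0 < ‖e‖ := norm_pos_iff.2 he
  obtain ⟨y, hy⟩ := exists_half_sq_le_inner_of_inner_nonneg (S := S) hr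
    (Set.forall_mem_image.2 fun k hk => hiso k hk e)
    (Set.forall_mem_image.2 fun k hk => Set.forall_mem_image.2 (hpos k hk))
  set Q : Set V := closure (convexHull ℝ S)
  have heQ : e ∈ Q := subset_closure (subset_convexHull ℝ S ⟨1, K.one_mem, rfl⟩)
  have hconv : Convex ℝ {x : V | ‖e‖ ^ 2 / 2 ≤ ⟪x, y⟫} := convex_halfSpace_ge
    ⟨fun a b => inner_add_left a b y, fun c a => real_inner_smul_left a y c⟩ _
  have hQy : Q ⊆ {x : V | ‖e‖ ^ 2 / 2 ≤ ⟪x, y⟫} := closure_minimal (convexHull_min hy hconv)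
    (isClosed_le continuous_const (continuous_id.inner continuous_const))
  have hQK : ∀ k ∈ K, Set.MapsTo k Q Q := by
    intro k hk
    have hS : Set.MapsTo k S S :=
      Set.mapsTo_image_iff.2 fun k' hk' => ⟨k * k', K.mul_mem hk hk', rfl⟩
    refine Set.MapsTo.closure (Set.mapsTo_iff_image_subset.2 ?_) k.continuous
    exact (LinearMap.image_convexHull k.toLinearMap S).trans_subset
      (convexHull_mono hS.image_subset)
  obtain ⟨w, hwQ, hw⟩ := exists_mem_forall_eq_of_norm_le ⟨e, heQ⟩ isClosed_closure
    (convex_convexHull ℝ S).closure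
  refine ⟨w, ?_, fun k hk => hw _ (hQK k hk hwQ) (hiso k hk w).le⟩
  rintro rfl
  have hle : ‖e‖ ^ 2 / 2 ≤ ⟪0, y⟫ := hQy hwQ
  rw [inner_zero_left] at hle
  nlinarith

end FixedVectors

/-! ### Flows of a Euclidean Cartan algebra -/

lemma dense_setOf_quadratic_pos {a b d : ℝ} (ha : 0 < a)
    (hdouble : ∀ t, a + b * t + d * t ^ 2 = 0 → b + 2 * d * t = 0) :
    Dense {t : ℝ | 0 < a + b * t + d * t ^ 2} := by
  by_cases hroot : ∃ r, a + b * r + d * r ^ 2 = 0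
  · obtain ⟨r, hr⟩ := hroot
    have hsq : ∀ t, a + b * t + d * t ^ 2 = d * (t - r) ^ 2 := fun t => by
      linear_combination hdouble r hr * (t - r) + hr
    have hd : 0 < d := pos_of_mul_pos_left (b := (0 - r) ^ 2) (by linarith [hsq 0]) (sq_nonneg _)
    refine (dense_compl_singleton r).mono fun t ht => ?_
    have : t - r ≠ 0 := sub_ne_zero.2 ht
    have hpos : 0 < a + b * t + d * t ^ 2 := by rw [hsq]; positivity
    exact hpos
  · refine dense_univ.mono fun t _ => ?_
    by_contra hneg
    have hcont : Continuous fun t : ℝ => a + b * t + d * t ^ 2 := by fun_prop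
    exact hroot (mem_range_of_exists_le_of_exists_ge hcont ⟨t, not_lt.1 hneg⟩
      ⟨0, by simpa using ha.le⟩)

/-- A Lie bracket on a Euclidean space together with a Cartan involution `θ`, such that the inner
product is `⟪x, y⟫ = -b (x, θ y)` for an invariant bilinear form `b`. The bracket is a field, since
the instances `LieRing V` and `NormedAddCommGroup V` would carry two unrelated additions. -/
structure EuclideanCartanAlgebra (V : Type*) [NormedAddCommGroup V] [InnerProductSpace ℝ V] where
  br : V →ₗ[ℝ] V →ₗ[ℝ] V
  br_self : ∀ x, br x x = 0
  jacobi : ∀ x y z, br x (br y z) = br (br x y) z + br y (br x z)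
  θ : V →ₗ[ℝ] V
  θ_θ : ∀ x, θ (θ x) = x
  θ_br : ∀ x y, θ (br x y) = br (θ x) (θ y)
  inner_θ : ∀ x y, ⟪θ x, θ y⟫ = ⟪x, y⟫
  inner_br : ∀ x y z, ⟪br x y, z⟫ = -⟪y, br (θ x) z⟫

namespace EuclideanCartanAlgebra

open NormedSpace

variable {V : Type*} [NormedAddCommGroup V] [InnerProductSpace ℝ V] (D : EuclideanCartanAlgebra V)

/-- The Lie algebra `V` is simple: it is not abelian and has no nontrivial ideals. -/
structure IsSimple : Prop where
  exists_br_ne_zero : ∃ x y, D.br x y ≠ 0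
  eq_bot_or_eq_top : ∀ W : Submodule ℝ V, (∀ x, ∀ y ∈ W, D.br x y ∈ W) → W = ⊥ ∨ W = ⊤

/-- The cone of elements `u` for which `(ad u)²` is the rank one operator attached to `u` and to
the constant `c`; long root vectors are of this kind. -/
def rankOneCone (c : ℝ) : Set V := {u | ∀ x, D.br u (D.br u x) = (c * ⟪u, D.θ x⟫) • u}

/-- The part of the rank one cone on which the height `⟪·, e⟫` is positive. -/
def positiveCone (c : ℝ) (e : V) : Set V := {u | u ∈ D.rankOneCone c ∧ 0 < ⟪u, e⟫}

lemma br_swap (x y : V) : D.br x y = -D.br y x := by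
  have h := D.br_self (x + y)
  simp only [map_add, LinearMap.add_apply, D.br_self, zero_add, add_zero] at h
  exact eq_neg_of_add_eq_zero_right h

variable {D} in
lemma IsSimple.eq_zero_of_forall_br_eq_zero (hD : D.IsSimple) {x : V} (hx : ∀ y, D.br y x = 0) :
    x = 0 := by
  let center : Submodule ℝ V :=
    { carrier := {x | ∀ y, D.br y x = 0}
      add_mem' := fun ha hb y => by rw [map_add, ha y, hb y, add_zero]
      zero_mem' := fun y => map_zero _
      smul_mem' := fun r a ha y => by rw [map_smul, ha y, smul_zero] }
  rcases hD.eq_bot_or_eq_top center fun x y hy z => by rw [hy x, map_zero] with h | h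
  · exact (Submodule.eq_bot_iff _).1 h x hx
  · obtain ⟨y, z, hyz⟩ := hD.exists_br_ne_zero
    exact absurd ((h ▸ Submodule.mem_top : z ∈ center) y) hyz

variable {D} in
lemma IsSimple.add_θ_ne_zero (hD : D.IsSimple) {w : V} (hw0 : w ≠ 0)
    (hw : ∀ y, D.θ y = y → D.br y w = 0) : w + D.θ w ≠ 0 := by
  intro h
  have hθw : D.θ w = -w := eq_neg_of_add_eq_zero_right h
  have hanti : ∀ y, D.θ y = -y → D.br y w = 0 := by
    intro y hy
    have hfix : D.θ (D.br y w) = D.br y w := by rw [D.θ_br, hθw, hy]; simp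
    have hz : D.br w (D.br y w) = 0 := by rw [D.br_swap, hw _ hfix, neg_zero]
    rw [← inner_self_eq_zero (𝕜 := ℝ)]
    calc ⟪D.br y w, D.br y w⟫ = ⟪y, D.br (D.θ w) (D.br y w)⟫ := by
          rw [D.br_swap y w, inner_neg_left, D.inner_br, neg_neg]
      _ = 0 := by rw [hθw, map_neg, LinearMap.neg_apply, hz, neg_zero, inner_zero_right]
  refine hw0 (hD.eq_zero_of_forall_br_eq_zero fun y => ?_)
  have hplus := hw (y + D.θ y) (by rw [map_add, D.θ_θ, add_comm])
  have hminus := hanti (y - D.θ y) (by rw [map_sub, D.θ_θ, neg_sub])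
  have hsum : D.br ((2 : ℝ) • y) w = 0 := by
    rw [show (2 : ℝ) • y = (y + D.θ y) + (y - D.θ y) by rw [two_smul]; abel, map_add,
      LinearMap.add_apply, hplus, hminus, add_zero]
  simpa using hsum

variable [FiniteDimensional ℝ V]

/-- The adjoint operator `ad x` as a continuous linear map. -/
noncomputable def ad : V →ₗ[ℝ] V →L[ℝ] V :=
  (LinearMap.toContinuousLinearMap : (V →ₗ[ℝ] V) ≃ₗ[ℝ] V →L[ℝ] V).toLinearMap ∘ₗ D.br

@[simp] lemma ad_apply (x y : V) : D.ad x y = D.br x y := rfl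

lemma hasDerivAt_exp_ad (x y : V) (s : ℝ) :
    HasDerivAt (fun s : ℝ => exp (s • D.ad x) y) (D.br x (exp (s • D.ad x) y)) s := by
  simpa using (hasDerivAt_exp_smul_const' (D.ad x) s).clm_apply (hasDerivAt_const s y)

lemma exp_ad_exp_neg_ad (x y : V) : exp (D.ad x) (exp (-D.ad x) y) = y := by
  let _ : NormedAlgebra ℚ (V →L[ℝ] V) := NormedAlgebra.restrictScalars ℚ ℝ _
  have h : exp (D.ad x) * exp (-D.ad x) = 1 := by
    rw [← exp_add_of_commute (Commute.refl (D.ad x)).neg_right, add_neg_cancel, exp_zero]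
  exact DFunLike.congr_fun h y

lemma exp_ad_br (x y z : V) :
    exp (D.ad x) (D.br y z) = D.br (exp (D.ad x) y) (exp (D.ad x) z) := by
  have hderiv : ∀ s : ℝ, HasDerivAt
      (fun s : ℝ => D.br (exp (s • D.ad x) y) (exp (s • D.ad x) z))
      (D.ad x (D.br (exp (s • D.ad x) y) (exp (s • D.ad x) z))) s := fun s => by
    have h := ((LinearMap.toContinuousLinearMap D.ad).hasFDerivAt.comp_hasDerivAt s
      (D.hasDerivAt_exp_ad x y s)).clm_apply (D.hasDerivAt_exp_ad x z s)
    simpa [D.jacobi x] using h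
  simpa using (eq_exp_smul_apply_of_hasDerivAt hderiv 1).symm

lemma θ_exp_ad (x y : V) : D.θ (exp (D.ad x) y) = exp (D.ad (D.θ x)) (D.θ y) := by
  have hderiv : ∀ s : ℝ, HasDerivAt (fun s : ℝ => D.θ (exp (s • D.ad x) y))
      (D.ad (D.θ x) (D.θ (exp (s • D.ad x) y))) s := fun s => by
    rw [ad_apply, ← θ_br]
    exact (LinearMap.toContinuousLinearMap D.θ).hasFDerivAt.comp_hasDerivAt s
      (D.hasDerivAt_exp_ad x y s)
  simpa using eq_exp_smul_apply_of_hasDerivAt hderiv 1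

lemma inner_exp_ad_exp_ad (x y z : V) :
    ⟪exp (D.ad x) y, exp (D.ad (D.θ x)) z⟫ = ⟪y, z⟫ := by
  have hconst : ∀ s : ℝ, HasDerivAt (fun s : ℝ =>
      ⟪exp (s • D.ad x) y, exp (s • D.ad (D.θ x)) z⟫) 0 s := fun s => by
    simpa [D.inner_br x] using
      (D.hasDerivAt_exp_ad x y s).inner ℝ (D.hasDerivAt_exp_ad (D.θ x) z s)
  simpa using is_const_of_deriv_eq_zero (fun s => (hconst s).differentiableAt)
    (fun s => (hconst s).deriv) 1 0

lemma inner_exp_ad (x y z : V) :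
    ⟪exp (D.ad x) y, z⟫ = ⟪y, exp (-D.ad (D.θ x)) z⟫ := by
  rw [← D.inner_exp_ad_exp_ad x y, exp_ad_exp_neg_ad]

variable {D} {c : ℝ} {e : V}

lemma exp_ad_mem_rankOneCone {u : V} (hu : u ∈ D.rankOneCone c) (x : V) :
    exp (D.ad x) u ∈ D.rankOneCone c := by
  intro z
  obtain ⟨y, rfl⟩ : ∃ y, exp (D.ad x) y = z := ⟨_, D.exp_ad_exp_neg_ad x z⟩
  rw [← exp_ad_br, ← exp_ad_br, hu y, θ_exp_ad, inner_exp_ad_exp_ad, map_smul]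

lemma exp_smul_ad_apply_of_mem {X : V} (hX : X ∈ D.rankOneCone c) (s : ℝ) (y : V) :
    exp (s • D.ad X) y = y + s • D.br X y + (s ^ 2 / 2) • D.br X (D.br X y) := by
  have hcube : D.ad X ^ 3 = 0 := by
    ext y
    simp [pow_succ, hX y, D.br_self]
  have hexp : exp (s • D.ad X) =
      ∑ n ∈ Finset.range 3, (n.factorial : ℝ)⁻¹ • (s • D.ad X) ^ n := by
    simp only [exp_eq_tsum ℝ]
    refine tsum_eq_sum fun n hn => ?_
    obtain ⟨k, rfl⟩ := Nat.exists_eq_add_of_le (not_lt.1 (mt Finset.mem_range.2 hn))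
    rw [pow_add, smul_pow, hcube, smul_zero, zero_mul, smul_zero]
  rw [hexp]
  simp [Finset.sum_range_succ, pow_succ, smul_smul, div_eq_inv_mul]

lemma exp_smul_ad_mem_closure_positiveCone
    (hcrit : ∀ u ∈ D.rankOneCone c, ⟪u, e⟫ = 0 → D.br u (D.θ e) = 0)
    {X : V} (hX : X ∈ D.rankOneCone c) (s : ℝ) {u : V} (hu : u ∈ D.positiveCone c e) :
    exp (s • D.ad X) u ∈ closure (D.positiveCone c e) := by
  have hmem : ∀ t : ℝ, exp (t • D.ad X) u ∈ D.rankOneCone c := fun t => by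
    rw [← map_smul]; exact exp_ad_mem_rankOneCone hu.1 _
  have hcrit' : ∀ t : ℝ, ⟪exp (t • D.ad X) u, e⟫ = 0 → ⟪D.br X (exp (t • D.ad X) u), e⟫ = 0 := by
    intro t ht
    have h := congrArg D.θ (hcrit _ (hmem t) ht)
    rw [D.θ_br, D.θ_θ, map_zero] at h
    rw [D.br_swap, inner_neg_left, D.inner_br, neg_neg, h, inner_zero_right]
  have hheight : ∀ t : ℝ, ⟪exp (t • D.ad X) u, e⟫ =
      ⟪u, e⟫ + ⟪D.br X u, e⟫ * t + ⟪D.br X (D.br X u), e⟫ / 2 * t ^ 2 := fun t => by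
    simp only [exp_smul_ad_apply_of_mem hX, inner_add_left, real_inner_smul_left]
    ring
  have hderiv : ∀ t : ℝ, ⟪D.br X (exp (t • D.ad X) u), e⟫ =
      ⟪D.br X u, e⟫ + 2 * (⟪D.br X (D.br X u), e⟫ / 2) * t := fun t => by
    simp only [exp_smul_ad_apply_of_mem hX, hX u, map_add, map_smul, D.br_self, smul_zero,
      inner_add_left, inner_zero_left, real_inner_smul_left]
    ring
  have hdense := dense_setOf_quadratic_pos hu.2 fun t ht =>
    (hderiv t).symm.trans (hcrit' t ((hheight t).trans ht))
  have hcont : Continuous fun t : ℝ => exp (t • D.ad X) u :=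
    continuous_iff_continuousAt.2 fun t => (D.hasDerivAt_exp_ad X u t).continuousAt
  exact map_mem_closure (f := fun t : ℝ => exp (t • D.ad X) u) hcont (hdense s)
    fun t ht => ⟨hmem t, (hheight t).symm ▸ ht⟩

/-- By the Lie product formula. -/
lemma mapsTo_exp_ad_add {C : Set V} (hC : IsClosed C) {X Y : V}
    (hX : ∀ s : ℝ, Set.MapsTo (exp (s • D.ad X) : V →L[ℝ] V) C C)
    (hY : ∀ s : ℝ, Set.MapsTo (exp (s • D.ad Y) : V →L[ℝ] V) C C) (s : ℝ) :
    Set.MapsTo (exp (s • D.ad (X + Y)) : V →L[ℝ] V) C C := by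
  intro u hu
  rcases subsingleton_or_nontrivial V with hV | hV
  · rwa [Subsingleton.elim ((exp (s • D.ad (X + Y)) : V →L[ℝ] V) u) u]
  rw [map_add, smul_add]
  refine hC.mem_of_tendsto (((ContinuousLinearMap.apply ℝ V u).continuous.tendsto _).comp
    (tendsto_exp_mul_exp_pow (s • D.ad X) (s • D.ad Y))) (Eventually.of_forall fun n => ?_)
  have hstep : Set.MapsTo (exp ((n : ℝ)⁻¹ • s • D.ad X) *
      exp ((n : ℝ)⁻¹ • s • D.ad Y) : V →L[ℝ] V) C C := by
    rw [smul_smul, smul_smul]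
    exact (hX _).comp (hY _)
  simpa [FunLike.coe_pow] using hstep.iterate n hu

lemma span_rankOneCone_eq_top (hD : D.IsSimple) (he : e ∈ D.rankOneCone c) (he0 : e ≠ 0) :
    Submodule.span ℝ (D.rankOneCone c) = ⊤ := by
  refine (hD.eq_bot_or_eq_top _ fun x y hy => ?_).resolve_left fun h =>
    he0 ((Submodule.eq_bot_iff _).1 h e (Submodule.subset_span he))
  induction hy using Submodule.span_induction with
  | mem y hy =>
    have hlim := (D.hasDerivAt_exp_ad x y 0).tendsto_slope_zero_right
    simp only [zero_smul, exp_zero, one_apply_eq_self, zero_add] at hlim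
    refine (Submodule.closed_of_finiteDimensional _).mem_of_tendsto hlim
      (Eventually.of_forall fun t => ?_)
    refine Submodule.smul_mem _ _ (Submodule.sub_mem _ (Submodule.subset_span ?_)
      (Submodule.subset_span hy))
    rw [← map_smul]
    exact exp_ad_mem_rankOneCone hy _
  | zero => rw [map_zero]; exact Submodule.zero_mem _
  | add y z _ _ hy hz => rw [map_add]; exact Submodule.add_mem _ hy hz
  | smul a y _ hy => rw [map_smul]; exact Submodule.smul_mem _ _ hy

lemma mapsTo_exp_ad_closure_positiveCone (hD : D.IsSimple) (he : e ∈ D.rankOneCone c)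
    (he0 : e ≠ 0) (hcrit : ∀ u ∈ D.rankOneCone c, ⟪u, e⟫ = 0 → D.br u (D.θ e) = 0) (Y : V) :
    Set.MapsTo (exp (D.ad Y) : V →L[ℝ] V) (closure (D.positiveCone c e))
      (closure (D.positiveCone c e)) := by
  have hY : Y ∈ Submodule.span ℝ (D.rankOneCone c) :=
    span_rankOneCone_eq_top hD he he0 ▸ Submodule.mem_top
  suffices h : ∀ s : ℝ, Set.MapsTo (exp (s • D.ad Y) : V →L[ℝ] V)
      (closure (D.positiveCone c e)) (closure (D.positiveCone c e)) by simpa using h 1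
  induction hY using Submodule.span_induction with
  | mem X hX =>
    intro s
    have h : Set.MapsTo (exp (s • D.ad X) : V →L[ℝ] V) (D.positiveCone c e)
        (closure (D.positiveCone c e)) :=
      fun u hu => exp_smul_ad_mem_closure_positiveCone hcrit hX s hu
    simpa using h.closure (exp (s • D.ad X)).continuous
  | zero => intro s u hu; simpa using hu
  | add X Y _ _ hX hY => exact mapsTo_exp_ad_add isClosed_closure hX hY
  | smul a X _ hX => intro s; rw [map_smul, smul_smul]; exact hX _

variable (D) in
/-- The monoid of isometries generated by the flows of the fixed points of `θ`. -/
def isotropyMonoid : Submonoid (V →L[ℝ] V) :=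
  Submonoid.closure {k | ∃ Y, D.θ Y = Y ∧ exp (D.ad Y) = k}

lemma norm_apply_of_mem_isotropyMonoid {k : V →L[ℝ] V} (hk : k ∈ D.isotropyMonoid) (x : V) :
    ‖k x‖ = ‖x‖ := by
  induction hk using Submonoid.closure_induction generalizing x with
  | mem k hk =>
    obtain ⟨Y, hY, rfl⟩ := hk
    have h := D.inner_exp_ad_exp_ad Y x x
    rw [hY, real_inner_self_eq_norm_sq, real_inner_self_eq_norm_sq] at h
    exact (sq_eq_sq₀ (norm_nonneg _) (norm_nonneg _)).1 h
  | one => rfl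
  | mul a b _ _ ha hb => exact (ha (b x)).trans (hb x)

lemma exists_adjoint_mem_isotropyMonoid {k : V →L[ℝ] V} (hk : k ∈ D.isotropyMonoid) :
    ∃ k' ∈ D.isotropyMonoid, ∀ x y, ⟪k x, y⟫ = ⟪x, k' y⟫ := by
  induction hk using Submonoid.closure_induction with
  | mem k hk =>
    obtain ⟨Y, hY, rfl⟩ := hk
    exact ⟨exp (-D.ad Y), Submonoid.subset_closure ⟨-Y, by rw [map_neg, hY], by rw [map_neg]⟩,
      fun x y => by rw [inner_exp_ad, hY]⟩
  | one => exact ⟨1, Submonoid.one_mem _, fun _ _ => rfl⟩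
  | mul a b _ _ ha hb =>
    obtain ⟨a', ha', haa⟩ := ha
    obtain ⟨b', hb', hbb⟩ := hb
    exact ⟨b' * a', Submonoid.mul_mem _ hb' ha', fun x y => (haa _ _).trans (hbb _ _)⟩

lemma exists_ne_zero_forall_br_eq_zero_of_critical (hD : D.IsSimple) (he : e ∈ D.rankOneCone c)
    (he0 : e ≠ 0) (hcrit : ∀ u ∈ D.rankOneCone c, ⟪u, e⟫ = 0 → D.br u (D.θ e) = 0) :
    ∃ w ≠ 0, ∀ y, D.θ y = y → D.br y w = 0 := by
  have heC : e ∈ closure (D.positiveCone c e) :=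
    subset_closure ⟨he, real_inner_self_pos.2 he0⟩
  have hpos : closure (D.positiveCone c e) ⊆ {x | 0 ≤ ⟪x, e⟫} :=
    closure_minimal (fun x hx => hx.2.le)
      (isClosed_le continuous_const (continuous_id.inner continuous_const))
  have hC : ∀ k ∈ D.isotropyMonoid,
      Set.MapsTo k (closure (D.positiveCone c e)) (closure (D.positiveCone c e)) := by
    intro k hk
    induction hk using Submonoid.closure_induction with
    | mem k hk =>
      obtain ⟨Y, -, rfl⟩ := hk
      exact mapsTo_exp_ad_closure_positiveCone hD he he0 hcrit Y
    | one => exact Set.mapsTo_id _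
    | mul a b _ _ ha hb => exact ha.comp hb
  obtain ⟨w, hw0, hw⟩ := exists_fixed_vector_of_inner_nonneg D.isotropyMonoid
    (fun k hk => norm_apply_of_mem_isotropyMonoid hk) he0 fun k hk k' hk' => by
      obtain ⟨l, hl, hadj⟩ := exists_adjoint_mem_isotropyMonoid hk'
      rw [real_inner_comm, hadj, real_inner_comm]
      exact hpos (hC l hl (hC k hk heC))
  refine ⟨w, hw0, fun y hy => ?_⟩
  have hfix : (fun s : ℝ => exp (s • D.ad y) w) = fun _ => w := funext fun s =>
    hw _ (Submonoid.subset_closure ⟨s • y, by rw [map_smul, hy], by rw [map_smul]⟩)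
  have hderiv := D.hasDerivAt_exp_ad y w 0
  rw [hfix] at hderiv
  simpa using hderiv.unique (hasDerivAt_const _ _)

theorem exists_center_of_critical (hD : D.IsSimple) (he : e ∈ D.rankOneCone c) (he0 : e ≠ 0)
    (hcrit : ∀ u ∈ D.rankOneCone c, ⟪u, e⟫ = 0 → D.br u (D.θ e) = 0) :
    ∃ w ≠ 0, D.θ w = w ∧ ∀ y, D.θ y = y → D.br w y = 0 := by
  obtain ⟨w, hw0, hw⟩ := exists_ne_zero_forall_br_eq_zero_of_critical hD he he0 hcrit
  refine ⟨w + D.θ w, hD.add_θ_ne_zero hw0 hw, by rw [map_add, D.θ_θ, add_comm], fun y hy => ?_⟩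
  have hθ := congrArg D.θ (hw y hy)
  rw [D.θ_br, hy, map_zero] at hθ
  rw [D.br_swap, map_add, hw y hy, hθ, add_zero, neg_zero]

end EuclideanCartanAlgebra

/-! ### Restricted weights -/

namespace EuclideanCartanAlgebra

variable {V : Type*} [NormedAddCommGroup V] [InnerProductSpace ℝ V]
  (D : EuclideanCartanAlgebra V) (𝔞 : Submodule ℝ V)

/-- The weight space of `𝔞` attached to the linear form `⟪·, A⟫` on `𝔞`. -/
def weightSpace (A : V) : Submodule ℝ V where
  carrier := {x | ∀ H ∈ 𝔞, D.br H x = ⟪H, A⟫ • x}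
  add_mem' := fun hx hy H hH => by rw [map_add, hx H hH, hy H hH, smul_add]
  zero_mem' := fun H _ => by rw [map_zero, smul_zero]
  smul_mem' := fun c x hx H hH => by rw [map_smul, hx H hH, smul_comm]

/-- `𝔞` is a maximal abelian subspace of the `-1`-eigenspace of the Cartan involution. -/
structure IsCartanSubspace : Prop where
  br_eq_zero : ∀ H ∈ 𝔞, ∀ H' ∈ 𝔞, D.br H H' = 0
  θ_eq_neg : ∀ H ∈ 𝔞, D.θ H = -H
  mem_of_br_eq_zero : ∀ x, D.θ x = -x → (∀ H ∈ 𝔞, D.br H x = 0) → x ∈ 𝔞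

/-- `A₀ ∈ 𝔞` represents a weight of maximal length and multiplicity one, with weight vector `e`. -/
structure IsLongestWeightVector (A₀ e : V) : Prop where
  weight_mem : A₀ ∈ 𝔞
  mem : e ∈ D.weightSpace 𝔞 A₀
  ne_zero : e ≠ 0
  exists_eq_smul : ∀ x ∈ D.weightSpace 𝔞 A₀, ∃ t : ℝ, x = t • e
  norm_le : ∀ A ∈ 𝔞, ∀ x ∈ D.weightSpace 𝔞 A, x ≠ 0 → ‖A‖ ≤ ‖A₀‖

variable {D 𝔞} {A A' A₀ e x y : V}

lemma br_mem_weightSpace (hx : x ∈ D.weightSpace 𝔞 A) (hy : y ∈ D.weightSpace 𝔞 A') :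
    D.br x y ∈ D.weightSpace 𝔞 (A + A') := by
  intro H hH
  rw [D.jacobi, hx H hH, hy H hH, inner_add_right, map_smul, map_smul, add_smul,
    LinearMap.smul_apply]

namespace IsLongestWeightVector

/-- For `A ≠ -A₀`, one of the weights `A` and `A + 2 A₀` is longer than `A₀`. -/
lemma br_br_eq_zero (he : D.IsLongestWeightVector 𝔞 A₀ e) (hA : A ∈ 𝔞)
    (hne : A ≠ -A₀) (hx : x ∈ D.weightSpace 𝔞 A) : D.br e (D.br e x) = 0 := by
  by_contra hbr
  have hx0 : x ≠ 0 := by rintro rfl; simp at hbr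
  have hA_le := he.norm_le A hA x hx hx0
  have hA₂_le := he.norm_le _ (𝔞.add_mem he.weight_mem (𝔞.add_mem he.weight_mem hA)) _
    (br_mem_weightSpace he.mem (br_mem_weightSpace he.mem hx)) hbr
  have hpar := parallelogram_law_with_norm ℝ (A + A₀) A₀
  rw [add_sub_cancel_right, show A + A₀ + A₀ = A₀ + (A₀ + A) by abel] at hpar
  have hsum : ‖A + A₀‖ = 0 := by
    nlinarith [norm_nonneg (A + A₀), norm_nonneg A, norm_nonneg (A₀ + (A₀ + A))]
  exact hne (eq_neg_of_add_eq_zero_left (norm_eq_zero.1 hsum))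

/-- The weight `A + A₀` is longer than `A₀`. -/
lemma br_eq_zero (he : D.IsLongestWeightVector 𝔞 A₀ e) (hA : A ∈ 𝔞)
    (hpos : 0 < ⟪A₀, A⟫) (hx : x ∈ D.weightSpace 𝔞 A) : D.br x e = 0 := by
  by_contra hbr
  have hle := he.norm_le _ (𝔞.add_mem hA he.weight_mem) _ (br_mem_weightSpace hx he.mem) hbr
  have hsq := norm_add_sq_real A A₀
  rw [real_inner_comm] at hsq
  nlinarith [norm_nonneg (A + A₀), sq_nonneg ‖A‖]

end IsLongestWeightVector

namespace IsCartanSubspace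

lemma inner_br_left (h : D.IsCartanSubspace 𝔞) {H : V} (hH : H ∈ 𝔞) (x y : V) :
    ⟪D.br H x, y⟫ = ⟪x, D.br H y⟫ := by
  rw [D.inner_br, h.θ_eq_neg H hH, map_neg, LinearMap.neg_apply, inner_neg_right, neg_neg]

lemma θ_mem_weightSpace (h : D.IsCartanSubspace 𝔞) (hx : x ∈ D.weightSpace 𝔞 A) :
    D.θ x ∈ D.weightSpace 𝔞 (-A) := by
  intro H hH
  have hθ := congrArg D.θ (hx H hH)
  rw [D.θ_br, h.θ_eq_neg H hH, map_neg, LinearMap.neg_apply, map_smul] at hθ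
  rw [inner_neg_right, neg_smul, ← hθ, neg_neg]

lemma inner_eq_zero (h : D.IsCartanSubspace 𝔞) (hx : x ∈ D.weightSpace 𝔞 A)
    (hy : y ∈ D.weightSpace 𝔞 A') (hA : A ∈ 𝔞) (hA' : A' ∈ 𝔞) (hne : A ≠ A') : ⟪x, y⟫ = 0 := by
  have hsymm := h.inner_br_left (𝔞.sub_mem hA hA') x y
  rw [hx _ (𝔞.sub_mem hA hA'), hy _ (𝔞.sub_mem hA hA'), real_inner_smul_left,
    real_inner_smul_right, ← sub_eq_zero, ← sub_mul, ← inner_sub_right] at hsymm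
  exact (mul_eq_zero.1 hsymm).resolve_left (inner_self_ne_zero.2 (sub_ne_zero.2 hne))

lemma br_θ_self (h : D.IsCartanSubspace 𝔞) (hx : x ∈ D.weightSpace 𝔞 A) (hA : A ∈ 𝔞) :
    D.br x (D.θ x) = -(‖x‖ ^ 2) • A := by
  have hmem : D.br x (D.θ x) ∈ 𝔞 := by
    refine h.mem_of_br_eq_zero _ (by rw [D.θ_br, D.θ_θ, D.br_swap]) fun H hH => ?_
    simpa using br_mem_weightSpace hx (h.θ_mem_weightSpace hx) H hH
  have horth : ∀ H ∈ 𝔞, ⟪D.br x (D.θ x) - -(‖x‖ ^ 2) • A, H⟫ = 0 := by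
    intro H hH
    rw [inner_sub_left, D.inner_br, D.br_swap (D.θ x) H, h.θ_mem_weightSpace hx H hH,
      inner_neg_right, real_inner_smul_right, D.inner_θ, real_inner_smul_left, inner_neg_right,
      real_inner_self_eq_norm_sq, real_inner_comm H A]
    ring
  exact sub_eq_zero.1 (inner_self_eq_zero.1
    (horth _ (𝔞.sub_mem hmem (𝔞.smul_mem _ hA))))

lemma br_br_θ_self (h : D.IsCartanSubspace 𝔞) (hx : x ∈ D.weightSpace 𝔞 A) (hA : A ∈ 𝔞) :
    D.br x (D.br x (D.θ x)) = (‖A‖ ^ 2 * ‖x‖ ^ 2) • x := by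
  rw [h.br_θ_self hx hA, map_smul, D.br_swap, hx A hA, real_inner_self_eq_norm_sq, smul_neg,
    neg_smul, neg_neg, smul_smul, mul_comm]

lemma norm_sq_eq_of_mem_rankOneCone (h : D.IsCartanSubspace 𝔞) (hx : x ∈ D.weightSpace 𝔞 A)
    (hA : A ∈ 𝔞) (hx0 : x ≠ 0) {c : ℝ} (hc : x ∈ D.rankOneCone c) : ‖A‖ ^ 2 = c := by
  have hsmul := hc (D.θ x)
  rw [h.br_br_θ_self hx hA, D.θ_θ, real_inner_self_eq_norm_sq] at hsmul
  have hx2 : ‖x‖ ^ 2 ≠ 0 := pow_ne_zero 2 (norm_ne_zero_iff.2 hx0)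
  exact mul_right_cancel₀ hx2 (smul_left_injective ℝ hx0 hsmul)

/-- For `A ≠ 0`, the weight `A - A₀` is longer than `A₀`. -/
lemma br_θ_eq_zero_of_inner_nonpos (h : D.IsCartanSubspace 𝔞)
    (he : D.IsLongestWeightVector 𝔞 A₀ e) (hA : A ∈ 𝔞) (hA0 : A ≠ 0) (hnonpos : ⟪A₀, A⟫ ≤ 0)
    (hx : x ∈ D.weightSpace 𝔞 A) : D.br x (D.θ e) = 0 := by
  by_contra hbr
  have hle := he.norm_le _ (𝔞.add_mem hA (𝔞.neg_mem he.weight_mem)) _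
    (br_mem_weightSpace hx (h.θ_mem_weightSpace he.mem)) hbr
  have hsq := norm_sub_sq_real A A₀
  rw [real_inner_comm] at hsq
  rw [← sub_eq_add_neg] at hle
  have hApos : 0 < ‖A‖ := norm_pos_iff.2 hA0
  nlinarith [norm_nonneg (A - A₀)]

variable [FiniteDimensional ℝ V]

lemma iSup_weightSpace (h : D.IsCartanSubspace 𝔞) : ⨆ A : 𝔞, D.weightSpace 𝔞 A = ⊤ := by
  have hcomm : Pairwise (Function.onFun Commute fun H : 𝔞 => (D.br H : V →ₗ[ℝ] V)) := by
    intro H H' _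
    refine LinearMap.ext fun x => ?_
    have hjac := D.jacobi H H' x
    rwa [h.br_eq_zero H H.2 H' H'.2, map_zero, LinearMap.zero_apply, zero_add] at hjac
  rw [eq_top_iff, ← LinearMap.IsSymmetric.iSup_iInf_eq_top_of_commute
    (fun H : 𝔞 => fun x y => h.inner_br_left H.2 x y) hcomm]
  refine iSup_le fun χ => ?_
  rcases eq_or_ne (⨅ H : 𝔞, Module.End.eigenspace (D.br H) (χ H)) ⊥ with hbot | hne
  · rw [hbot]; exact bot_le
  obtain ⟨x, hx, hx0⟩ := Submodule.exists_mem_ne_zero_of_ne_bot hne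
  simp only [Submodule.mem_iInf, Module.End.mem_eigenspace_iff] at hx
  let χL : 𝔞 →ₗ[ℝ] ℝ :=
    { toFun := χ
      map_add' := fun H H' => smul_left_injective ℝ hx0 (by
        change χ (H + H') • x = (χ H + χ H') • x
        rw [add_smul, ← hx, ← hx, ← hx, Submodule.coe_add, map_add, LinearMap.add_apply])
      map_smul' := fun c H => smul_left_injective ℝ hx0 (by
        change χ (c • H) • x = (c • χ H) • x
        rw [smul_assoc, ← hx, ← hx, Submodule.coe_smul, map_smul, LinearMap.smul_apply]) }
  let A : 𝔞 := (InnerProductSpace.toDual ℝ 𝔞).symm (LinearMap.toContinuousLinearMap χL)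
  have hA : ∀ H : 𝔞, ⟪(H : V), (A : V)⟫ = χ H := by
    intro H
    rw [real_inner_comm, ← Submodule.coe_inner, InnerProductSpace.toDual_symm_apply]
    rfl
  refine le_iSup_of_le A fun y hy H hH => ?_
  simp only [Submodule.mem_iInf, Module.End.mem_eigenspace_iff] at hy
  rw [hA ⟨H, hH⟩, ← hy ⟨H, hH⟩]

lemma mem_rankOneCone_of_longest (h : D.IsCartanSubspace 𝔞)
    (he : D.IsLongestWeightVector 𝔞 A₀ e) : e ∈ D.rankOneCone (‖A₀‖ ^ 2) := by
  intro x
  have hx : x ∈ ⨆ A : 𝔞, D.weightSpace 𝔞 A := h.iSup_weightSpace ▸ Submodule.mem_top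
  induction hx using Submodule.iSup_induction' with
  | zero => simp
  | add x y _ _ hx hy =>
    rw [map_add, map_add, hx, hy, map_add, inner_add_right, mul_add, add_smul]
  | mem A x hx =>
    have hθx := h.θ_mem_weightSpace hx
    by_cases hA : (A : V) = -A₀
    · rw [hA, neg_neg] at hθx
      obtain ⟨t, ht⟩ := he.exists_eq_smul _ hθx
      rw [ht, ← D.θ_θ x, ht, map_smul, map_smul, map_smul, h.br_br_θ_self he.mem he.weight_mem,
        real_inner_smul_right, real_inner_self_eq_norm_sq, smul_smul]
      congr 1; ring
    · rw [he.br_br_eq_zero A.2 hA hx, h.inner_eq_zero he.mem hθx he.weight_mem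
        (𝔞.neg_mem A.2) fun h' => hA (by rw [h', neg_neg]), mul_zero, zero_smul]

end IsCartanSubspace

section HighestComponents

variable {c : ℝ}

lemma smul_mem_rankOneCone (a : ℝ) {u : V} (hu : u ∈ D.rankOneCone c) :
    a • u ∈ D.rankOneCone c := by
  intro x
  simp only [map_smul, LinearMap.smul_apply, hu x, smul_smul, real_inner_smul_left]
  congr 1; ring

variable [FiniteDimensional ℝ V]

lemma isClosed_rankOneCone (c : ℝ) : IsClosed (D.rankOneCone c) := by
  have had : Continuous D.ad := LinearMap.continuous_of_finiteDimensional _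
  have hInter : D.rankOneCone c = ⋂ x, {u | D.ad u (D.ad u x) = (c * ⟪u, D.θ x⟫) • u} := by
    ext u; simp [rankOneCone]
  rw [hInter]
  exact isClosed_iInter fun x => isClosed_eq (had.clm_apply (had.clm_apply continuous_const))
    ((continuous_const.mul (continuous_id.inner continuous_const)).smul continuous_id)

variable {s : Finset 𝔞} {f : 𝔞 → V}

/-- The components of largest value on `H` are the limit of `exp (-t M) • exp (t • ad H)` as
`t → ∞`. -/
lemma sum_filter_mem_rankOneCone (hf : ∀ A ∈ s, f A ∈ D.weightSpace 𝔞 A)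
    (hs : ∑ A ∈ s, f A ∈ D.rankOneCone c) (H : 𝔞) {M : ℝ}
    (hM : ∀ A ∈ s, ⟪(H : V), (A : V)⟫ ≤ M) :
    ∑ A ∈ s.filter fun A : 𝔞 => ⟪(H : V), (A : V)⟫ = M, f A ∈ D.rankOneCone c := by
  have hlim : Tendsto (fun t : ℝ => ∑ A ∈ s, Real.exp (t * (⟪(H : V), (A : V)⟫ - M)) • f A) atTop
      (𝓝 (∑ A ∈ s, if ⟪(H : V), (A : V)⟫ = M then f A else 0)) := by
    refine tendsto_finsetSum _ fun A hA => ?_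
    split_ifs with hAM
    · simp [hAM]
    · have hneg : ⟪(H : V), (A : V)⟫ - M < 0 := sub_neg.2 (lt_of_le_of_ne (hM A hA) hAM)
      simpa [Function.comp_def] using
        (Real.tendsto_exp_atBot.comp (tendsto_id.atTop_mul_const_of_neg hneg)).smul_const (f A)
  rw [Finset.sum_filter]
  refine (isClosed_rankOneCone c).mem_of_tendsto hlim (Eventually.of_forall fun t => ?_)
  have hflow : ∑ A ∈ s, Real.exp (t * (⟪(H : V), (A : V)⟫ - M)) • f A =
      Real.exp (-(t * M)) • NormedSpace.exp (D.ad (t • (H : V))) (∑ A ∈ s, f A) := by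
    rw [map_sum, Finset.smul_sum]
    refine Finset.sum_congr rfl fun A hA => ?_
    rw [exp_apply_of_apply_eq_smul (r := t * ⟪(H : V), (A : V)⟫)
      (by rw [ad_apply, map_smul, LinearMap.smul_apply, hf A hA H H.2, smul_smul]), smul_smul,
      ← Real.exp_add]
    congr 2; ring
  rw [hflow]
  exact smul_mem_rankOneCone _ (exp_ad_mem_rankOneCone hs _)

/-- Among the components of largest value on `H`, one of largest norm is isolated by a second
limit. -/
lemma exists_mem_rankOneCone_of_sum_mem (hf : ∀ A ∈ s, f A ∈ D.weightSpace 𝔞 A)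
    (hs : ∑ A ∈ s, f A ∈ D.rankOneCone c) (H : 𝔞) (hne : s.Nonempty) :
    ∃ B ∈ s, (∀ A ∈ s, ⟪(H : V), (A : V)⟫ ≤ ⟪(H : V), B⟫) ∧ f B ∈ D.rankOneCone c := by
  classical
  obtain ⟨A₁, hA₁, hmax⟩ := s.exists_max_image (fun A : 𝔞 => ⟪(H : V), (A : V)⟫) hne
  have hs' := sum_filter_mem_rankOneCone hf hs H hmax
  set s' := s.filter fun A : 𝔞 => ⟪(H : V), (A : V)⟫ = ⟪(H : V), (A₁ : V)⟫
  obtain ⟨B, hB, hBmax⟩ := s'.exists_max_image (fun A : 𝔞 => ‖(A : V)‖)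
    ⟨A₁, Finset.mem_filter.2 ⟨hA₁, rfl⟩⟩
  have hBs := Finset.mem_filter.1 hB
  have hBA : ∀ A ∈ s', ⟪(B : V), (A : V)⟫ ≤ ‖(B : V)‖ ^ 2 := fun A hA =>
    (real_inner_le_norm _ _).trans (by nlinarith [hBmax A hA, norm_nonneg (B : V)])
  have hB' := sum_filter_mem_rankOneCone (fun A hA => hf A (Finset.mem_filter.1 hA).1) hs' B hBA
  have hfilter : s'.filter (fun A : 𝔞 => ⟪(B : V), (A : V)⟫ = ‖(B : V)‖ ^ 2) = {B} := by
    refine Finset.eq_singleton_iff_unique_mem.2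
      ⟨Finset.mem_filter.2 ⟨hB, real_inner_self_eq_norm_sq _⟩, fun A hA => ?_⟩
    obtain ⟨hA, hinner⟩ := Finset.mem_filter.1 hA
    have hsq := norm_sub_sq_real (B : V) A
    have hle : ‖(B : V) - A‖ ^ 2 ≤ 0 := by nlinarith [hBmax A hA, norm_nonneg (A : V)]
    exact (Subtype.ext (sub_eq_zero.1 (norm_eq_zero.1 (pow_eq_zero_iff two_ne_zero |>.1
      (le_antisymm hle (sq_nonneg _)))))).symm
  rw [hfilter, Finset.sum_singleton] at hB'
  exact ⟨B, hBs.1, fun A hA => (hmax A hA).trans_eq hBs.2.symm, hB'⟩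

end HighestComponents

namespace IsCartanSubspace

variable {s : Finset 𝔞} {f : 𝔞 → V}

lemma inner_sum_eq (h : D.IsCartanSubspace 𝔞) (hf : ∀ A : 𝔞, f A ∈ D.weightSpace 𝔞 A) {A : 𝔞}
    (hA : A ∈ s) (hx : x ∈ D.weightSpace 𝔞 A) : ⟪∑ A ∈ s, f A, x⟫ = ⟪f A, x⟫ := by
  rw [sum_inner]
  exact Finset.sum_eq_single_of_mem A hA fun A' _ hne =>
    h.inner_eq_zero (hf A') hx A'.2 A.2 (Subtype.coe_ne_coe.2 hne)

lemma apply_eq_zero_of_inner_sum_eq_zero (h : D.IsCartanSubspace 𝔞)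
    (he : D.IsLongestWeightVector 𝔞 A₀ e) (hf : ∀ A : 𝔞, f A ∈ D.weightSpace 𝔞 A) {A : 𝔞}
    (hA : A ∈ s) (hAA₀ : (A : V) = A₀) (horth : ⟪∑ A ∈ s, f A, e⟫ = 0) : f A = 0 := by
  subst hAA₀
  obtain ⟨t, ht⟩ := he.exists_eq_smul _ (hf A)
  rw [h.inner_sum_eq hf hA he.mem, ht, real_inner_smul_left] at horth
  rw [ht, (mul_eq_zero.1 horth).resolve_right (inner_self_ne_zero.2 he.ne_zero), zero_smul]

lemma exists_br_sum_θ_eq_smul (h : D.IsCartanSubspace 𝔞) (he : D.IsLongestWeightVector 𝔞 A₀ e)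
    (hf : ∀ A : 𝔞, f A ∈ D.weightSpace 𝔞 A) (hnonpos : ∀ A ∈ s, ⟪A₀, (A : V)⟫ ≤ 0) :
    ∃ t : ℝ, D.br (∑ A ∈ s, f A) (D.θ e) = t • D.θ e := by
  have hterm : ∀ A ∈ s, A ≠ 0 → D.br (f A) (D.θ e) = 0 := fun A hA hne =>
    h.br_θ_eq_zero_of_inner_nonpos he A.2 (by simpa using hne) (hnonpos A hA) (hf A)
  rw [map_sum, LinearMap.sum_apply]
  by_cases h0 : (0 : 𝔞) ∈ s
  · rw [Finset.sum_eq_single_of_mem 0 h0 hterm]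
    have hmem := h.θ_mem_weightSpace (br_mem_weightSpace (hf 0) (h.θ_mem_weightSpace he.mem))
    rw [Submodule.coe_zero, zero_add, neg_neg] at hmem
    obtain ⟨t, ht⟩ := he.exists_eq_smul _ hmem
    exact ⟨t, by rw [← D.θ_θ (D.br _ _), ht, map_smul]⟩
  · refine ⟨0, ?_⟩
    rw [zero_smul]
    exact Finset.sum_eq_zero fun A hA => hterm A hA fun hA0 => h0 (hA0 ▸ hA)

lemma br_sum_θ_eq_zero (h : D.IsCartanSubspace 𝔞) (he : D.IsLongestWeightVector 𝔞 A₀ e)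
    (hf : ∀ A : 𝔞, f A ∈ D.weightSpace 𝔞 A) (hnonpos : ∀ A ∈ s, ⟪A₀, (A : V)⟫ ≤ 0) {c : ℝ}
    (hs : ∑ A ∈ s, f A ∈ D.rankOneCone c) (horth : ⟪∑ A ∈ s, f A, e⟫ = 0) :
    D.br (∑ A ∈ s, f A) (D.θ e) = 0 := by
  obtain ⟨t, ht⟩ := h.exists_br_sum_θ_eq_smul he hf hnonpos
  have hsq := hs (D.θ e)
  rw [D.θ_θ, horth, mul_zero, zero_smul, ht, map_smul, ht, smul_smul] at hsq
  have hθe : D.θ e ≠ 0 := fun h0 => he.ne_zero (by rw [← D.θ_θ e, h0, map_zero])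
  rw [ht, mul_self_eq_zero.1 ((smul_eq_zero.1 hsq).resolve_right hθe), zero_smul]

variable [FiniteDimensional ℝ V]

lemma br_eq_zero_or_exists_weight (h : D.IsCartanSubspace 𝔞)
    (he : D.IsLongestWeightVector 𝔞 A₀ e) {u : V} (hu : u ∈ D.rankOneCone (‖A₀‖ ^ 2))
    (hue : ⟪u, e⟫ = 0) :
    D.br u (D.θ e) = 0 ∨ ∃ A ∈ 𝔞, ∃ w ∈ D.weightSpace 𝔞 A, w ≠ 0 ∧ ‖A‖ = ‖A₀‖ ∧
      0 < ⟪A₀, A⟫ ∧ A ≠ A₀ := by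
  obtain ⟨f, hf, rfl⟩ := (Submodule.mem_iSup_iff_exists_finsupp _ u).1
    (h.iSup_weightSpace ▸ Submodule.mem_top)
  by_cases hpos : ∃ A ∈ f.support, 0 < ⟪A₀, (A : V)⟫
  · obtain ⟨A₁, hA₁, hA₁pos⟩ := hpos
    obtain ⟨B, hB, hmax, hBcone⟩ :=
      exists_mem_rankOneCone_of_sum_mem (fun A _ => hf A) hu ⟨A₀, he.weight_mem⟩ ⟨A₁, hA₁⟩
    have hfB : f B ≠ 0 := Finsupp.mem_support_iff.1 hB
    refine .inr ⟨B, B.2, f B, hf B, hfB, ?_, hA₁pos.trans_le (hmax A₁ hA₁), fun hBA₀ =>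
      hfB (h.apply_eq_zero_of_inner_sum_eq_zero he hf hB hBA₀ hue)⟩
    exact (sq_eq_sq₀ (norm_nonneg _) (norm_nonneg _)).1
      (h.norm_sq_eq_of_mem_rankOneCone (hf B) B.2 hfB hBcone)
  · push Not at hpos
    exact .inl (h.br_sum_θ_eq_zero he hf hpos hu hue)

theorem exists_oblique_longest_weight (h : D.IsCartanSubspace 𝔞) (hD : D.IsSimple)
    (hk : ∀ w, D.θ w = w → (∀ y, D.θ y = y → D.br w y = 0) → w = 0)
    (he : D.IsLongestWeightVector 𝔞 A₀ e) :
    ∃ A ∈ 𝔞, ∃ w ∈ D.weightSpace 𝔞 A, w ≠ 0 ∧ ‖A‖ = ‖A₀‖ ∧ 0 < ⟪A₀, A⟫ ∧ A ≠ A₀ ∧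
      D.br w e = 0 := by
  by_cases hex : ∃ A ∈ 𝔞, ∃ w ∈ D.weightSpace 𝔞 A, w ≠ 0 ∧ ‖A‖ = ‖A₀‖ ∧ 0 < ⟪A₀, A⟫ ∧ A ≠ A₀
  · obtain ⟨A, hA, w, hw, hw0, hnorm, hpos, hne⟩ := hex
    exact ⟨A, hA, w, hw, hw0, hnorm, hpos, hne, he.br_eq_zero hA hpos hw⟩
  · obtain ⟨w, hw0, hθw, hw⟩ := exists_center_of_critical hD (h.mem_rankOneCone_of_longest he)
      he.ne_zero fun u hu hue => (h.br_eq_zero_or_exists_weight he hu hue).resolve_right hex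
    exact absurd (hk w hθw hw) hw0

end IsCartanSubspace

end EuclideanCartanAlgebra

/-! ### One-parameter subgroups and the adjoint representation -/

open VectorField

section RestrictScalars

variable {E : Type*} [NormedAddCommGroup E] [NormedSpace ℂ E]
  {G : Type*} [TopologicalSpace G] [ChartedSpace E G] {n : WithTop ℕ∞}

lemma isManifold_real_of_complex [IsManifold 𝓘(ℂ, E) n G] : IsManifold 𝓘(ℝ, E) n G := by
  refine isManifold_of_contDiffOn _ _ _ fun e e' he he' => ?_
  have h := (contDiffGroupoid n 𝓘(ℂ, E)).compatible he he'
  rw [contDiffGroupoid, mem_groupoid_of_pregroupoid] at h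
  exact h.1.restrict_scalars ℝ

lemma contMDiff_real_of_complex {f : G → G} (hf : ContMDiff 𝓘(ℂ, E) 𝓘(ℂ, E) n f) :
    ContMDiff 𝓘(ℝ, E) 𝓘(ℝ, E) n f := fun x =>
  have h := contMDiffAt_iff.1 (hf x)
  contMDiffAt_iff.2 ⟨h.1, h.2.restrict_scalars ℝ⟩

lemma lieGroup_real_of_complex [Group G] [LieGroup 𝓘(ℂ, E) n G] : LieGroup 𝓘(ℝ, E) n G := by
  have : IsManifold 𝓘(ℝ, E) n G := isManifold_real_of_complex
  refine { contMDiff_mul := fun p => ?_, contMDiff_inv := ?_ }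
  · have h := contMDiffAt_iff.1 (contMDiff_mul 𝓘(ℂ, E) n (G := G) p)
    exact contMDiffAt_iff.2 ⟨h.1, h.2.restrict_scalars ℝ⟩
  · exact contMDiff_real_of_complex (contMDiff_inv 𝓘(ℂ, E) n)

end RestrictScalars

section OneParameterSubgroups

variable {E : Type*} [NormedAddCommGroup E] [NormedSpace ℝ E]
  {G : Type*} [TopologicalSpace G] [ChartedSpace E G] [Group G]

lemma mulInvariantVectorField_one_apply (X : GroupLieAlgebra 𝓘(ℝ, E) G) :
    mulInvariantVectorField X (1 : G) = X := by
  have h : HasMFDerivAt 𝓘(ℝ, E) 𝓘(ℝ, E) (fun x : G => 1 * x) 1 (ContinuousLinearMap.id ℝ E) :=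
    (hasMFDerivAt_id (I := 𝓘(ℝ, E)) (1 : G)).congr_of_eventuallyEq
      (Eventually.of_forall fun x => one_mul x)
  exact DFunLike.congr_fun (f := (mfderiv 𝓘(ℝ, E) 𝓘(ℝ, E) (fun x : G => 1 * x) 1 : E →L[ℝ] E))
    h.mfderiv X

variable [LieGroup 𝓘(ℝ, E) ω G] {X : GroupLieAlgebra 𝓘(ℝ, E) G} {γ γ' : ℝ → G}

lemma mfderiv_mul_left_mulInvariantVectorField (X : GroupLieAlgebra 𝓘(ℝ, E) G) (g h : G) :
    mfderiv 𝓘(ℝ, E) 𝓘(ℝ, E) (fun x : G => g * x) h (mulInvariantVectorField X h) =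
      mulInvariantVectorField X (g * h) := by
  have hcomp : (fun x : G => g * h * x) = (fun x : G => g * x) ∘ fun x : G => h * x :=
    funext fun x => mul_assoc g h x
  have hcongr : ∀ p, p = h → (mfderiv 𝓘(ℝ, E) 𝓘(ℝ, E) (fun x : G => g * x) p : E →L[ℝ] E)
      (mfderiv 𝓘(ℝ, E) 𝓘(ℝ, E) (fun x : G => h * x) 1 X) =
      (mfderiv 𝓘(ℝ, E) 𝓘(ℝ, E) (fun x : G => g * x) h : E →L[ℝ] E)
      (mfderiv 𝓘(ℝ, E) 𝓘(ℝ, E) (fun x : G => h * x) 1 X) := by rintro _ rfl; rfl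
  simp only [mulInvariantVectorField]
  rw [hcomp, mfderiv_comp (I' := 𝓘(ℝ, E)) _ mdifferentiableAt_mul_left mdifferentiableAt_mul_left]
  exact (hcongr _ (mul_one h)).symm

lemma isMIntegralCurveOn_mul_left {s : Set ℝ}
    (hγ : IsMIntegralCurveOn (I := 𝓘(ℝ, E)) γ (mulInvariantVectorField X) s) (g : G) :
    IsMIntegralCurveOn (I := 𝓘(ℝ, E)) (fun t => g * γ t) (mulInvariantVectorField X) s := by
  intro t ht
  have hcomp := (mdifferentiableAt_mul_left (I := 𝓘(ℝ, E)) (a := g)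
    (b := γ t)).hasMFDerivAt.comp_hasMFDerivWithinAt t (hγ t ht)
  refine hcomp.congr_mfderiv ?_
  ext
  change (mfderiv 𝓘(ℝ, E) 𝓘(ℝ, E) (fun x : G => g * x) (γ t) : E →L[ℝ] E)
    ((1 : ℝ) • (mulInvariantVectorField X (γ t) : E)) =
      (1 : ℝ) • (mulInvariantVectorField X (g * γ t) : E)
  rw [one_smul, one_smul]
  exact mfderiv_mul_left_mulInvariantVectorField X g (γ t)

lemma isMIntegralCurve_of_map_add (hγ : ∀ s t, γ (s + t) = γ s * γ t)
    (hd : HasMFDerivAt 𝓘(ℝ, ℝ) 𝓘(ℝ, E) γ 0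
      (ContinuousLinearMap.toSpanSingleton ℝ (show E from X))) :
    IsMIntegralCurve (I := 𝓘(ℝ, E)) γ (mulInvariantVectorField X) := by
  intro t
  have h0 : γ (t - t) = 1 := by rw [sub_self]; simpa using hγ 0 0
  have hsub : HasMFDerivAt 𝓘(ℝ, ℝ) 𝓘(ℝ, ℝ) (fun s : ℝ => s - t) t (ContinuousLinearMap.id ℝ ℝ) :=
    ((hasFDerivAt_id t).sub_const t).hasMFDerivAt
  have hd' : HasMFDerivAt 𝓘(ℝ, ℝ) 𝓘(ℝ, E) γ (t - t)
      (ContinuousLinearMap.toSpanSingleton ℝ (show E from X)) := by rwa [sub_self]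
  have hcomp := (mdifferentiableAt_mul_left (I := 𝓘(ℝ, E)) (a := γ t)
    (b := γ (t - t))).hasMFDerivAt.comp t
      (HasMFDerivAt.comp (g := γ) (f := fun s : ℝ => s - t) t hd' hsub)
  have hfun : (fun x => γ t * x) ∘ γ ∘ (fun s => s - t) = γ := by
    funext s
    simp [← hγ]
  have hval : ∀ p : G, p = 1 → (mfderiv 𝓘(ℝ, E) 𝓘(ℝ, E) (fun x : G => γ t * x) p : E →L[ℝ] E) X =
      mulInvariantVectorField X (γ t) := by
    rintro _ rfl; rfl
  rw [hfun] at hcomp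
  refine hcomp.congr_mfderiv ?_
  ext
  change (mfderiv 𝓘(ℝ, E) 𝓘(ℝ, E) (fun x : G => γ t * x) (γ (t - t)) : E →L[ℝ] E)
    ((1 : ℝ) • (X : E)) = (1 : ℝ) • (mulInvariantVectorField X (γ t) : E)
  rw [one_smul, one_smul]
  exact hval _ h0

lemma contMDiff_mulInvariantVectorField_one (X : GroupLieAlgebra 𝓘(ℝ, E) G) :
    ContMDiff 𝓘(ℝ, E) 𝓘(ℝ, E).tangent 1
      (fun g : G => (⟨g, mulInvariantVectorField X g⟩ : TangentBundle 𝓘(ℝ, E) G)) :=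
  (contMDiff_mulInvariantVectorField X).of_le (by simp)

variable [T2Space G]

lemma isMIntegralCurve_mulInvariantVectorField_unique
    (hγ : IsMIntegralCurve (I := 𝓘(ℝ, E)) γ (mulInvariantVectorField X))
    (hγ' : IsMIntegralCurve (I := 𝓘(ℝ, E)) γ' (mulInvariantVectorField X)) (h0 : γ 0 = γ' 0) :
    γ = γ' :=
  isMIntegralCurve_Ioo_eq_of_contMDiff_boundaryless (I := 𝓘(ℝ, E)) (t₀ := 0)
    (contMDiff_mulInvariantVectorField_one X) hγ hγ' h0

theorem oneParameterSubgroup_unique (hγ : ∀ s t, γ (s + t) = γ s * γ t)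
    (hγ' : ∀ s t, γ' (s + t) = γ' s * γ' t)
    (hd : HasMFDerivAt 𝓘(ℝ, ℝ) 𝓘(ℝ, E) γ 0
      (ContinuousLinearMap.toSpanSingleton ℝ (show E from X)))
    (hd' : HasMFDerivAt 𝓘(ℝ, ℝ) 𝓘(ℝ, E) γ' 0
      (ContinuousLinearMap.toSpanSingleton ℝ (show E from X))) : γ = γ' := by
  have h0 : γ 0 = 1 := by simpa using hγ 0 0
  have h0' : γ' 0 = 1 := by simpa using hγ' 0 0
  exact isMIntegralCurve_mulInvariantVectorField_unique (isMIntegralCurve_of_map_add hγ hd)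
    (isMIntegralCurve_of_map_add hγ' hd') (by rw [h0, h0'])

lemma exists_isMIntegralCurve_mulInvariantVectorField [CompleteSpace E]
    (X : GroupLieAlgebra 𝓘(ℝ, E) G) :
    ∃ γ : ℝ → G, γ 0 = 1 ∧ IsMIntegralCurve (I := 𝓘(ℝ, E)) γ (mulInvariantVectorField X) := by
  have hX := contMDiff_mulInvariantVectorField_one X
  obtain ⟨γ₀, hγ₀, hloc⟩ := exists_isMIntegralCurveAt_of_contMDiffAt_boundaryless
    (I := 𝓘(ℝ, E)) (t₀ := 0) (hX 1)
  obtain ⟨ε, hε, hγε⟩ := isMIntegralCurveAt_iff'.1 hloc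
  rw [Real.ball_eq_Ioo, zero_sub, zero_add] at hγε
  -- Left translation moves the local curve to any point, with the same time of existence.
  exact exists_isMIntegralCurve_of_isMIntegralCurveOn (I := 𝓘(ℝ, E)) hX hε
    (fun g => ⟨fun t => g * γ₀ t, by simp [hγ₀], isMIntegralCurveOn_mul_left hγε g⟩) 1

lemma map_add_of_isMIntegralCurve
    (hγ : IsMIntegralCurve (I := 𝓘(ℝ, E)) γ (mulInvariantVectorField X)) (h0 : γ 0 = 1)
    (s t : ℝ) : γ (s + t) = γ s * γ t := by
  have hmul : IsMIntegralCurve (I := 𝓘(ℝ, E)) (fun t => γ s * γ t) (mulInvariantVectorField X) := by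
    rw [isMIntegralCurve_iff_isMIntegralCurveOn] at hγ ⊢
    exact isMIntegralCurveOn_mul_left hγ (γ s)
  have heq := isMIntegralCurve_mulInvariantVectorField_unique (hγ.comp_add s) hmul (by simp [h0])
  simpa [add_comm] using congrFun heq t

theorem exists_oneParameterSubgroup [CompleteSpace E] (X : GroupLieAlgebra 𝓘(ℝ, E) G) :
    ∃ γ : ℝ → G, (∀ s t, γ (s + t) = γ s * γ t) ∧
      HasMFDerivAt 𝓘(ℝ, ℝ) 𝓘(ℝ, E) γ 0
        (ContinuousLinearMap.toSpanSingleton ℝ (show E from X)) := by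
  obtain ⟨γ, h0, hγ⟩ := exists_isMIntegralCurve_mulInvariantVectorField X
  have hval : ∀ p : G, p = 1 → (mulInvariantVectorField (I := 𝓘(ℝ, E)) X p : E) = X := by
    rintro _ rfl
    exact mulInvariantVectorField_one_apply X
  refine ⟨γ, map_add_of_isMIntegralCurve hγ h0, (hγ 0).congr_mfderiv ?_⟩
  ext
  exact congrArg (fun v : E => (1 : ℝ) • v) (hval _ h0)

end OneParameterSubgroups

section LocalGroup

variable {𝕜 : Type*} [RCLike 𝕜] {E F : Type*} [NormedAddCommGroup E] [NormedSpace 𝕜 E]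
  [NormedAddCommGroup F] [NormedSpace 𝕜 F] {f : E × E → F} {m A : E × E → E} {a b e : E}

lemma hasFDerivAt_prodMk_right_of_differentiableAt (hf : DifferentiableAt 𝕜 f (a, b)) :
    HasFDerivAt (fun y => f (a, y)) ((fderiv 𝕜 f (a, b)).comp (ContinuousLinearMap.inr 𝕜 E E)) b :=
  HasFDerivAt.comp (g := f) (f := fun y : E => (a, y)) b hf.hasFDerivAt
    (hasFDerivAt_prodMk_right a b)

lemma fderiv_apply_inl_of_eventually_eq (hm : DifferentiableAt 𝕜 m (e, e))
    (hme : ∀ᶠ x in 𝓝 e, m (x, e) = x) (X : E) : fderiv 𝕜 m (e, e) (X, 0) = X := by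
  have hcomp := HasFDerivAt.comp (g := m) (f := fun x : E => (x, e)) e hm.hasFDerivAt
    (hasFDerivAt_prodMk_left e e)
  have hid : HasFDerivAt (fun x => m (x, e)) (ContinuousLinearMap.id 𝕜 E) e :=
    (hasFDerivAt_id e).congr_of_eventuallyEq hme
  simpa using DFunLike.congr_fun (hcomp.unique hid) X

lemma fderiv_apply_inr_of_eventually_eq (hm : DifferentiableAt 𝕜 m (e, e))
    (hem : ∀ᶠ x in 𝓝 e, m (e, x) = x) (X : E) : fderiv 𝕜 m (e, e) (0, X) = X := by
  have hid : HasFDerivAt (fun x => m (e, x)) (ContinuousLinearMap.id 𝕜 E) e :=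
    (hasFDerivAt_id e).congr_of_eventuallyEq hem
  simpa using DFunLike.congr_fun
    ((hasFDerivAt_prodMk_right_of_differentiableAt hm).unique hid) X

lemma hasFDerivAt_fderiv_prodMk_left_apply (hf : DifferentiableAt 𝕜 (fderiv 𝕜 f) (a, b))
    (v : E × E) :
    HasFDerivAt (fun x => fderiv 𝕜 f (x, b) v)
      (((fderiv 𝕜 (fderiv 𝕜 f) (a, b)).flip v).comp (ContinuousLinearMap.inl 𝕜 E E)) a := by
  refine ((HasFDerivAt.comp (g := fderiv 𝕜 f) (f := fun x : E => (x, b)) a hf.hasFDerivAt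
    (hasFDerivAt_prodMk_left a b)).clm_apply (hasFDerivAt_const v a)).congr_fderiv ?_
  ext X
  simp

lemma hasFDerivAt_fderiv_prodMk_right_apply (hf : DifferentiableAt 𝕜 (fderiv 𝕜 f) (a, b))
    {v : E → E × E} {v' : E →L[𝕜] E × E} (hv : HasFDerivAt v v' b) :
    HasFDerivAt (fun y => fderiv 𝕜 f (a, y) (v y))
      ((fderiv 𝕜 f (a, b)).comp v' +
        ((fderiv 𝕜 (fderiv 𝕜 f) (a, b)).flip (v b)).comp (ContinuousLinearMap.inr 𝕜 E E)) b := by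
  refine ((HasFDerivAt.comp (g := fderiv 𝕜 f) (f := fun y : E => (a, y)) b hf.hasFDerivAt
    (hasFDerivAt_prodMk_right a b)).clm_apply hv).congr_fderiv ?_
  ext X
  simp

lemma eventually_differentiableAt_of_contDiffAt {n : WithTop ℕ∞} (hf : ContDiffAt 𝕜 n f (a, b))
    (hn : 1 ≤ n) : ∀ᶠ p in 𝓝 (a, b), DifferentiableAt 𝕜 f p :=
  ((hf.of_le hn).eventually (by simp)).mono fun _ hp => hp.differentiableAt one_ne_zero

/-- Differentiate `m (A (x, y), x) = m (x, y)` in `y`. -/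
lemma eventually_fderiv_mul_eq_fderiv_mul_conj (hm : ∀ᶠ p in 𝓝 (e, e), DifferentiableAt 𝕜 m p)
    (hA : ∀ᶠ p in 𝓝 (e, e), DifferentiableAt 𝕜 A p) (hAe : ∀ᶠ x in 𝓝 e, A (x, e) = e)
    (hrel : ∀ᶠ p in 𝓝 (e, e), m (A p, p.1) = m p) (Y : E) :
    ∀ᶠ x in 𝓝 e, fderiv 𝕜 m (x, e) (0, Y) = fderiv 𝕜 m (e, x) (fderiv 𝕜 A (x, e) (0, Y), 0) := by
  have hleft : Tendsto (fun x : E => (x, e)) (𝓝 e) (𝓝 (e, e)) :=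
    (Continuous.prodMk_left e).continuousAt
  have hright : Tendsto (fun x : E => (e, x)) (𝓝 e) (𝓝 (e, e)) :=
    (Continuous.prodMk_right e).continuousAt
  filter_upwards [hleft.eventually hrel.eventually_nhds, hleft.eventually hA,
    hright.eventually hm, hAe] with x hrelx hAx hmx hAex
  have hmx' : DifferentiableAt 𝕜 m (A (x, e), x) := by rwa [hAex]
  have hcomp := (HasFDerivAt.comp (g := m) (f := fun p : E × E => (A p, p.1)) (x, e)
    hmx'.hasFDerivAt (hAx.hasFDerivAt.prodMk hasFDerivAt_fst)).congr_of_eventuallyEq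
      (hrelx.mono fun p hp => hp.symm)
  rw [hcomp.fderiv, hAex]
  simp

/-- In a local group with neutral element `e`, multiplication `m` and conjugation `A`, the
derivative of the adjoint representation is the commutator of left-invariant vector fields. -/
theorem exists_hasFDerivAt_conj_of_local_group (hm : ContDiffAt 𝕜 2 m (e, e))
    (hA : ContDiffAt 𝕜 2 A (e, e)) (hme : ∀ᶠ x in 𝓝 e, m (x, e) = x)
    (hAe : ∀ᶠ x in 𝓝 e, A (x, e) = e) (heA : ∀ᶠ x in 𝓝 e, A (e, x) = x)
    (hrel : ∀ᶠ p in 𝓝 (e, e), m (A p, p.1) = m p) (Y : E) :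
    ∃ L : E →L[𝕜] E, HasFDerivAt (fun x => fderiv 𝕜 A (x, e) (0, Y)) L e ∧
      ∀ X, L X = fderiv 𝕜 (fun x => fderiv 𝕜 m (x, e) (0, Y)) e X -
        fderiv 𝕜 (fun x => fderiv 𝕜 m (x, e) (0, X)) e Y := by
  have hm2 : DifferentiableAt 𝕜 (fderiv 𝕜 m) (e, e) :=
    (hm.fderiv_right (m := 1) (by norm_num)).differentiableAt one_ne_zero
  have hA2 : DifferentiableAt 𝕜 (fderiv 𝕜 A) (e, e) :=
    (hA.fderiv_right (m := 1) (by norm_num)).differentiableAt one_ne_zero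
  have hsymm : IsSymmSndFDerivAt 𝕜 m (e, e) := hm.isSymmSndFDerivAt (by simp)
  have hL := hasFDerivAt_fderiv_prodMk_left_apply hA2 (0, Y)
  have hAeY := fderiv_apply_inr_of_eventually_eq (hA.differentiableAt two_ne_zero) heA Y
  refine ⟨_, hL, fun X => ?_⟩
  have hleft := hasFDerivAt_fderiv_prodMk_left_apply hm2
  have hright := hasFDerivAt_fderiv_prodMk_right_apply hm2
    (hL.prodMk (hasFDerivAt_const (0 : E) e))
  have heq := eventually_fderiv_mul_eq_fderiv_mul_conj
    (eventually_differentiableAt_of_contDiffAt hm one_le_two)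
    (eventually_differentiableAt_of_contDiffAt hA one_le_two) hAe hrel Y
  have hX := DFunLike.congr_fun ((hleft (0, Y)).unique (hright.congr_of_eventuallyEq heq)) X
  have hme' := fderiv_apply_inl_of_eventually_eq (hm.differentiableAt two_ne_zero) hme
  rw [(hleft (0, Y)).fderiv, (hleft (0, X)).fderiv, eq_sub_iff_add_eq, hX]
  simp [hAeY, hme', hsymm (0, X)]

end LocalGroup

namespace ComplexLie

section OneChart

variable {𝕜 : Type*} [RCLike 𝕜] {E : Type*} [NormedAddCommGroup E] [NormedSpace 𝕜 E]
  {G : Type*} [TopologicalSpace G] [ChartedSpace E G] [Group G]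

variable (E G) in
/-- The preferred chart at the identity, in which the Lie bracket and the adjoint representation
are computed. -/
abbrev oneChart : OpenPartialHomeomorph G E := chartAt E (1 : G)

lemma oneChart_symm_one : (oneChart E G).symm (oneChart E G 1) = 1 :=
  (oneChart E G).left_inv (mem_chart_source E 1)

lemma hasFDerivAt_oneChart_comp {f : G → G} (hf : f 1 = 1) {L : E →L[𝕜] E}
    (h : HasMFDerivAt 𝓘(𝕜, E) 𝓘(𝕜, E) f 1 L) :
    HasFDerivAt (fun y => oneChart E G (f ((oneChart E G).symm y))) L (oneChart E G 1) := by
  have h' := h.2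
  simp only [writtenInExtChartAt, hf, mfld_simps] at h'
  exact hasFDerivWithinAt_univ.1 h'

lemma eventually_symm_oneChart {X : Type*} [TopologicalSpace X] {γ : X → G} {x : X}
    (hγ : ContinuousAt γ x) (h1 : γ x = 1) :
    ∀ᶠ s in 𝓝 x, (oneChart E G).symm (oneChart E G (γ s)) = γ s := by
  have hmem : (oneChart E G).source ∈ 𝓝 (γ x) :=
    h1 ▸ (oneChart E G).open_source.mem_nhds (mem_chart_source E 1)
  exact (hγ.eventually hmem).mono fun p hp => (oneChart E G).left_inv hp

/-- The multiplication read in the chart at the identity, a local group law near `oneChart E G 1`;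
its values far from that point are meaningless. -/
def chartMul (E G : Type*) [NormedAddCommGroup E] [TopologicalSpace G] [ChartedSpace E G] [Group G]
    (p : E × E) : E :=
  oneChart E G ((oneChart E G).symm p.1 * (oneChart E G).symm p.2)

/-- The conjugation `(g, h) ↦ g * h * g⁻¹` read in the chart at the identity; as for `chartMul`,
only its values near `oneChart E G 1` are meaningful. -/
def chartConj (E G : Type*) [NormedAddCommGroup E] [TopologicalSpace G] [ChartedSpace E G] [Group G]
    (p : E × E) : E :=
  oneChart E G ((oneChart E G).symm p.1 * (oneChart E G).symm p.2 * ((oneChart E G).symm p.1)⁻¹)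

lemma eventually_chartMul_one :
    ∀ᶠ x in 𝓝 (oneChart E G 1), chartMul E G (x, oneChart E G 1) = x := by
  filter_upwards [chart_target_mem_nhds E (1 : G)] with x hx
  simp only [chartMul, oneChart_symm_one, mul_one]
  exact (oneChart E G).right_inv hx

lemma eventually_one_chartMul :
    ∀ᶠ x in 𝓝 (oneChart E G 1), chartMul E G (oneChart E G 1, x) = x := by
  filter_upwards [chart_target_mem_nhds E (1 : G)] with x hx
  simp only [chartMul, oneChart_symm_one, one_mul]
  exact (oneChart E G).right_inv hx

lemma eventually_one_chartConj :
    ∀ᶠ x in 𝓝 (oneChart E G 1), chartConj E G (oneChart E G 1, x) = x := by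
  filter_upwards [chart_target_mem_nhds E (1 : G)] with x hx
  simp only [chartConj, oneChart_symm_one, one_mul, inv_one, mul_one]
  exact (oneChart E G).right_inv hx

lemma chartConj_one (x : E) : chartConj E G (x, oneChart E G 1) = oneChart E G 1 := by
  simp [chartConj]

lemma eventually_chartMul_chartConj [IsTopologicalGroup G] :
    ∀ᶠ p in 𝓝 (oneChart E G 1, oneChart E G 1),
      chartMul E G (chartConj E G p, p.1) = chartMul E G p := by
  have hsymm : ContinuousAt (oneChart E G).symm (oneChart E G 1) :=
    (oneChart E G).symm.continuousAt (mem_chart_target E 1)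
  have hfst : ContinuousAt (fun p : E × E => (oneChart E G).symm p.1)
      (oneChart E G 1, oneChart E G 1) := ContinuousAt.fst' hsymm
  have hsnd : ContinuousAt (fun p : E × E => (oneChart E G).symm p.2)
      (oneChart E G 1, oneChart E G 1) := ContinuousAt.snd' hsymm
  filter_upwards [eventually_symm_oneChart (E := E) ((hfst.mul hsnd).mul hfst.inv) (by simp)]
    with p hp
  simp only [Pi.mul_apply, Pi.inv_apply] at hp
  simp only [chartMul, chartConj]
  rw [hp, inv_mul_cancel_right]

variable [LieGroup 𝓘(𝕜, E) ω G]

variable (𝕜) in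
lemma contMDiffAt_oneChart : ContMDiffAt 𝓘(𝕜, E) 𝓘(𝕜, E) ω (oneChart E G) 1 :=
  contMDiffAt_of_mem_maximalAtlas (IsManifold.chart_mem_maximalAtlas 1) (mem_chart_source E 1)

variable (𝕜) in
lemma contMDiffAt_oneChart_symm :
    ContMDiffAt 𝓘(𝕜, E) 𝓘(𝕜, E) ω (oneChart E G).symm (oneChart E G 1) :=
  contMDiffAt_symm_of_mem_maximalAtlas (IsManifold.chart_mem_maximalAtlas 1)
    (mem_chart_target E 1)

variable (𝕜) in
lemma contMDiffAt_oneChart_symm_fst :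
    ContMDiffAt 𝓘(𝕜, E × E) 𝓘(𝕜, E) ω (fun p : E × E => (oneChart E G).symm p.1)
      (oneChart E G 1, oneChart E G 1) :=
  ContMDiffAt.comp (g := (oneChart E G).symm) (f := Prod.fst) _ (contMDiffAt_oneChart_symm 𝕜)
    contDiff_fst.contMDiff.contMDiffAt

variable (𝕜) in
lemma contMDiffAt_oneChart_symm_mul :
    ContMDiffAt 𝓘(𝕜, E × E) 𝓘(𝕜, E) ω
      (fun p : E × E => (oneChart E G).symm p.1 * (oneChart E G).symm p.2)
      (oneChart E G 1, oneChart E G 1) :=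
  (contMDiffAt_oneChart_symm_fst 𝕜).mul
    (ContMDiffAt.comp (g := (oneChart E G).symm) (f := Prod.snd) _ (contMDiffAt_oneChart_symm 𝕜)
      contDiff_snd.contMDiff.contMDiffAt)

variable (𝕜) in
lemma contMDiffAt_oneChart_symm_conj :
    ContMDiffAt 𝓘(𝕜, E × E) 𝓘(𝕜, E) ω (fun p : E × E =>
      (oneChart E G).symm p.1 * (oneChart E G).symm p.2 * ((oneChart E G).symm p.1)⁻¹)
      (oneChart E G 1, oneChart E G 1) :=
  (contMDiffAt_oneChart_symm_mul 𝕜).mul (contMDiffAt_oneChart_symm_fst 𝕜).inv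

variable (𝕜) in
lemma contDiffAt_chartMul : ContDiffAt 𝕜 ω (chartMul E G) (oneChart E G 1, oneChart E G 1) := by
  refine contMDiffAt_iff_contDiffAt.1
    (ContMDiffAt.comp (g := oneChart E G) _ ?_ (contMDiffAt_oneChart_symm_mul 𝕜))
  rw [oneChart_symm_one, one_mul]
  exact contMDiffAt_oneChart 𝕜

variable (𝕜) in
lemma contDiffAt_chartConj : ContDiffAt 𝕜 ω (chartConj E G) (oneChart E G 1, oneChart E G 1) := by
  refine contMDiffAt_iff_contDiffAt.1
    (ContMDiffAt.comp (g := oneChart E G) _ ?_ (contMDiffAt_oneChart_symm_conj 𝕜))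
  rw [oneChart_symm_one, one_mul, inv_one, one_mul]
  exact contMDiffAt_oneChart 𝕜

lemma hasFDerivAt_chartMul_right {x : E} (hx : x ∈ (oneChart E G).target) :
    HasFDerivAt (fun y => chartMul E G (x, y))
      ((mfderiv 𝓘(𝕜, E) 𝓘(𝕜, E) (extChartAt 𝓘(𝕜, E) (1 : G)) ((oneChart E G).symm x) :
        E →L[𝕜] E).comp
        (mfderiv 𝓘(𝕜, E) 𝓘(𝕜, E) (fun h : G => (oneChart E G).symm x * h) 1 : E →L[𝕜] E))
      (oneChart E G 1) := by
  set g : G := (oneChart E G).symm x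
  have hgs : g ∈ (chartAt E (1 : G)).source := (oneChart E G).map_target hx
  suffices ∀ p, p = g * 1 → HasFDerivAt (fun y => chartMul E G (x, y))
      ((mfderiv 𝓘(𝕜, E) 𝓘(𝕜, E) (extChartAt 𝓘(𝕜, E) (1 : G)) p : E →L[𝕜] E).comp
        (mfderiv 𝓘(𝕜, E) 𝓘(𝕜, E) (fun h : G => g * h) 1 : E →L[𝕜] E)) (oneChart E G 1) from
    this g (mul_one g).symm
  rintro _ rfl
  have hchart : HasMFDerivAt 𝓘(𝕜, E) 𝓘(𝕜, E) (extChartAt 𝓘(𝕜, E) (1 : G)) (g * 1)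
      (mfderiv 𝓘(𝕜, E) 𝓘(𝕜, E) (extChartAt 𝓘(𝕜, E) (1 : G)) (g * 1)) :=
    (mdifferentiableAt_extChartAt (by rwa [mul_one])).hasMFDerivAt
  have hmul : HasMFDerivAt 𝓘(𝕜, E) 𝓘(𝕜, E) (fun h : G => g * h) 1
      (mfderiv 𝓘(𝕜, E) 𝓘(𝕜, E) (fun h : G => g * h) 1) :=
    mdifferentiableAt_mul_left.hasMFDerivAt
  have hcomp := (hchart.comp 1 hmul).2
  rw [modelWithCornersSelf_coe, Set.range_id] at hcomp
  exact hasFDerivWithinAt_univ.1 hcomp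

lemma lie_eq_lieBracket_mpullbackWithin (X Y : GroupLieAlgebra 𝓘(𝕜, E) G) {V W : E → E}
    (hV : (mpullbackWithin 𝓘(𝕜, E) 𝓘(𝕜, E) (extChartAt 𝓘(𝕜, E) (1 : G)).symm
      (mulInvariantVectorField X) (Set.range 𝓘(𝕜, E)) : E → E) =ᶠ[𝓝 (oneChart E G 1)] V)
    (hW : (mpullbackWithin 𝓘(𝕜, E) 𝓘(𝕜, E) (extChartAt 𝓘(𝕜, E) (1 : G)).symm
      (mulInvariantVectorField Y) (Set.range 𝓘(𝕜, E)) : E → E) =ᶠ[𝓝 (oneChart E G 1)] W) :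
    ⁅X, Y⁆ = (lieBracket 𝕜 V W (oneChart E G 1) : E) := by
  let V' : E → E := mpullbackWithin 𝓘(𝕜, E) 𝓘(𝕜, E) (extChartAt 𝓘(𝕜, E) (1 : G)).symm
    (mulInvariantVectorField X) (Set.range 𝓘(𝕜, E))
  let W' : E → E := mpullbackWithin 𝓘(𝕜, E) 𝓘(𝕜, E) (extChartAt 𝓘(𝕜, E) (1 : G)).symm
    (mulInvariantVectorField Y) (Set.range 𝓘(𝕜, E))
  have hbr : lieBracket 𝕜 V' W' (oneChart E G 1) = lieBracket 𝕜 V W (oneChart E G 1) :=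
    Filter.EventuallyEq.lieBracket_vectorField_eq hV hW
  have hset : (extChartAt 𝓘(𝕜, E) (1 : G)).symm ⁻¹' Set.univ ∩ Set.range 𝓘(𝕜, E) = Set.univ := by
    simp
  have hinv : ∀ L : E →L[𝕜] E, L = ContinuousLinearMap.id 𝕜 E →
      L.inverse = ContinuousLinearMap.id 𝕜 E := by
    rintro _ rfl; exact ContinuousLinearMap.inverse_id
  rw [← hbr, ← lieBracketWithin_univ, ← hset]
  exact congrArg (fun L : E →L[𝕜] E => L _) (hinv _ mfderiv_extChartAt_self)

lemma mpullbackWithin_mulInvariantVectorField (X : GroupLieAlgebra 𝓘(𝕜, E) G) :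
    (mpullbackWithin 𝓘(𝕜, E) 𝓘(𝕜, E) (extChartAt 𝓘(𝕜, E) (1 : G)).symm
      (mulInvariantVectorField X) (Set.range 𝓘(𝕜, E)) : E → E) =ᶠ[𝓝 (oneChart E G 1)]
      fun x => fderiv 𝕜 (chartMul E G) (x, oneChart E G 1) (0, X) := by
  have hleft : Tendsto (fun x : E => (x, oneChart E G 1)) (𝓝 (oneChart E G 1))
      (𝓝 (oneChart E G 1, oneChart E G 1)) := (Continuous.prodMk_left _).continuousAt
  filter_upwards [chart_target_mem_nhds E (1 : G), hleft.eventually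
    (eventually_differentiableAt_of_contDiffAt (contDiffAt_chartMul 𝕜) le_top)] with x hx hdiff
  have hx' : x ∈ (extChartAt 𝓘(𝕜, E) (1 : G)).target := by simpa using hx
  have hinv : (mfderivWithin 𝓘(𝕜, E) 𝓘(𝕜, E) (extChartAt 𝓘(𝕜, E) (1 : G)).symm
      (Set.range 𝓘(𝕜, E)) x).inverse = mfderiv 𝓘(𝕜, E) 𝓘(𝕜, E) (extChartAt 𝓘(𝕜, E) (1 : G))
        ((extChartAt 𝓘(𝕜, E) (1 : G)).symm x) :=
    ContinuousLinearMap.inverse_eq (mfderivWithin_extChartAt_symm_comp_mfderiv_extChartAt hx')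
      (mfderiv_extChartAt_comp_mfderivWithin_extChartAt_symm hx')
  have hright := (hasFDerivAt_prodMk_right_of_differentiableAt hdiff).unique
    (hasFDerivAt_chartMul_right hx)
  rw [mpullbackWithin_apply, hinv]
  exact (DFunLike.congr_fun hright (show E from X)).symm

theorem lie_eq_fderiv_chartMul (X Y : GroupLieAlgebra 𝓘(𝕜, E) G) :
    ⁅X, Y⁆ =
      (fderiv 𝕜 (fun x => fderiv 𝕜 (chartMul E G) (x, oneChart E G 1) (0, Y)) (oneChart E G 1) X -
      fderiv 𝕜 (fun x => fderiv 𝕜 (chartMul E G) (x, oneChart E G 1) (0, X)) (oneChart E G 1) Y :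
        E) := by
  have hone : ∀ Z : E, fderiv 𝕜 (chartMul E G) (oneChart E G 1, oneChart E G 1) (0, Z) = Z :=
    fderiv_apply_inr_of_eventually_eq ((contDiffAt_chartMul 𝕜).differentiableAt (by simp))
      eventually_one_chartMul
  rw [lie_eq_lieBracket_mpullbackWithin X Y (mpullbackWithin_mulInvariantVectorField X)
    (mpullbackWithin_mulInvariantVectorField Y), lieBracket]
  exact congrArg₂ (fun a b : E =>
    fderiv 𝕜 (fun x => fderiv 𝕜 (chartMul E G) (x, oneChart E G 1) (0, Y)) (oneChart E G 1) a -
    fderiv 𝕜 (fun x => fderiv 𝕜 (chartMul E G) (x, oneChart E G 1) (0, X)) (oneChart E G 1) b)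
    (hone X) (hone Y)

end OneChart

section Velocity

variable {E : Type*} [NormedAddCommGroup E] {G : Type*} [TopologicalSpace G] [ChartedSpace E G]
  [Group G]

variable (E) in
/-- A self-map of `G` read in the chart at the identity. For a map fixing the identity, its
derivative at `oneChart E G 1` is the differential at the identity. -/
def chartRep (f : G → G) (y : E) : E := oneChart E G (f ((oneChart E G).symm y))

lemma hasFDerivAt_chartRep_comp {𝕜 : Type*} [NontriviallyNormedField 𝕜] [NormedSpace 𝕜 E]
    {f g : G → G} {Lf Lg : E →L[𝕜] E} (hf : HasFDerivAt (chartRep E f) Lf (oneChart E G 1))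
    (hg : HasFDerivAt (chartRep E g) Lg (oneChart E G 1)) (hgc : ContinuousAt g 1) (hg1 : g 1 = 1) :
    HasFDerivAt (chartRep E fun x => f (g x)) (Lf.comp Lg) (oneChart E G 1) := by
  have hone : chartRep E g (oneChart E G 1) = oneChart E G 1 := by
    simp [chartRep, hg1]
  rw [← hone] at hf
  refine (hf.comp _ hg).congr_of_eventuallyEq ?_
  have hc : ContinuousAt (fun y => g ((oneChart E G).symm y)) (oneChart E G 1) :=
    ContinuousAt.comp (by rwa [oneChart_symm_one])
      ((oneChart E G).symm.continuousAt (mem_chart_target E 1))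
  filter_upwards [eventually_symm_oneChart (E := E) hc (by rw [oneChart_symm_one, hg1])] with y hy
  simp only [chartRep, Function.comp_apply, hy]

variable [NormedSpace ℝ E] {γ : ℝ → G} {X : E}

/-- The curve `γ` passes through the identity at time `0`, with velocity `X` in the chart there. -/
def HasVelocity (γ : ℝ → G) (X : E) : Prop :=
  γ 0 = 1 ∧ ContinuousAt γ 0 ∧ HasDerivAt (fun s => oneChart E G (γ s)) X 0

lemma hasMFDerivAt_iff_hasVelocity (hγ : γ 0 = 1) :
    HasMFDerivAt 𝓘(ℝ, ℝ) 𝓘(ℝ, E) γ 0 (ContinuousLinearMap.toSpanSingleton ℝ X) ↔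
      HasVelocity γ X := by
  have hchart : HasDerivAt (fun s => oneChart E G (γ s)) X 0 ↔
      HasFDerivWithinAt (writtenInExtChartAt 𝓘(ℝ, ℝ) 𝓘(ℝ, E) (0 : ℝ) γ)
        (ContinuousLinearMap.toSpanSingleton ℝ X) (Set.range 𝓘(ℝ, ℝ))
        (extChartAt 𝓘(ℝ, ℝ) (0 : ℝ) 0) := by
    rw [modelWithCornersSelf_coe, Set.range_id, hasFDerivWithinAt_univ,
      hasDerivAt_iff_hasFDerivAt]
    simp only [writtenInExtChartAt, hγ]
    rfl
  exact ⟨fun h => ⟨hγ, h.1, hchart.2 h.2⟩, fun h => ⟨h.2.1, hchart.1 h.2.2⟩⟩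

lemma HasVelocity.hasDerivAt_comp {F : Type*} [NormedAddCommGroup F] [NormedSpace ℝ F]
    (hγ : HasVelocity γ X) {f : G → F} {L : E →L[ℝ] F}
    (hf : HasFDerivAt (fun y => f ((oneChart E G).symm y)) L (oneChart E G 1)) :
    HasDerivAt (fun s => f (γ s)) (L X) 0 := by
  obtain ⟨h0, hc, hd⟩ := hγ
  rw [← h0] at hf
  refine (hf.comp_hasDerivAt 0 hd).congr_of_eventuallyEq ?_
  filter_upwards [eventually_symm_oneChart (E := E) hc h0] with s hs
  simp only [Function.comp_apply, hs]

lemma HasVelocity.comp (hγ : HasVelocity γ X) {f : G → G} {L : E →L[ℝ] E}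
    (hf : HasFDerivAt (chartRep E f) L (oneChart E G 1)) (hfc : ContinuousAt f 1) (hf1 : f 1 = 1) :
    HasVelocity (fun s => f (γ s)) (L X) :=
  ⟨by simp only [hγ.1, hf1], ContinuousAt.comp (by rwa [hγ.1]) hγ.2.1,
    hγ.hasDerivAt_comp (f := fun g => oneChart E G (f g)) hf⟩

lemma HasVelocity.smul (hγ : HasVelocity γ X) (c : ℝ) :
    HasVelocity (fun s => γ (c * s)) (c • X) := by
  obtain ⟨h0, hc, hd⟩ := hγ
  have hmul : HasDerivAt (fun s : ℝ => c * s) c 0 := by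
    simpa using (hasDerivAt_id (0 : ℝ)).const_mul c
  rw [← mul_zero c] at hd
  exact ⟨by simpa using h0, ContinuousAt.comp (g := γ) (by rwa [mul_zero]) hmul.continuousAt,
    hd.scomp (0 : ℝ) hmul⟩

end Velocity

section Adjoint

variable {E : Type*} [NormedAddCommGroup E] [NormedSpace ℂ E]
  {G : Type*} [TopologicalSpace G] [ChartedSpace E G] [Group G]

/-- The adjoint action `Ad g` as a continuous linear map. -/
noncomputable def AdL (g : G) : E →L[ℂ] E :=
  mfderiv 𝓘(ℂ, E) 𝓘(ℂ, E) (fun x : G => g * x * g⁻¹) (1 : G)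

variable {X W : LieAlg E G} {γ γ' : ℝ → G}

lemma isOneParameterSubgroup_iff : IsOneParameterSubgroup X γ ↔
    (∀ s t : ℝ, γ (s + t) = γ s * γ t) ∧ HasVelocity (E := E) γ X :=
  and_congr_right fun h =>
    hasMFDerivAt_iff_hasVelocity (X := (show E from X)) (by simpa using h 0 0)

lemma IsOneParameterSubgroup.hasVelocity (hγ : IsOneParameterSubgroup X γ) :
    HasVelocity (E := E) γ X :=
  (isOneParameterSubgroup_iff.1 hγ).2

lemma IsOneParameterSubgroup.map_zero (hγ : IsOneParameterSubgroup X γ) : γ 0 = 1 :=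
  hγ.hasVelocity.1

lemma IsOneParameterSubgroup.smul (hγ : IsOneParameterSubgroup X γ) (c : ℝ) :
    IsOneParameterSubgroup (c • X) (fun s => γ (c * s)) :=
  isOneParameterSubgroup_iff.2 ⟨fun s t => by rw [mul_add, hγ.1], hγ.hasVelocity.smul c⟩

variable [LieGroup 𝓘(ℂ, E) ω G]

lemma contMDiff_conj (g : G) : ContMDiff 𝓘(ℂ, E) 𝓘(ℂ, E) ω (fun x : G => g * x * g⁻¹) :=
  (contMDiff_mul_right (I := 𝓘(ℂ, E)) (n := ω) (a := g⁻¹)).comp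
    (contMDiff_mul_left (I := 𝓘(ℂ, E)) (n := ω) (a := g))

lemma hasFDerivAt_chartRep_conj (g : G) :
    HasFDerivAt (chartRep E fun x : G => g * x * g⁻¹) (AdL (E := E) g) (oneChart E G 1) :=
  hasFDerivAt_oneChart_comp (by simp)
    ((contMDiff_conj g).contMDiffAt.mdifferentiableAt (by simp)).hasMFDerivAt

lemma AdL_mul (g h : G) : AdL (E := E) (g * h) = (AdL g).comp (AdL h) := by
  have hcomp := hasFDerivAt_chartRep_comp (hasFDerivAt_chartRep_conj g)
    (hasFDerivAt_chartRep_conj (E := E) h) (contMDiff_conj (E := E) h).continuous.continuousAt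
    (by simp)
  refine (hasFDerivAt_chartRep_conj (E := E) (g * h)).unique ?_
  convert hcomp using 2
  funext x
  group

lemma AdL_one : AdL (E := E) (1 : G) = ContinuousLinearMap.id ℂ E := by
  refine (hasFDerivAt_chartRep_conj (E := E) (1 : G)).unique
    ((hasFDerivAt_id _).congr_of_eventuallyEq ?_)
  filter_upwards [chart_target_mem_nhds E (1 : G)] with x hx
  simp only [chartRep, one_mul, inv_one, mul_one]
  exact (oneChart E G).right_inv hx

lemma AdL_oneChart_symm (Y : E) : (fun x => AdL (E := E) ((oneChart E G).symm x) Y)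
    =ᶠ[𝓝 (oneChart E G 1)] fun x => fderiv ℂ (chartConj E G) (x, oneChart E G 1) (0, Y) := by
  have hleft : Tendsto (fun x : E => (x, oneChart E G 1)) (𝓝 (oneChart E G 1))
      (𝓝 (oneChart E G 1, oneChart E G 1)) := (Continuous.prodMk_left _).continuousAt
  filter_upwards [hleft.eventually
    (eventually_differentiableAt_of_contDiffAt (contDiffAt_chartConj ℂ) le_top)] with x hx
  exact DFunLike.congr_fun ((hasFDerivAt_chartRep_conj ((oneChart E G).symm x)).unique
    (hasFDerivAt_prodMk_right_of_differentiableAt hx)) Y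

theorem HasVelocity.hasDerivAt_AdL (hγ : HasVelocity (E := E) γ X) (Y : LieAlg E G) :
    HasDerivAt (F := E) (fun s => AdL (E := E) (γ s) Y) (⁅X, Y⁆ : LieAlg E G) 0 := by
  have : IsTopologicalGroup G := topologicalGroup_of_lieGroup 𝓘(ℂ, E) ω
  obtain ⟨L, hL, hLX⟩ := exists_hasFDerivAt_conj_of_local_group (E := E)
    ((contDiffAt_chartMul ℂ).of_le le_top) ((contDiffAt_chartConj ℂ).of_le le_top)
    (eventually_chartMul_one (E := E) (G := G)) (Eventually.of_forall chartConj_one)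
    eventually_one_chartConj eventually_chartMul_chartConj Y
  have hlie : (⁅X, Y⁆ : LieAlg E G) = (L X : E) :=
    (lie_eq_fderiv_chartMul X Y).trans (hLX X).symm
  rw [hlie]
  exact hγ.hasDerivAt_comp (f := fun g => AdL (E := E) g Y)
    ((hL.congr_of_eventuallyEq (AdL_oneChart_symm (E := E) Y)).restrictScalars ℝ)

lemma IsOneParameterSubgroup.continuous (hγ : IsOneParameterSubgroup X γ) : Continuous γ := by
  refine continuous_iff_continuousAt.2 fun t => ?_
  have htrans : γ = fun s => γ t * γ (s - t) := by
    funext s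
    rw [← hγ.1, add_sub_cancel]
  rw [htrans]
  have hsub : ContinuousAt (fun s => γ (s - t)) t :=
    ContinuousAt.comp (g := γ) (f := fun s => s - t)
      (by rw [sub_self]; exact hγ.hasVelocity.2.1) (continuous_sub_right t).continuousAt
  exact (contMDiff_mul_left (I := 𝓘(ℂ, E)) (n := ω) (a := γ t)).continuous.continuousAt.comp hsub

lemma IsOneParameterSubgroup.conj (hγ : IsOneParameterSubgroup X γ) (g : G) :
    IsOneParameterSubgroup (Ad g X) (fun s => g * γ s * g⁻¹) :=
  isOneParameterSubgroup_iff.2 ⟨fun s t => by rw [hγ.1]; group,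
    hγ.hasVelocity.comp ((hasFDerivAt_chartRep_conj (E := E) g).restrictScalars ℝ)
      (contMDiff_conj (E := E) g).continuous.continuousAt (by simp)⟩

lemma IsOneParameterSubgroup.hasDerivAt_AdL (hγ : IsOneParameterSubgroup X γ) (W : LieAlg E G)
    (t : ℝ) :
    HasDerivAt (F := E) (fun s => AdL (E := E) (γ s) W) (AdL (γ t) (⁅X, W⁆ : LieAlg E G)) t := by
  have h0 : HasDerivAt (F := E) (fun s : ℝ => AdL (E := E) (γ s) W) (⁅X, W⁆ : LieAlg E G)
      (t - t) := by
    rw [sub_self]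
    exact hγ.hasVelocity.hasDerivAt_AdL W
  refine (((AdL (E := E) (γ t)).restrictScalars ℝ).hasFDerivAt.comp_hasDerivAt t
    (h0.comp_sub_const t t)).congr_of_eventuallyEq (Eventually.of_forall fun s => ?_)
  have hs : γ s = γ t * γ (s - t) := by rw [← hγ.1, add_sub_cancel]
  simp only [hs, AdL_mul]
  rfl

theorem IsOneParameterSubgroup.Ad_of_lie_eq_smul (hγ : IsOneParameterSubgroup X γ) {c : ℂ}
    (h : ⁅X, W⁆ = c • W) : Ad (γ 1) W = Complex.exp c • W := by
  let w : E := W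
  let f : ℝ → E := fun s => Complex.exp (-(s * c)) • AdL (γ s) w
  have hAd : ∀ t : ℝ, HasDerivAt (F := E) (fun s => AdL (E := E) (γ s) w) (c • AdL (γ t) w) t :=
    fun t => (hγ.hasDerivAt_AdL W t).congr_deriv
      ((congrArg (AdL (E := E) (γ t)) h).trans (map_smul (AdL (γ t)) c w))
  have hf : ∀ t : ℝ, HasDerivAt f 0 t := by
    intro t
    have hlin : HasDerivAt (fun s : ℝ => -((s : ℂ) * c)) (-c) t :=
      ((Complex.ofRealCLM.hasDerivAt.mul_const c).neg).congr_deriv (by simp)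
    refine (hlin.cexp.smul (hAd t)).congr_deriv ?_
    rw [smul_smul, ← add_smul]
    simp
  have hconst : f 1 = f 0 :=
    is_const_of_deriv_eq_zero (fun t => (hf t).differentiableAt) (fun t => (hf t).deriv) 1 0
  have h0 : f 0 = w := by simp [f, hγ.map_zero, AdL_one]
  have h1 : Complex.exp c • f 1 = AdL (γ 1) w := by
    simp [f, smul_smul, ← Complex.exp_add]
  rw [hconst, h0] at h1
  exact h1.symm

variable [T2Space G]

lemma IsOneParameterSubgroup.unique (hγ : IsOneParameterSubgroup X γ)
    (hγ' : IsOneParameterSubgroup X γ') : γ = γ' := by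
  have : LieGroup 𝓘(ℝ, E) ω G := lieGroup_real_of_complex
  exact oneParameterSubgroup_unique (X := (show E from X)) hγ.1 hγ'.1 hγ.2 hγ'.2

lemma IsOneParameterSubgroup.lieExp_eq (hγ : IsOneParameterSubgroup X γ) : lieExp X = γ 1 := by
  have h : ∃ γ, IsOneParameterSubgroup X γ := ⟨γ, hγ⟩
  rw [lieExp, dif_pos h, h.choose_spec.unique hγ]

variable [CompleteSpace E]

lemma isOneParameterSubgroup_lieExp (X : LieAlg E G) :
    IsOneParameterSubgroup X (fun s => lieExp (s • X)) := by
  have : LieGroup 𝓘(ℝ, E) ω G := lieGroup_real_of_complex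
  obtain ⟨γ, hγ⟩ : ∃ γ, IsOneParameterSubgroup X γ := exists_oneParameterSubgroup (show E from X)
  convert hγ using 1
  funext s
  rw [(hγ.smul s).lieExp_eq, mul_one]

lemma lieExp_conj (g : G) (X : LieAlg E G) : lieExp (Ad g X) = g * lieExp X * g⁻¹ := by
  simpa only [one_smul] using ((isOneParameterSubgroup_lieExp X).conj g).lieExp_eq

theorem Ad_lieExp_of_lie_eq_smul {c : ℂ} (h : ⁅X, W⁆ = c • W) :
    Ad (lieExp X) W = Complex.exp c • W := by
  simpa only [one_smul] using (isOneParameterSubgroup_lieExp X).Ad_of_lie_eq_smul h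

lemma Ad_lieExp_of_lie_eq_zero (h : ⁅X, W⁆ = 0) : Ad (lieExp X) W = W := by
  simpa using Ad_lieExp_of_lie_eq_smul (c := 0) (by rw [h, zero_smul])

end Adjoint

section Involution

variable {E : Type*} [NormedAddCommGroup E] [NormedSpace ℂ E]
  {G : Type*} [TopologicalSpace G] [ChartedSpace E G] [Group G] {φ ψ : G ≃* G}

/-- The differential `dAut φ` as a continuous linear map. -/
noncomputable def dAutL (φ : G → G) : E →L[ℝ] E := mfderiv 𝓘(ℝ, E) 𝓘(ℝ, E) φ (1 : G)

lemma IsLieInvolution.continuousAt (hφ : IsLieInvolution E φ) (g : G) : ContinuousAt φ g :=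
  hφ.1.continuous.continuousAt

lemma IsLieInvolution.hasFDerivAt (hφ : IsLieInvolution E φ) :
    HasFDerivAt (chartRep E φ) (dAutL (E := E) φ) (oneChart E G 1) :=
  hasFDerivAt_oneChart_comp (map_one φ)
    (hφ.1.contMDiffAt.mdifferentiableAt (by simp)).hasMFDerivAt

lemma dAut_comp (hφ : IsLieInvolution E φ) (hψ : IsLieInvolution E ψ) (X : LieAlg E G) :
    dAut (fun x => φ (ψ x)) X = dAut φ (dAut ψ X) := by
  have hcomp := hasFDerivAt_chartRep_comp hφ.hasFDerivAt hψ.hasFDerivAt (hψ.continuousAt 1)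
    (map_one ψ)
  have hd : HasFDerivAt (chartRep E fun x => φ (ψ x)) (dAutL (E := E) fun x => φ (ψ x))
      (oneChart E G 1) :=
    hasFDerivAt_oneChart_comp (by simp)
      ((hφ.1.comp hψ.1).contMDiffAt.mdifferentiableAt (by simp)).hasMFDerivAt
  exact DFunLike.congr_fun (hd.unique hcomp) (show E from X)

lemma IsLieInvolution.dAut_dAut (hφ : IsLieInvolution E φ) (X : LieAlg E G) :
    dAut φ (dAut φ X) = X := by
  have hcomp := hasFDerivAt_chartRep_comp hφ.hasFDerivAt hφ.hasFDerivAt (hφ.continuousAt 1)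
    (map_one φ)
  have hid : HasFDerivAt (chartRep E fun x => φ (φ x)) (ContinuousLinearMap.id ℝ E)
      (oneChart E G 1) := by
    refine (hasFDerivAt_id _).congr_of_eventuallyEq ?_
    filter_upwards [chart_target_mem_nhds E (1 : G)] with x hx
    simp only [chartRep, hφ.2]
    exact (oneChart E G).right_inv hx
  exact DFunLike.congr_fun (hcomp.unique hid) (show E from X)

lemma IsLieInvolution.comp_oneParameterSubgroup (hφ : IsLieInvolution E φ)
    {X : LieAlg E G} {γ : ℝ → G} (hγ : IsOneParameterSubgroup X γ) :
    IsOneParameterSubgroup (dAut φ X) (fun s => φ (γ s)) :=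
  isOneParameterSubgroup_iff.2 ⟨fun s t => by rw [hγ.1, map_mul],
    hγ.hasVelocity.comp hφ.hasFDerivAt (hφ.continuousAt 1) (map_one φ)⟩

variable [LieGroup 𝓘(ℂ, E) ω G]

lemma IsLieInvolution.dAut_Ad (hφ : IsLieInvolution E φ) (g : G) (X : LieAlg E G) :
    dAut φ (Ad g X) = Ad (φ g) (dAut φ X) := by
  have hleft := hasFDerivAt_chartRep_comp hφ.hasFDerivAt
    ((hasFDerivAt_chartRep_conj (E := E) g).restrictScalars ℝ)
    (contMDiff_conj (E := E) g).continuous.continuousAt (by simp)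
  have hright := hasFDerivAt_chartRep_comp
    ((hasFDerivAt_chartRep_conj (E := E) (φ g)).restrictScalars ℝ) hφ.hasFDerivAt
    (hφ.continuousAt 1) (map_one φ)
  have hφg : (fun x => φ (g * x * g⁻¹)) = fun x => φ g * φ x * (φ g)⁻¹ := by
    funext x; simp
  rw [hφg] at hleft
  exact DFunLike.congr_fun (hleft.unique hright) (show E from X)

variable [CompleteSpace E] [T2Space G]

lemma IsLieInvolution.lieExp_dAut (hφ : IsLieInvolution E φ) (X : LieAlg E G) :
    lieExp (dAut φ X) = φ (lieExp X) := by
  simpa only [one_smul] using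
    (hφ.comp_oneParameterSubgroup (isOneParameterSubgroup_lieExp X)).lieExp_eq

theorem IsLieInvolution.dAut_lie (hφ : IsLieInvolution E φ) (X Y : LieAlg E G) :
    dAut φ ⁅X, Y⁆ = ⁅dAut φ X, dAut φ Y⁆ := by
  have hγ := isOneParameterSubgroup_lieExp X
  have hleft := (dAutL (E := E) φ).hasFDerivAt.comp_hasDerivAt 0 (hγ.hasVelocity.hasDerivAt_AdL Y)
  have hright := (hφ.comp_oneParameterSubgroup hγ).hasVelocity.hasDerivAt_AdL (dAut φ Y)
  refine hleft.unique (hright.congr_of_eventuallyEq (Eventually.of_forall fun s => ?_))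
  exact hφ.dAut_Ad (lieExp (s • X)) Y

end Involution

end ComplexLie

/-! ### Real forms with a Cartan involution -/

open Complex (I)

section KillingForm

variable {𝔤 : Type*} [LieRing 𝔤] [LieAlgebra ℝ 𝔤]

lemma killingForm_map_of_involutive {f : 𝔤 →ₗ[ℝ] 𝔤} (hf : ∀ x, f (f x) = x)
    (hlie : ∀ x y, f ⁅x, y⁆ = ⁅f x, f y⁆) (x y : 𝔤) :
    killingForm ℝ 𝔤 (f x) (f y) = killingForm ℝ 𝔤 x y :=
  let e : 𝔤 ≃ₗ⁅ℝ⁆ 𝔤 :=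
    { f with map_lie' := hlie _ _, invFun := f, left_inv := hf, right_inv := hf }
  LieAlgebra.killingForm_of_equiv_apply e x y

lemma killingForm_lie_left (x y z : 𝔤) :
    killingForm ℝ 𝔤 ⁅x, y⁆ z = -killingForm ℝ 𝔤 y ⁅x, z⁆ := by
  rw [← lie_skew, map_neg, LinearMap.neg_apply]
  exact congrArg Neg.neg (LieModule.traceForm_apply_lie_apply ℝ 𝔤 𝔤 y x z)

lemma killingForm_smul_left [LieAlgebra ℂ 𝔤] [IsScalarTower ℝ ℂ 𝔤] (c : ℂ) (x y : 𝔤) :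
    killingForm ℝ 𝔤 (c • x) y = killingForm ℝ 𝔤 x (c • y) := by
  rw [killingForm_apply_apply, killingForm_apply_apply]
  congr 1
  ext z
  simp

end KillingForm

lemma smul_I_smul_I {M : Type*} [AddCommGroup M] [Module ℂ M] (x : M) : I • I • x = -x := by
  rw [smul_smul, Complex.I_mul_I, neg_one_smul]

/-- A complex Lie algebra `𝔤` with commuting involutive automorphisms of `𝔤` as a real Lie algebra:
a Cartan involution `Θ`, and `T` whose fixed points form a real form of `𝔤`. The last two fields say
that `𝔤` is the direct sum of the fixed points of `T` and their multiples by `i`. -/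
structure CartanRealForm (𝔤 : Type*) [LieRing 𝔤] [LieAlgebra ℂ 𝔤] [LieAlgebra ℝ 𝔤] where
  Θ : 𝔤 →ₗ[ℝ] 𝔤
  T : 𝔤 →ₗ[ℝ] 𝔤
  Θ_Θ : ∀ x, Θ (Θ x) = x
  T_T : ∀ x, T (T x) = x
  Θ_lie : ∀ x y, Θ ⁅x, y⁆ = ⁅Θ x, Θ y⁆
  T_lie : ∀ x y, T ⁅x, y⁆ = ⁅T x, T y⁆
  Θ_T : ∀ x, Θ (T x) = T (Θ x)
  pos : ∀ x, x ≠ 0 → 0 < -killingForm ℝ 𝔤 x (Θ x)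
  exists_eq_add : ∀ x, ∃ a b, T a = a ∧ T b = b ∧ x = a + I • b
  eq_zero_of_eq_smul : ∀ a b, T a = a → T b = b → a = I • b → a = 0

namespace CartanRealForm

variable {𝔤 : Type*} [LieRing 𝔤] [LieAlgebra ℂ 𝔤] [LieAlgebra ℝ 𝔤] (D : CartanRealForm 𝔤)

section Conjugation

lemma killingForm_Θ (x y : 𝔤) : killingForm ℝ 𝔤 (D.Θ x) (D.Θ y) = killingForm ℝ 𝔤 x y :=
  killingForm_map_of_involutive D.Θ_Θ D.Θ_lie x y

lemma eq_zero_of_killingForm_Θ_nonneg {x : 𝔤} (h : 0 ≤ killingForm ℝ 𝔤 x (D.Θ x)) : x = 0 := by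
  by_contra hx
  linarith [D.pos x hx]

include D in
lemma eq_zero_of_lie_eq_zero {x : 𝔤} (h : ∀ y : 𝔤, ⁅x, y⁆ = 0) : x = 0 := by
  have had : LieAlgebra.ad ℝ 𝔤 x = 0 := by
    ext y
    simp [h]
  exact D.eq_zero_of_killingForm_Θ_nonneg (by simp [killingForm_apply_apply, had])

include D in
/-- Both sides are centroid operators applied to `x`, and centroid operators commute because the
center of `𝔤` is trivial. -/
lemma smul_I_map_smul_I_map {f : 𝔤 →ₗ[ℝ] 𝔤} (hf : ∀ x, f (f x) = x)
    (hlie : ∀ x y, f ⁅x, y⁆ = ⁅f x, f y⁆) (x : 𝔤) : I • f (I • f x) = f (I • f (I • x)) := by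
  have hl : ∀ x y, ⁅f (I • f x), y⁆ = f (I • f ⁅x, y⁆) := fun x y => by
    rw [hlie, ← smul_lie, hlie, hf]
  rw [← sub_eq_zero]
  refine D.eq_zero_of_lie_eq_zero fun y => ?_
  rw [sub_lie, hl, smul_lie, ← lie_smul, hl, lie_smul, smul_lie, sub_self]

lemma T_smul_I_of_T_eq {x : 𝔤} (hx : D.T x = x) : D.T (I • x) = -(I • x) := by
  have hcomm := D.smul_I_map_smul_I_map D.T_T D.T_lie x
  rw [hx] at hcomm
  set P := D.T (I • x) + I • x with hP
  have hTP : D.T P = P := by rw [hP, map_add, D.T_T, add_comm]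
  have hTIP : D.T (I • P) = I • P := by
    rw [hP, smul_add, smul_I_smul_I, map_add, ← hcomm, map_neg, hx]
  have hIP : I • P = 0 := D.eq_zero_of_eq_smul _ P hTIP hTP rfl
  exact eq_neg_of_add_eq_zero_left ((smul_eq_zero_iff_right Complex.I_ne_zero).1 hIP)

lemma T_smul_I (x : 𝔤) : D.T (I • x) = -(I • D.T x) := by
  obtain ⟨a, b, ha, hb, rfl⟩ := D.exists_eq_add x
  simp only [smul_add, smul_I_smul_I, map_add, map_neg, D.T_smul_I_of_T_eq ha,
    D.T_smul_I_of_T_eq hb, ha, hb, smul_neg]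
  abel

variable [IsScalarTower ℝ ℂ 𝔤]

lemma eq_zero_of_Θ_smul_I {x : 𝔤} (h : D.Θ (I • x) = I • D.Θ x) : x = 0 := by
  by_contra hx
  have hpos := D.pos (I • x) ((smul_ne_zero_iff_right Complex.I_ne_zero).2 hx)
  rw [h, killingForm_smul_left, smul_I_smul_I, map_neg] at hpos
  linarith [D.pos x hx]

lemma Θ_smul_I (x : 𝔤) : D.Θ (I • x) = -(I • D.Θ x) := by
  refine eq_neg_of_add_eq_zero_left (D.eq_zero_of_Θ_smul_I ?_)
  have hcomm := D.smul_I_map_smul_I_map D.Θ_Θ D.Θ_lie x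
  simp only [smul_add, map_add, map_neg, smul_I_smul_I, D.Θ_Θ, hcomm]
  abel

lemma T_smul (z : ℂ) (x : 𝔤) : D.T (z • x) = (starRingEnd ℂ) z • D.T x := by
  have hsmul : ∀ (w : ℂ) (y : 𝔤), w • y = w.re • y + w.im • I • y := fun w y => by
    rw [← algebraMap_smul ℂ w.re, ← algebraMap_smul ℂ w.im, smul_smul, ← add_smul,
      Complex.coe_algebraMap, Complex.re_add_im]
  rw [hsmul z, hsmul _ (D.T x), map_add, map_smul, map_smul, D.T_smul_I]
  simp

lemma exists_real_generator {V : Submodule ℂ 𝔤} (hV : Module.finrank ℂ V = 1)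
    (hT : ∀ x ∈ V, D.T x ∈ V) :
    ∃ e ∈ V, D.T e = e ∧ e ≠ 0 ∧ ∀ x ∈ V, D.T x = x → ∃ r : ℝ, x = r • e := by
  obtain ⟨⟨v, hvV⟩, hv0, -⟩ := finrank_eq_one_iff'.1 hV
  obtain ⟨e, heV, hTe, he0⟩ : ∃ e ∈ V, D.T e = e ∧ e ≠ 0 := by
    by_cases hTv : v + D.T v = 0
    · refine ⟨I • v, V.smul_mem _ hvV, ?_,
        smul_ne_zero Complex.I_ne_zero fun h => hv0 (Subtype.ext h)⟩
      rw [D.T_smul_I, eq_neg_of_add_eq_zero_right hTv, smul_neg, neg_neg]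
    · exact ⟨_, V.add_mem hvV (hT v hvV), by rw [map_add, D.T_T, add_comm], hTv⟩
  refine ⟨e, heV, hTe, he0, fun x hx hTx => ?_⟩
  obtain ⟨z, hz⟩ := exists_smul_eq_of_finrank_eq_one hV
    (x := ⟨e, heV⟩) (fun h => he0 (congrArg Subtype.val h)) ⟨x, hx⟩
  have hxe : x = z • e := (congrArg Subtype.val hz).symm
  have hconj : (starRingEnd ℂ) z = z := by
    refine smul_left_injective ℂ he0 ?_
    change (starRingEnd ℂ) z • e = z • e
    rw [← hxe, ← hTx, hxe, D.T_smul, hTe]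
  obtain ⟨r, hr⟩ := Complex.conj_eq_iff_real.1 hconj
  exact ⟨r, by rw [hxe, hr, ← algebraMap_smul ℂ r, Complex.coe_algebraMap]⟩

end Conjugation

section Euclidean

/-- The real form: the fixed points of `T`. -/
def fixed : Submodule ℝ 𝔤 := LinearMap.eqLocus D.T LinearMap.id

lemma mem_fixed {x : 𝔤} : x ∈ D.fixed ↔ D.T x = x := Iff.rfl

/-- The inner product `-B(x, Θ y)` on the real form. -/
@[reducible] noncomputable def core : InnerProductSpace.Core ℝ D.fixed where
  inner x y := -killingForm ℝ 𝔤 (x : 𝔤) (D.Θ y)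
  conj_inner_symm x y := by
    rw [← D.killingForm_Θ, D.Θ_Θ, LieModule.traceForm_comm]
    rfl
  re_inner_nonneg x := by
    by_cases hx : (x : 𝔤) = 0
    · simp [hx]
    · exact (D.pos x hx).le
  add_left x y z := by
    simp only [Submodule.coe_add, map_add, LinearMap.add_apply]
    ring
  smul_left x y r := by
    simp only [Submodule.coe_smul, map_smul, LinearMap.smul_apply, smul_eq_mul, conj_trivial]
    ring
  definite x h := by
    rw [neg_eq_zero] at h
    exact Subtype.ext (D.eq_zero_of_killingForm_Θ_nonneg h.ge)

noncomputable instance : NormedAddCommGroup D.fixed := D.core.toNormedAddCommGroup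

noncomputable instance : InnerProductSpace ℝ D.fixed := InnerProductSpace.ofCore D.core.toCore

lemma inner_def (x y : D.fixed) : ⟪x, y⟫ = -killingForm ℝ 𝔤 (x : 𝔤) (D.Θ y) := rfl

/-- The real form, with its bracket and Cartan involution, as a Euclidean Cartan algebra. -/
noncomputable def euclidean : EuclideanCartanAlgebra D.fixed where
  br := LinearMap.mk₂ ℝ (fun x y => ⟨⁅(x : 𝔤), (y : 𝔤)⁆, by
      rw [mem_fixed, D.T_lie, D.mem_fixed.1 x.2, D.mem_fixed.1 y.2]⟩)
    (fun _ _ _ => Subtype.ext (by simp)) (fun _ _ _ => Subtype.ext (by simp))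
    (fun _ _ _ => Subtype.ext (by simp)) (fun _ _ _ => Subtype.ext (by simp))
  br_self x := Subtype.ext (lie_self (x : 𝔤))
  jacobi x y z := Subtype.ext (leibniz_lie (x : 𝔤) (y : 𝔤) (z : 𝔤))
  θ := D.Θ.restrict fun x hx => by rw [mem_fixed, ← D.Θ_T, D.mem_fixed.1 hx]
  θ_θ x := Subtype.ext (D.Θ_Θ x)
  θ_br x y := Subtype.ext (D.Θ_lie x y)
  inner_θ x y := by
    rw [inner_def, inner_def]
    exact congrArg Neg.neg (D.killingForm_Θ _ _)
  inner_br x y z := by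
    rw [inner_def, inner_def]
    change -killingForm ℝ 𝔤 ⁅(x : 𝔤), (y : 𝔤)⁆ (D.Θ z) =
      -(-killingForm ℝ 𝔤 (y : 𝔤) (D.Θ ⁅D.Θ x, (z : 𝔤)⁆))
    rw [killingForm_lie_left, D.Θ_lie, D.Θ_Θ]

lemma coe_br (x y : D.fixed) : (D.euclidean.br x y : 𝔤) = ⁅(x : 𝔤), (y : 𝔤)⁆ := rfl

lemma coe_θ (x : D.fixed) : (D.euclidean.θ x : 𝔤) = D.Θ x := rfl

variable {D} {𝔞 : Submodule ℝ D.fixed} {A A₀ e w : D.fixed}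

lemma exists_isSl2Triple_of_mem_weightSpace (h : D.euclidean.IsCartanSubspace 𝔞) (hA : A ∈ 𝔞)
    (hA0 : A ≠ 0) (hw : w ∈ D.euclidean.weightSpace 𝔞 A) (hw0 : w ≠ 0) :
    ∃ r : ℝ, IsSl2Triple ((2 / ‖A‖ ^ 2) • (A : 𝔤)) (r • (w : 𝔤)) (-D.Θ (r • (w : 𝔤))) := by
  have hAn : ‖A‖ ≠ 0 := norm_ne_zero_iff.2 hA0
  have hwn : ‖w‖ ≠ 0 := norm_ne_zero_iff.2 hw0
  have hΘA : D.Θ A = -(A : 𝔤) := congrArg Subtype.val (h.θ_eq_neg A hA)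
  have hAw : ⁅(A : 𝔤), (w : 𝔤)⁆ = ‖A‖ ^ 2 • (w : 𝔤) := by
    rw [← real_inner_self_eq_norm_sq]
    exact congrArg Subtype.val (hw A hA)
  have hAΘw : ⁅(A : 𝔤), D.Θ w⁆ = -(‖A‖ ^ 2 • D.Θ w) := by
    rw [← map_smul, ← hAw, D.Θ_lie, hΘA, neg_lie, neg_neg]
  have hwΘw : ⁅(w : 𝔤), D.Θ w⁆ = -(‖w‖ ^ 2) • (A : 𝔤) := congrArg Subtype.val (h.br_θ_self hw hA)
  set r := √2 / (‖w‖ * ‖A‖) with hr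
  have hr2 : r * r * ‖w‖ ^ 2 = 2 / ‖A‖ ^ 2 := by
    rw [hr]
    field_simp
    exact Real.sq_sqrt zero_le_two
  refine ⟨r, ⟨?_, ?_, ?_, ?_⟩⟩
  · exact smul_ne_zero (by positivity) fun h0 => hA0 (Subtype.ext h0)
  · rw [map_smul, lie_neg, smul_lie, lie_smul, hwΘw, neg_smul, smul_neg, smul_neg, neg_neg,
      smul_smul, smul_smul, hr2]
  · rw [lie_smul, smul_lie, hAw, smul_smul (2 / ‖A‖ ^ 2), div_mul_cancel₀ _ (pow_ne_zero 2 hAn),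
      smul_comm, ofNat_smul_eq_nsmul]
  · rw [map_smul, lie_neg, lie_smul, smul_lie, hAΘw, smul_neg, smul_smul (2 / ‖A‖ ^ 2),
      div_mul_cancel₀ _ (pow_ne_zero 2 hAn), smul_neg, smul_comm, ofNat_smul_eq_nsmul, smul_neg]

theorem exists_isSl2Triple_of_isLongestWeightVector [FiniteDimensional ℝ 𝔤]
    (h : D.euclidean.IsCartanSubspace 𝔞) (hD : D.euclidean.IsSimple)
    (hk : ∀ w, D.euclidean.θ w = w → (∀ y, D.euclidean.θ y = y → D.euclidean.br w y = 0) → w = 0)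
    (he : D.euclidean.IsLongestWeightVector 𝔞 A₀ e) :
    ∃ H ∈ 𝔞, ∃ X : D.fixed, IsSl2Triple (H : 𝔤) X (-D.Θ X) ∧ ⁅(H : 𝔤), (e : 𝔤)⁆ = e := by
  obtain ⟨A, hA, w, hw, hw0, hnorm, hpos, hne, hbr⟩ := h.exists_oblique_longest_weight hD hk he
  have hA0 : A ≠ 0 := by
    rintro rfl
    simp at hpos
  obtain ⟨r, hsl⟩ := exists_isSl2Triple_of_mem_weightSpace h hA hA0 hw hw0
  have hHe : ⁅(2 / ‖A‖ ^ 2) • (A : 𝔤), (e : 𝔤)⁆ = (2 / ‖A‖ ^ 2 * ⟪A, A₀⟫) • (e : 𝔤) := by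
    rw [smul_lie, ← coe_br, he.mem A hA, Submodule.coe_smul, smul_smul]
  have hprim : hsl.HasPrimitiveVectorWith (e : 𝔤) (2 / ‖A‖ ^ 2 * ⟪A, A₀⟫) :=
    ⟨fun h0 => he.ne_zero (Subtype.ext h0), hHe, by rw [smul_lie, ← coe_br, hbr]; simp⟩
  obtain ⟨m, hm⟩ := hprim.exists_nat
  have hsq : 0 < ‖A‖ ^ 2 := by positivity
  have hlt : ⟪A, A₀⟫ < ‖A‖ ^ 2 := by
    have := inner_lt_norm_mul_iff_real.2 (show ‖A₀‖ • A ≠ ‖A‖ • A₀ from fun h => hne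
      (smul_right_injective _ (norm_ne_zero_iff.2 hA0) (by rwa [← hnorm] at h)))
    rwa [← hnorm, ← sq] at this
  have hm0 : (0 : ℝ) < m := hm ▸ mul_pos (by positivity) (real_inner_comm A A₀ ▸ hpos)
  have hm2 : (m : ℝ) < 2 := by
    rw [← hm, div_mul_eq_mul_div, div_lt_iff₀ hsq]
    linarith
  have hm1 : m = 1 := by
    have : 0 < m := by exact_mod_cast hm0
    have : m < 2 := by exact_mod_cast hm2
    lia
  rw [hm, hm1, Nat.cast_one, one_smul] at hHe
  exact ⟨(2 / ‖A‖ ^ 2) • A, 𝔞.smul_mem _ hA, r • w, hsl, hHe⟩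

end Euclidean

section Torus

variable {𝔱 : Submodule ℝ 𝔤}

/-- `𝔱` is a maximal abelian subspace of the vectors fixed by `Θ` and negated by `T`. -/
structure IsTorus (𝔱 : Submodule ℝ 𝔤) : Prop where
  lie_eq_zero : ∀ x ∈ 𝔱, ∀ y ∈ 𝔱, ⁅x, y⁆ = 0
  Θ_eq : ∀ x ∈ 𝔱, D.Θ x = x
  T_eq : ∀ x ∈ 𝔱, D.T x = -x
  mem_of_lie_eq_zero : ∀ x, D.Θ x = x → D.T x = -x → (∀ y ∈ 𝔱, ⁅y, x⁆ = 0) → x ∈ 𝔱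

/-- The element `-iy` of the real form, for `y ∈ 𝔱`. -/
def IsTorus.negI {D : CartanRealForm 𝔤} (h : D.IsTorus 𝔱) {y : 𝔤} (hy : y ∈ 𝔱) : D.fixed :=
  ⟨-(I • y), by rw [mem_fixed, map_neg, D.T_smul_I, h.T_eq y hy, smul_neg, neg_neg]⟩

lemma IsTorus.coe_negI {D : CartanRealForm 𝔤} (h : D.IsTorus 𝔱) {y : 𝔤} (hy : y ∈ 𝔱) :
    (h.negI hy : 𝔤) = -(I • y) := rfl

lemma IsTorus.negI_smul_I {D : CartanRealForm 𝔤} (h : D.IsTorus 𝔱) {A : D.fixed}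
    (hA : I • (A : 𝔤) ∈ 𝔱) : h.negI hA = A :=
  Subtype.ext (neg_eq_iff_eq_neg.2 (smul_I_smul_I (A : 𝔤)))

variable [IsScalarTower ℝ ℂ 𝔤]

/-- The vectors of the real form which multiplication by `i` sends into `𝔱`. -/
def imaginary (𝔱 : Submodule ℝ 𝔤) : Submodule ℝ D.fixed where
  carrier := {x | I • (x : 𝔤) ∈ 𝔱}
  add_mem' hx hy := by
    rw [Set.mem_ofPred_eq, Submodule.coe_add, smul_add]
    exact 𝔱.add_mem hx hy
  zero_mem' := by simp
  smul_mem' r x hx := by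
    rw [Set.mem_ofPred_eq, Submodule.coe_smul, smul_comm]
    exact 𝔱.smul_mem r hx

lemma mem_imaginary {x : D.fixed} : x ∈ D.imaginary 𝔱 ↔ I • (x : 𝔤) ∈ 𝔱 := Iff.rfl

namespace IsTorus

variable {D} {x y : 𝔤} (h : D.IsTorus 𝔱)

include h

lemma negI_mem (hy : y ∈ 𝔱) : h.negI hy ∈ D.imaginary 𝔱 := by
  rwa [mem_imaginary, coe_negI, smul_neg, smul_I_smul_I, neg_neg]

lemma inner_negI (hx : x ∈ 𝔱) (hy : y ∈ 𝔱) :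
    ⟪h.negI hx, h.negI hy⟫ = -killingForm ℝ 𝔤 x y := by
  rw [inner_def, coe_negI, coe_negI]
  simp only [map_neg, LinearMap.neg_apply, D.Θ_smul_I, h.Θ_eq _ hy, neg_neg,
    killingForm_smul_left, smul_I_smul_I]

lemma norm_negI_sq (hx : x ∈ 𝔱) : ‖h.negI hx‖ ^ 2 = -killingForm ℝ 𝔤 x x := by
  rw [← real_inner_self_eq_norm_sq, h.inner_negI]

lemma isCartanSubspace : D.euclidean.IsCartanSubspace (D.imaginary 𝔱) where
  br_eq_zero x hx y hy := by
    have hlie := h.lie_eq_zero _ hx _ hy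
    rw [smul_lie, lie_smul, smul_I_smul_I, neg_eq_zero] at hlie
    exact Subtype.ext hlie
  θ_eq_neg x hx := by
    rw [mem_imaginary] at hx
    rw [Subtype.ext_iff, ← h.negI_smul_I hx, coe_θ, Submodule.coe_neg, coe_negI, map_neg,
      D.Θ_smul_I, h.Θ_eq _ hx]
  mem_of_br_eq_zero x hθ hx := by
    have hΘ : D.Θ x = -x := congrArg Subtype.val hθ
    refine h.mem_of_lie_eq_zero _ (by rw [D.Θ_smul_I, hΘ, smul_neg, neg_neg])
      (by rw [D.T_smul_I, D.mem_fixed.1 x.2]) fun y hy => ?_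
    have hbr := congrArg Subtype.val (hx _ (h.negI_mem hy))
    rw [coe_br, coe_negI, neg_lie, smul_lie] at hbr
    rw [lie_smul]
    exact neg_eq_zero.1 hbr

lemma mem_weightSpace {c : 𝔤} (hc : c ∈ 𝔱) {x : D.fixed} :
    x ∈ D.euclidean.weightSpace (D.imaginary 𝔱) (h.negI hc) ↔
      ∀ y ∈ 𝔱, ⁅y, (x : 𝔤)⁆ = (-(killingForm ℝ 𝔤 c y : ℂ) * I) • (x : 𝔤) := by
  have key : ∀ y (hy : y ∈ 𝔱), D.euclidean.br (h.negI hy) x = ⟪h.negI hy, h.negI hc⟫ • x ↔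
      ⁅y, (x : 𝔤)⁆ = (-(killingForm ℝ 𝔤 c y : ℂ) * I) • (x : 𝔤) := fun y hy => by
    rw [Subtype.ext_iff, coe_br, Submodule.coe_smul, h.inner_negI, LieModule.traceForm_comm,
      coe_negI, neg_lie, smul_lie, neg_smul, neg_inj,
      ← smul_right_inj (r := I) (M := 𝔤) Complex.I_ne_zero, smul_I_smul_I, neg_eq_iff_eq_neg,
      ← algebraMap_smul ℂ (killingForm ℝ 𝔤 c y), Complex.coe_algebraMap, smul_smul, ← neg_smul,
      neg_mul, mul_comm I]
  refine ⟨fun hx y hy => (key y hy).1 (hx _ (h.negI_mem hy)), fun hx A hA => ?_⟩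
  have := (key _ hA).2 (hx _ hA)
  rwa [h.negI_smul_I hA] at this

end IsTorus

end Torus

end CartanRealForm

/-! ### The Cayley transform and the reflection -/

namespace ComplexLie

variable {E : Type*} [NormedAddCommGroup E] [NormedSpace ℂ E] [CompleteSpace E]
  {G : Type*} [TopologicalSpace G] [ChartedSpace E G] [Group G] [LieGroup 𝓘(ℂ, E) ω G]

lemma mem_plusSpace {φ : LieAlg E G →ₗ[ℝ] LieAlg E G} {x : LieAlg E G} :
    x ∈ plusSpace φ ↔ φ x = x := by
  rw [plusSpace, LinearMap.mem_ker, LinearMap.sub_apply, LinearMap.id_apply, sub_eq_zero]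

lemma mem_minusSpace {φ : LieAlg E G →ₗ[ℝ] LieAlg E G} {x : LieAlg E G} :
    x ∈ minusSpace φ ↔ φ x = -x := by
  rw [minusSpace, LinearMap.mem_ker, LinearMap.add_apply, LinearMap.id_apply,
    add_eq_zero_iff_eq_neg]

section Cayley

variable [T2Space G]

lemma lieExp_zero : lieExp (0 : LieAlg E G) = 1 := by
  simpa using (isOneParameterSubgroup_lieExp (0 : LieAlg E G)).map_zero

lemma lieExp_neg (X : LieAlg E G) : lieExp (-X) = (lieExp X)⁻¹ := by
  have hmul := (isOneParameterSubgroup_lieExp X).1 (-1) 1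
  simp only [neg_add_cancel, zero_smul, neg_smul, one_smul, lieExp_zero] at hmul
  exact eq_inv_of_mul_eq_one_left hmul.symm

lemma Ad_lieExp_of_lie_eq_int_smul {X W : LieAlg E G} (n : ℤ)
    (h : ⁅X, W⁆ = (n * (2 * Real.pi * I)) • W) : Ad (lieExp X) W = W := by
  rw [Ad_lieExp_of_lie_eq_smul h, Complex.exp_int_mul_two_pi_mul_I, one_smul]

variable {H X Y : LieAlg E G}

/-- `H ± (X - Y)` are eigenvectors of `ad (X + Y)`. -/
lemma Ad_cayley_of_isSl2Triple (h : IsSl2Triple H X Y) :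
    Ad (lieExp ((Real.pi / 4 * I : ℂ) • (X + Y))) (Real.pi • I • H) = Real.pi • (X - Y) := by
  have hXH : ⁅X, H⁆ = (-2 : ℂ) • X := by
    rw [← lie_skew, h.lie_h_e_nsmul]
    module
  have hYH : ⁅Y, H⁆ = (2 : ℂ) • Y := by
    rw [← lie_skew, h.lie_h_f_nsmul]
    module
  have hYX : ⁅Y, X⁆ = -H := by rw [← lie_skew, h.lie_e_f]
  have hplus := Ad_lieExp_of_lie_eq_smul (X := (Real.pi / 4 * I : ℂ) • (X + Y))
    (W := H + (X - Y)) (c := -(Real.pi / 2 * I)) (by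
      simp only [smul_lie, add_lie, lie_add, lie_sub, hXH, hYH, hYX, h.lie_e_f, lie_self]
      module)
  have hminus := Ad_lieExp_of_lie_eq_smul (X := (Real.pi / 4 * I : ℂ) • (X + Y))
    (W := H - (X - Y)) (c := Real.pi / 2 * I) (by
      simp only [smul_lie, add_lie, lie_sub, hXH, hYH, hYX, h.lie_e_f, lie_self]
      module)
  rw [Complex.exp_pi_div_two_mul_I] at hminus
  rw [Complex.exp_neg, Complex.exp_pi_div_two_mul_I, Complex.inv_I] at hplus
  have hsum : Real.pi • I • H = (Real.pi / 2 * I : ℂ) • ((H + (X - Y)) + (H - (X - Y))) := by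
    rw [← Complex.coe_smul]
    module
  have hrot : -I • (H + (X - Y)) + I • (H - (X - Y)) = (-2 * I) • (X - Y) := by module
  rw [hsum, map_smul, map_add, hplus, hminus, hrot, smul_smul, ← Complex.coe_smul]
  congr 1
  linear_combination (-Real.pi : ℂ) * Complex.I_mul_I

/-- `π(X - Y)` is the image of `πiH` under the Cayley transform, which commutes with `exp(πiH)`. -/
theorem lieExp_pi_smul_of_isSl2Triple (h : IsSl2Triple H X Y) :
    lieExp (Real.pi • I • H) = lieExp (Real.pi • (X - Y)) := by
  set t := lieExp (Real.pi • I • H) with ht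
  set k := lieExp ((Real.pi / 4 * I : ℂ) • (X + Y)) with hk
  have htX : Ad t X = X := Ad_lieExp_of_lie_eq_int_smul 1 (by
    rw [← Complex.coe_smul, smul_lie, smul_lie, h.lie_h_e_nsmul, Int.cast_one]
    module)
  have htY : Ad t Y = Y := Ad_lieExp_of_lie_eq_int_smul (-1) (by
    rw [← Complex.coe_smul, smul_lie, smul_lie, h.lie_h_f_nsmul, Int.cast_neg, Int.cast_one]
    module)
  have hcomm : t * k * t⁻¹ = k := by rw [hk, ← lieExp_conj, map_smul, map_add, htX, htY]
  rw [← Ad_cayley_of_isSl2Triple h, lieExp_conj, ← ht, ← hk, ← mul_inv_eq_iff_eq_mul.1 hcomm,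
    mul_inv_cancel_right]

end Cayley

namespace RealFormData

variable (D : RealFormData E G)

lemma τ_involution : IsLieInvolution E (D.θ.trans D.σ) :=
  ⟨D.σ_involution.1.comp D.θ_cartan.1.1, fun x => by
    simp only [MulEquiv.trans_apply]
    rw [← D.comm, D.θ_cartan.1.2, D.σ_involution.2]⟩

lemma dAut_τ (X : LieAlg E G) :
    dAut (fun x => D.σ (D.θ x)) X = dAut D.σ (dAut D.θ X) :=
  dAut_comp D.σ_involution D.θ_cartan.1 X

lemma dAut_σ (X : LieAlg E G) :
    dAut D.σ X = dAut (fun x => D.σ (D.θ x)) (dAut D.θ X) := by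
  rw [dAut_τ, D.θ_cartan.1.dAut_dAut]

variable [T2Space G]

/-- The differentials of `θ` and `τ`. -/
noncomputable def toCartanRealForm : CartanRealForm (LieAlg E G) where
  Θ := dAut D.θ
  T := dAut fun x => D.σ (D.θ x)
  Θ_Θ := D.θ_cartan.1.dAut_dAut
  T_T := D.τ_involution.dAut_dAut
  Θ_lie := D.θ_cartan.1.dAut_lie
  T_lie := D.τ_involution.dAut_lie
  Θ_T x := (dAut_comp D.θ_cartan.1 D.τ_involution x).symm.trans <|
    (congrArg (fun φ : G → G => dAut φ x) (funext fun g => (D.comm (D.θ g)).symm)).trans <|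
      dAut_comp D.τ_involution D.θ_cartan.1 x
  pos := D.θ_cartan.2
  exists_eq_add x := by
    have hx := D.realForm.sup_eq_top ▸ Submodule.mem_top (x := x)
    obtain ⟨a, ha, b, hb, rfl⟩ := Submodule.mem_sup.1 hx
    obtain ⟨b, hb', rfl⟩ := (Submodule.mem_smul_pointwise_iff_exists _ _ _).1 hb
    exact ⟨a, b, mem_plusSpace.1 ha, mem_plusSpace.1 hb', rfl⟩
  eq_zero_of_eq_smul a b ha hb hab :=
    Submodule.disjoint_def.1 D.realForm.disjoint a (mem_plusSpace.2 ha)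
      (hab ▸ Submodule.smul_mem_pointwise_smul _ _ _ (mem_plusSpace.2 hb))

lemma toCartanRealForm_Θ : D.toCartanRealForm.Θ = dAut D.θ := rfl

lemma toCartanRealForm_T : D.toCartanRealForm.T = dAut fun x => D.σ (D.θ x) := rfl

lemma fixed_toCartanRealForm : D.toCartanRealForm.fixed = D.𝔥' := by
  ext x
  rw [CartanRealForm.mem_fixed, 𝔥', mem_plusSpace, toCartanRealForm_T]

lemma mem_𝔨_inf_𝔮 {x : LieAlg E G} : x ∈ D.𝔨 ⊓ D.𝔮 ↔
    D.toCartanRealForm.Θ x = x ∧ D.toCartanRealForm.T x = -x := by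
  rw [Submodule.mem_inf, 𝔨, 𝔮, mem_plusSpace, mem_minusSpace, toCartanRealForm_T,
    toCartanRealForm_Θ]
  refine and_congr_right fun h => ?_
  rw [dAut_τ, h]

lemma isTorus {𝔱 : Submodule ℝ (LieAlg E G)} (h𝔱 : IsMaxAbelianIn 𝔱 (D.𝔨 ⊓ D.𝔮)) :
    D.toCartanRealForm.IsTorus 𝔱 where
  lie_eq_zero := h𝔱.prop.2
  Θ_eq x hx := (D.mem_𝔨_inf_𝔮.1 (h𝔱.prop.1 hx)).1
  T_eq x hx := (D.mem_𝔨_inf_𝔮.1 (h𝔱.prop.1 hx)).2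
  mem_of_lie_eq_zero x hΘ hT hx := by
    have hle : 𝔱 ⊔ Submodule.span ℝ {x} ≤ 𝔱 := by
      refine h𝔱.le_of_ge ⟨sup_le h𝔱.prop.1 ?_, fun u hu v hv => ?_⟩ le_sup_left
      · exact (Submodule.span_singleton_le_iff_mem _ _).2 (D.mem_𝔨_inf_𝔮.2 ⟨hΘ, hT⟩)
      · obtain ⟨a, ha, _, hr, rfl⟩ := Submodule.mem_sup.1 hu
        obtain ⟨b, hb, _, hs, rfl⟩ := Submodule.mem_sup.1 hv
        obtain ⟨r, rfl⟩ := Submodule.mem_span_singleton.1 hr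
        obtain ⟨s, rfl⟩ := Submodule.mem_span_singleton.1 hs
        have hxb : ⁅x, b⁆ = 0 := by rw [← lie_skew, hx b hb, neg_zero]
        simp only [add_lie, lie_add, smul_lie, lie_smul, hx a ha, hxb, h𝔱.prop.2 a ha b hb,
          lie_self, smul_zero, add_zero]
    exact hle (Submodule.mem_sup_right (Submodule.mem_span_singleton_self x))

theorem euclidean_isSimple : D.toCartanRealForm.euclidean.IsSimple := by
  obtain ⟨L, hL, hsimple⟩ := D.simple
  have hLfixed : L.toSubmodule = D.toCartanRealForm.fixed := hL.trans D.fixed_toCartanRealForm.symm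
  let e : L →ₗ[ℝ] D.toCartanRealForm.fixed := Submodule.inclusion hLfixed.le
  have he : Function.Surjective e := fun x => ⟨⟨x, hLfixed.ge x.2⟩, rfl⟩
  refine ⟨?_, fun W hW => ?_⟩
  · by_contra! habelian
    have hcomm : ∀ x y : L, ⁅(x : LieAlg E G), (y : LieAlg E G)⁆ = 0 := fun x y =>
      congrArg Subtype.val (habelian (e x) (e y))
    exact hsimple.non_abelian ⟨fun x y => Subtype.ext (hcomm x y)⟩
  · let K : LieIdeal ℝ L := { W.comap e with lie_mem := fun {x y} hy => hW (e x) (e y) hy }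
    have hK : K.toSubmodule = W.comap e := rfl
    refine (hsimple.eq_bot_or_eq_top K).imp (fun h => ?_) (fun h => ?_) <;>
    · rw [← Submodule.map_comap_eq_of_surjective he W, ← hK, h]
      simp [LinearMap.range_eq_top.2 he]

lemma eq_zero_of_not_isHermitianType (hnH : ¬ D.IsHermitianType) (w : D.toCartanRealForm.fixed)
    (hw : D.toCartanRealForm.euclidean.θ w = w)
    (hcomm : ∀ y, D.toCartanRealForm.euclidean.θ y = y →
      D.toCartanRealForm.euclidean.br w y = 0) : w = 0 := by
  by_contra hw0
  refine hnH ⟨w, ⟨mem_plusSpace.2 (congrArg Subtype.val hw), mem_plusSpace.2 w.2⟩,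
    fun h => hw0 (Subtype.ext h), fun y hy => ?_⟩
  exact congrArg Subtype.val
    (hcomm ⟨y, mem_plusSpace.1 hy.2⟩ (Subtype.ext (mem_plusSpace.1 hy.1)))

lemma lieExp_smul_mem_H {X : LieAlg E G} (hX : X ∈ D.𝔥) (r : ℝ) : lieExp (r • X) ∈ D.H := by
  have hconn : IsPreconnected (Set.range fun s : ℝ => lieExp (s • X)) :=
    isPreconnected_range (isOneParameterSubgroup_lieExp X).continuous
  refine hconn.subset_connectedComponentIn ⟨0, by simp only [zero_smul, lieExp_zero]⟩ ?_ ⟨r, rfl⟩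
  rintro _ ⟨s, rfl⟩
  change D.σ (lieExp (s • X)) = lieExp (s • X)
  rw [← D.σ_involution.lieExp_dAut, map_smul, mem_plusSpace.1 hX]

end RealFormData

instance finiteDimensional_real_lieAlg [FiniteDimensional ℂ E] :
    FiniteDimensional ℝ (LieAlg E G) :=
  FiniteDimensional.complexToReal E

section Represents

variable {𝔱 : Submodule ℝ (LieAlg E G)} {α : 𝔱 →ₗ[ℝ] ℂ} {C : 𝔱}

lemma Represents.mem_rootSpace_iff (hC : Represents C α) {x : LieAlg E G} :
    x ∈ rootSpace α ↔
      ∀ y ∈ 𝔱, ⁅y, x⁆ = (-(killingForm ℝ (LieAlg E G) C y : ℂ) * I) • x :=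
  ⟨fun hx y hy => (hx ⟨y, hy⟩).trans (by rw [hC]; rfl),
    fun hx y => (hx y y.2).trans (by rw [hC]; rfl)⟩

lemma exists_form_represents (C : 𝔱) : ∃ β : 𝔱 →ₗ[ℝ] ℂ, Represents C β :=
  ⟨(LinearMap.toSpanSingleton ℝ ℂ (-I)).comp ((killingForm ℝ (LieAlg E G) C).comp 𝔱.subtype),
    fun Y => by
      change killingForm ℝ (LieAlg E G) C Y • (-I) = _
      rw [Complex.real_smul, mul_neg, neg_mul]
      rfl⟩

lemma Represents.mem_restrictedRoots (hC : Represents C α) (hCC : B (C : LieAlg E G) C ≠ 0)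
    {x : LieAlg E G} (hx : x ∈ rootSpace α) (hx0 : x ≠ 0) : α ∈ restrictedRoots 𝔱 := by
  refine ⟨?_, fun Y => by simp [hC Y], fun hbot => hx0 ((Submodule.mem_bot ℂ).1 (hbot ▸ hx))⟩
  rintro rfl
  have h0 := hC C
  rw [LinearMap.zero_apply, eq_comm, mul_eq_zero, neg_eq_zero, Complex.ofReal_eq_zero] at h0
  exact hCC (h0.resolve_right Complex.I_ne_zero)

end Represents

namespace RealFormData

variable (D : RealFormData E G) {𝔱 : Submodule ℝ (LieAlg E G)} {α : 𝔱 →ₗ[ℝ] ℂ}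

section

variable {𝔱' : Submodule ℝ (LieAlg E G)} {Z W : LieAlg E G}

lemma B_self_ne_zero_of_mem_𝔪 (hZ : Z ∈ D.𝔪) (hZ0 : Z ≠ 0) : B Z Z ≠ 0 := by
  have hpos := D.θ_cartan.2 Z hZ0
  rw [mem_minusSpace.1 hZ] at hpos
  simp only [B, map_neg, neg_neg] at hpos
  exact hpos.ne'

lemma mem_𝔧_self : Z ∈ D.𝔧 𝔱' α Z :=
  Submodule.mem_sup_left (Submodule.mem_sup_left (Submodule.mem_span_singleton_self Z))

lemma exists_eq_add_of_mem_𝔧 (hab : IsAbelianSubspace 𝔱)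
    (h𝔱' : ∀ X ∈ 𝔱, ∀ W ∈ 𝔱', ⁅X, W⁆ = 0) (hW : W ∈ D.𝔧 𝔱' α Z) :
    ∃ (r : ℝ) (U : LieAlg E G), W = r • Z + U ∧ ∀ X ∈ 𝔱, ⁅X, U⁆ = 0 := by
  obtain ⟨_, hW', _, hv, rfl⟩ := Submodule.mem_sup.1 hW
  obtain ⟨_, hz, _, hu, rfl⟩ := Submodule.mem_sup.1 hW'
  obtain ⟨r, rfl⟩ := Submodule.mem_span_singleton.1 hz
  obtain ⟨_, ⟨u, -, rfl⟩, rfl⟩ := (Submodule.mem_smul_pointwise_iff_exists _ _ _).1 hu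
  obtain ⟨v, hv', rfl⟩ := (Submodule.mem_smul_pointwise_iff_exists _ _ _).1 hv
  refine ⟨r, I • (u : LieAlg E G) + I • v, add_assoc _ _ _, fun X hX => ?_⟩
  rw [lie_add, lie_smul, lie_smul, hab X hX u u.2, h𝔱' X hX v hv'.1, smul_zero, add_zero]

end

variable [T2Space G]

lemma exists_represents [FiniteDimensional ℂ E] (h : D.toCartanRealForm.IsTorus 𝔱)
    (hα : ∀ Y, (α Y).re = 0) : ∃ C : 𝔱, Represents C α := by
  let f : 𝔱 →ₗ[ℝ] Module.Dual ℝ 𝔱 := (killingForm ℝ (LieAlg E G)).domRestrict₁₂ 𝔱 𝔱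
  have hinj : Function.Injective f := (injective_iff_map_eq_zero f).2 fun x hx => by
    refine Subtype.ext (D.toCartanRealForm.eq_zero_of_killingForm_Θ_nonneg ?_)
    rw [h.Θ_eq x x.2]
    exact (DFunLike.congr_fun hx x).ge
  obtain ⟨C, hC⟩ := (LinearMap.injective_iff_surjective_of_finrank_eq_finrank
    Subspace.dual_finrank_eq.symm).1 hinj (-(Complex.imLm.comp α))
  refine ⟨C, fun Y => ?_⟩
  have hCY : B (C : LieAlg E G) (Y : LieAlg E G) = -(α Y).im := DFunLike.congr_fun hC Y
  rw [hCY]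
  apply Complex.ext <;> simp [hα Y]

lemma T_mem_rootSpace (h : D.toCartanRealForm.IsTorus 𝔱) (hα : ∀ Y, (α Y).re = 0)
    {x : LieAlg E G} (hx : x ∈ rootSpace α) : D.toCartanRealForm.T x ∈ rootSpace α := fun Y => by
  have hT := congrArg D.toCartanRealForm.T (hx Y)
  have hconj : (starRingEnd ℂ) (α Y) = -α Y := by
    apply Complex.ext <;> simp [hα Y]
  rwa [D.toCartanRealForm.T_lie, h.T_eq Y Y.2, D.toCartanRealForm.T_smul, hconj, neg_lie, neg_smul,
    neg_inj] at hT

lemma exists_isLongestWeightVector [FiniteDimensional ℂ E]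
    (h : D.toCartanRealForm.IsTorus 𝔱) (hα : IsLongestRoot α)
    (hmult : Module.finrank ℂ (rootSpace α) = 1) :
    ∃ A₀ e : D.toCartanRealForm.fixed, (e : LieAlg E G) ∈ rootSpace α ∧
      D.toCartanRealForm.euclidean.IsLongestWeightVector (D.toCartanRealForm.imaginary 𝔱) A₀ e := by
  obtain ⟨C, hC⟩ := D.exists_represents h hα.1.2.1
  obtain ⟨e, he, hTe, he0, hreal⟩ := D.toCartanRealForm.exists_real_generator hmult
    fun x hx => D.T_mem_rootSpace h hα.1.2.1 hx
  refine ⟨h.negI C.2, ⟨e, hTe⟩, he, h.negI_mem C.2, (h.mem_weightSpace C.2).2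
    (hC.mem_rootSpace_iff.1 he), fun h0 => he0 (congrArg Subtype.val h0), fun x hx => ?_,
    fun A hA x hx hx0 => ?_⟩
  · obtain ⟨r, hr⟩ := hreal x (hC.mem_rootSpace_iff.2 ((h.mem_weightSpace C.2).1 hx)) x.2
    exact ⟨r, Subtype.ext hr⟩
  · let C' : 𝔱 := ⟨I • (A : LieAlg E G), hA⟩
    obtain ⟨β, hβ⟩ := exists_form_represents C'
    have hnorm : ‖A‖ ^ 2 = -B (C' : LieAlg E G) C' := by
      have hsq := h.norm_negI_sq hA
      rwa [h.negI_smul_I hA] at hsq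
    by_cases hA0 : A = 0
    · rw [hA0, norm_zero]
      exact norm_nonneg _
    · have hxβ : (x : LieAlg E G) ∈ rootSpace β := by
        rw [← h.negI_smul_I hA] at hx
        exact hβ.mem_rootSpace_iff.2 ((h.mem_weightSpace hA).1 hx)
      have hCC : B (C' : LieAlg E G) C' ≠ 0 := by
        rw [← neg_ne_zero, ← hnorm]
        exact pow_ne_zero 2 (norm_ne_zero_iff.2 hA0)
      have hβroot := hβ.mem_restrictedRoots hCC hxβ fun h0 => hx0 (Subtype.ext h0)
      refine le_of_sq_le_sq ?_ (norm_nonneg _)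
      rw [hnorm, h.norm_negI_sq C.2]
      exact hα.2 β hβroot C C' hC hβ

theorem exists_isSl2Triple_of_isLongestRoot [FiniteDimensional ℂ E] (hnH : ¬ D.IsHermitianType)
    (h𝔱 : IsMaxAbelianIn 𝔱 (D.𝔨 ⊓ D.𝔮)) (hα : IsLongestRoot α)
    (hmult : Module.finrank ℂ (rootSpace α) = 1) :
    ∃ e ∈ rootSpace α, e ≠ 0 ∧ ∃ H X : LieAlg E G, D.toCartanRealForm.T X = X ∧
      IsSl2Triple H X (-D.toCartanRealForm.Θ X) ∧ I • H ∈ 𝔱 ∧ ⁅H, e⁆ = e := by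
  have h := D.isTorus h𝔱
  obtain ⟨A₀, e, heα, he⟩ := D.exists_isLongestWeightVector h hα hmult
  obtain ⟨H, hH, X, hsl, hHe⟩ := CartanRealForm.exists_isSl2Triple_of_isLongestWeightVector
    h.isCartanSubspace D.euclidean_isSimple (D.eq_zero_of_not_isHermitianType hnH) he
  exact ⟨e, heα, fun h0 => he.ne_zero (Subtype.ext h0), H, X, X.2, hsl, hH, hHe⟩

lemma lieExp_pi_smul_mem_H {H X : LieAlg E G} (hX : D.toCartanRealForm.T X = X)
    (h : IsSl2Triple H X (-D.toCartanRealForm.Θ X)) : lieExp (Real.pi • I • H) ∈ D.H := by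
  have hσ : dAut D.σ (X + D.toCartanRealForm.Θ X) = X + D.toCartanRealForm.Θ X := by
    refine (D.dAut_σ _).trans ?_
    change D.toCartanRealForm.T (D.toCartanRealForm.Θ _) = _
    rw [map_add, map_add, D.toCartanRealForm.Θ_Θ, ← D.toCartanRealForm.Θ_T, hX, add_comm]
  rw [lieExp_pi_smul_of_isSl2Triple h, sub_neg_eq_add]
  exact D.lieExp_smul_mem_H (mem_plusSpace.2 hσ) _

end RealFormData

section Reflection

variable [T2Space G] {𝔱 : Submodule ℝ (LieAlg E G)} {α : 𝔱 →ₗ[ℝ] ℂ}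

lemma exp_eq_neg_one_of_Ad_lieExp_eq_neg {e : LieAlg E G} (he : e ∈ rootSpace α) (he0 : e ≠ 0)
    {Y : 𝔱} (hY : Ad (lieExp (Y : LieAlg E G)) e = -e) : Complex.exp (α Y) = -1 := by
  rw [Ad_lieExp_of_lie_eq_smul (he Y), ← neg_one_smul ℂ e] at hY
  exact smul_left_injective ℂ he0 hY

lemma Ad_lieExp_of_exp_eq_neg_one {Y : 𝔱} (hY : Complex.exp (α Y) = -1) {Z : LieAlg E G}
    (hZ : Z ∈ rootSpace α ⊔ rootSpace (-α)) : Ad (lieExp (Y : LieAlg E G)) Z = -Z := by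
  obtain ⟨P, hP, Q, hQ, rfl⟩ := Submodule.mem_sup.1 hZ
  have hY' : Complex.exp ((-α) Y) = -1 := by
    rw [LinearMap.neg_apply, Complex.exp_neg, hY, inv_neg_one]
  rw [map_add, Ad_lieExp_of_lie_eq_smul (hP Y), Ad_lieExp_of_lie_eq_smul (hQ Y), hY, hY']
  module

variable {Y : 𝔱} {Z U : LieAlg E G}

lemma Ad_lieExp_inv_add (hY : α Y = (Real.pi / 2 : ℂ) * I) {P Q : LieAlg E G}
    (hP : P ∈ rootSpace α) (hQ : Q ∈ rootSpace (-α)) :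
    Ad (lieExp (Y : LieAlg E G))⁻¹ (P + Q) = (-I) • P + I • Q := by
  have hP' : ⁅-(Y : LieAlg E G), P⁆ = (-(Real.pi / 2 * I) : ℂ) • P := by
    rw [neg_lie, hP Y, hY, neg_smul]
  have hQ' : ⁅-(Y : LieAlg E G), Q⁆ = (Real.pi / 2 * I : ℂ) • Q := by
    rw [neg_lie, hQ Y, LinearMap.neg_apply, hY, neg_smul, neg_neg]
  rw [← lieExp_neg, map_add, Ad_lieExp_of_lie_eq_smul hP', Ad_lieExp_of_lie_eq_smul hQ',
    Complex.exp_neg, Complex.exp_pi_div_two_mul_I, Complex.inv_I]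

lemma Ad_lieExp_inv_mem (hY : α Y = (Real.pi / 2 : ℂ) * I)
    (hZ : Z ∈ rootSpace α ⊔ rootSpace (-α)) :
    Ad (lieExp (Y : LieAlg E G))⁻¹ Z ∈ rootSpace α ⊔ rootSpace (-α) := by
  obtain ⟨P, hP, Q, hQ, rfl⟩ := Submodule.mem_sup.1 hZ
  rw [Ad_lieExp_inv_add hY hP hQ]
  exact Submodule.add_mem_sup (Submodule.smul_mem _ _ hP) (Submodule.smul_mem _ _ hQ)

lemma lie_eq_neg_smul_Ad_lieExp_inv (hY : α Y = (Real.pi / 2 : ℂ) * I)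
    (hZ : Z ∈ rootSpace α ⊔ rootSpace (-α)) :
    ⁅(Y : LieAlg E G), Z⁆ = -((Real.pi / 2) • Ad (lieExp (Y : LieAlg E G))⁻¹ Z) := by
  obtain ⟨P, hP, Q, hQ, rfl⟩ := Submodule.mem_sup.1 hZ
  rw [Ad_lieExp_inv_add hY hP hQ, lie_add, hP Y, hQ Y, LinearMap.neg_apply, hY, ← Complex.coe_smul]
  push_cast
  module

lemma lie_Ad_lieExp_inv (hY : α Y = (Real.pi / 2 : ℂ) * I)
    (hZ : Z ∈ rootSpace α ⊔ rootSpace (-α)) :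
    ⁅(Y : LieAlg E G), Ad (lieExp (Y : LieAlg E G))⁻¹ Z⁆ = (Real.pi / 2) • Z := by
  obtain ⟨P, hP, Q, hQ, rfl⟩ := Submodule.mem_sup.1 hZ
  rw [Ad_lieExp_inv_add hY hP hQ, lie_add, lie_smul, lie_smul, hP Y, hQ Y, LinearMap.neg_apply, hY,
    smul_smul, smul_smul, ← Complex.coe_smul, smul_add]
  push_cast
  congr 2 <;> linear_combination (-(Real.pi / 2 : ℂ)) * Complex.I_mul_I

lemma B_Ad_lieExp_inv_self (hY : α Y = (Real.pi / 2 : ℂ) * I)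
    (hZ : Z ∈ rootSpace α ⊔ rootSpace (-α)) :
    B (Ad (lieExp (Y : LieAlg E G))⁻¹ Z) (Ad (lieExp (Y : LieAlg E G))⁻¹ Z) = B Z Z := by
  have hinv := killingForm_lie_left (Y : LieAlg E G) Z (Ad (lieExp (Y : LieAlg E G))⁻¹ Z)
  rw [lie_eq_neg_smul_Ad_lieExp_inv hY hZ, lie_Ad_lieExp_inv hY hZ] at hinv
  simp only [map_neg, map_smul, LinearMap.neg_apply, LinearMap.smul_apply, neg_inj,
    smul_eq_mul] at hinv
  exact mul_left_cancel₀ (by positivity) hinv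

lemma B_Ad_lieExp_inv_eq_zero (hY : α Y = (Real.pi / 2 : ℂ) * I)
    (hZ : Z ∈ rootSpace α ⊔ rootSpace (-α)) (hU : ⁅(Y : LieAlg E G), U⁆ = 0) :
    B U (Ad (lieExp (Y : LieAlg E G))⁻¹ Z) = 0 := by
  have hinv := killingForm_lie_left (Y : LieAlg E G) U Z
  rw [lie_eq_neg_smul_Ad_lieExp_inv hY hZ, hU] at hinv
  simp only [map_zero, map_neg, map_smul, LinearMap.zero_apply, neg_neg, smul_eq_mul,
    zero_eq_mul] at hinv
  exact hinv.resolve_left (by positivity)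

/-- `exp Y₀` acts as `-1` on the root spaces of `±α`, and trivially on the centralizer of `𝔱`. -/
theorem isReflectionOn_Ad_lieExp {Y₀ : 𝔱} (hY : α Y = (Real.pi / 2 : ℂ) * I)
    (hY₀ : Complex.exp (α Y₀) = -1) (hZ : Z ∈ rootSpace α ⊔ rootSpace (-α)) (hB : B Z Z ≠ 0)
    {V : Submodule ℝ (LieAlg E G)} (hZV : Z ∈ V)
    (hV : ∀ W ∈ V, ∃ (r : ℝ) (U : LieAlg E G), W = r • Z + U ∧ ∀ X ∈ 𝔱, ⁅X, U⁆ = 0) :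
    IsReflectionOn (Ad (lieExp (Y₀ : LieAlg E G)))
      (V.map ((Ad (lieExp (Y : LieAlg E G))⁻¹).restrictScalars ℝ))
      (Ad (lieExp (Y : LieAlg E G))⁻¹ Z) := by
  have hBZ' := B_Ad_lieExp_inv_self hY hZ
  have htZ : Ad (lieExp (Y₀ : LieAlg E G)) (Ad (lieExp (Y : LieAlg E G))⁻¹ Z) =
      -Ad (lieExp (Y : LieAlg E G))⁻¹ Z :=
    Ad_lieExp_of_exp_eq_neg_one hY₀ (Ad_lieExp_inv_mem hY hZ)
  refine ⟨⟨Z, hZV, rfl⟩, hBZ' ▸ hB, ?_⟩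
  rintro _ ⟨W, hW, rfl⟩
  obtain ⟨r, U, rfl, hU⟩ := hV W hW
  have hYU : Ad (lieExp (Y : LieAlg E G))⁻¹ U = U := by
    rw [← lieExp_neg]
    exact Ad_lieExp_of_lie_eq_zero (by rw [neg_lie, hU Y Y.2, neg_zero])
  have hY₀U : Ad (lieExp (Y₀ : LieAlg E G)) U = U := Ad_lieExp_of_lie_eq_zero (hU Y₀ Y₀.2)
  have hBU := B_Ad_lieExp_inv_eq_zero hY hZ (hU Y Y.2)
  set Z' := Ad (lieExp (Y : LieAlg E G))⁻¹ Z
  have hW' : (Ad (lieExp (Y : LieAlg E G))⁻¹).restrictScalars ℝ (r • Z + U) = r • Z' + U := by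
    rw [map_add, map_smul]
    exact congrArg (r • Z' + ·) hYU
  have hBW : B (r • Z' + U) Z' = r * B Z' Z' := by
    simp only [B, map_add, map_smul, LinearMap.add_apply, LinearMap.smul_apply, smul_eq_mul]
    exact (congrArg _ hBU).trans (add_zero _)
  rw [hW', hBW, map_add, hY₀U, ← mul_assoc, mul_div_cancel_right₀ _ (by rwa [hBZ']),
    ← Complex.coe_smul, map_smul, htZ, ← Complex.coe_smul]
  push_cast
  module

end Reflection

end ComplexLie

open ComplexLie in
theorem lemma7p2_general {E : Type*} [NormedAddCommGroup E] [NormedSpace ℂ E] [CompleteSpace E]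
    [FiniteDimensional ℂ E] {G : Type*} [TopologicalSpace G] [T2Space G]
    [ChartedSpace E G] [Group G] [LieGroup 𝓘(ℂ, E) ω G]
    (D : RealFormData E G) (hnH : ¬ D.IsHermitianType)
    (𝔱 : Submodule ℝ (LieAlg E G)) (h𝔱 : IsMaxAbelianIn 𝔱 (D.𝔨 ⊓ D.𝔮))
    (α : 𝔱 →ₗ[ℝ] ℂ) (hα : IsLongestRoot α) (hmult : Module.finrank ℂ (rootSpace α) = 1)
    (Y : 𝔱) (hY : α Y = (Real.pi / 2 : ℂ) * Complex.I)
    (Z : LieAlg E G) (hZ : Z ∈ rootSpace α ⊔ rootSpace (-α)) (hBZ : B Z Z ≠ 0)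
    (𝔱' : Submodule ℝ (LieAlg E G)) (h𝔱' : ∀ X ∈ 𝔱, ∀ W ∈ 𝔱', ⁅X, W⁆ = 0) :
    ∃ t : G, t ∈ torus 𝔱 ∩ D.H ∧
      (∀ X : 𝔱, lieExp (X : LieAlg E G) = t → Complex.exp (α X) = -1) ∧
      IsReflectionOn (Ad t)
        ((D.𝔧 𝔱' α Z).map ((Ad (lieExp (Y : LieAlg E G))⁻¹).restrictScalars ℝ))
        (Ad (lieExp (Y : LieAlg E G))⁻¹ Z) := by
  obtain ⟨e, he, he0, H, X, hTX, hsl, hH, hHe⟩ :=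
    D.exists_isSl2Triple_of_isLongestRoot hnH h𝔱 hα hmult
  let Y₀ : 𝔱 := ⟨Real.pi • Complex.I • H, 𝔱.smul_mem _ hH⟩
  have hAde : Ad (lieExp (Y₀ : LieAlg E G)) e = -e := by
    have hlie : ⁅(Y₀ : LieAlg E G), e⁆ = (Real.pi * Complex.I : ℂ) • e := by
      rw [smul_lie, smul_lie, hHe, ← Complex.coe_smul, smul_smul]
    rw [Ad_lieExp_of_lie_eq_smul hlie, Complex.exp_pi_mul_I, neg_one_smul]
  have hexp : ∀ X : 𝔱, lieExp (X : LieAlg E G) = lieExp (Y₀ : LieAlg E G) →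
      Complex.exp (α X) = -1 := fun X hX =>
    exp_eq_neg_one_of_Ad_lieExp_eq_neg he he0 (by rw [hX, hAde])
  exact ⟨lieExp (Y₀ : LieAlg E G), ⟨⟨Y₀, rfl⟩, D.lieExp_pi_smul_mem_H hTX hsl⟩, hexp,
    isReflectionOn_Ad_lieExp hY (hexp Y₀ rfl) hZ hBZ D.mem_𝔧_self fun W hW =>
      D.exists_eq_add_of_mem_𝔧 h𝔱.prop.2 h𝔱' hW⟩

open ComplexLie in
theorem lemma7p2 {E : Type*} [NormedAddCommGroup E] [NormedSpace ℂ E] [CompleteSpace E]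
    [FiniteDimensional ℂ E] {G : Type*} [TopologicalSpace G] [T2Space G] [ConnectedSpace G]
    [ChartedSpace E G] [Group G] [LieGroup 𝓘(ℂ, E) ω G]
    (D : RealFormData E G) (hnH : ¬ D.IsHermitianType)
    (𝔱 : Submodule ℝ (LieAlg E G)) (h𝔱 : IsMaxAbelianIn 𝔱 (D.𝔨 ⊓ D.𝔮))
    (α : 𝔱 →ₗ[ℝ] ℂ) (hα : IsLongestRoot α) (hmult : Module.finrank ℂ (rootSpace α) = 1)
    (Yα : 𝔱) (hYα : IsYElement α Yα)
    (Z : LieAlg E G) (hZ : D.IsZElement α Z)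
    (𝔱' : Submodule ℝ (LieAlg E G)) (h𝔱' : IsMaxAbelianIn 𝔱' D.𝔨) (h𝔱𝔱' : 𝔱 ≤ 𝔱') :
    ∃ t : G, t ∈ torus 𝔱 ∩ D.H ∧
      (∀ Y : 𝔱, lieExp (Y : LieAlg E G) = t → Complex.exp (α Y) = -1) ∧
      IsReflectionOn (Ad t)
        ((D.𝔧 𝔱' α Z).map ((Ad (lieExp (Yα : LieAlg E G))⁻¹).restrictScalars ℝ))
        (Ad (lieExp (Yα : LieAlg E G))⁻¹ Z) :=
  lemma7p2_general D hnH 𝔱 h𝔱 α hα hmult Yα hYα.1 Z hZ.2.2.2 (D.B_self_ne_zero_of_mem_𝔪 hZ.2.1 hZ.1)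
    𝔱' fun X hX => h𝔱'.prop.2 X (h𝔱𝔱' hX)
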